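/- Let $d\ge 1$ and let $T$ be a Calderón–Zygmund operator on $\mathbb R^d$: a bounded linear operator on $L^2(\mathbb R^d,\mathbb R)$ with a real kernel $K$ defined off the diagonal, so that $Tf(x)=\int K(x,y)f(y)\,dy$ for a.e. $x\notin\operatorname{supp} f$ whenever $f\in L^2(\mathbb R^d)$ has compact support, where for some constant $C$ $$|K(x,y)|\le \frac{C}{|x-y|^d}\quad(x\ne y),$$ $$|K(x,y)-K(x',y)|+|K(y,x)-K(y,x')|\le C\,\omega\Big(\frac{|x-x'|}{|x-y|}\Big)\frac1{|x-y|^d}\quad\text{for } x\neq y,\ |x-x'|\le |x-y|/2,$$ and $\omega$ is an increasing subadditive function on $[0,\infty)$ with $\omega(0)=0$ and $\int_0^1\omega(t)\,\frac{dt}t<\infty$. For $\epsilon>0$ put $T_\epsilon f(x)=\int_{|x-y|>\epsilon}K(x,y)f(y)\,dy$, and for $\rho\in(2,\infty)$ put $$\mathcal V_\rho(\mathcal T_*f)(x)=\sup_{\epsilon_i\searrow 0}\Big(\sum_{i\ge1}|T_{\epsilon_{i+1}}f(x)-T_{\epsilon_i}f(x)|^\rho\Big)^{1/\rho},$$ the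 supremum being over all sequences of positive numbers that decrease to $0$. Assume that $\mathcal V_\rho(\mathcal T_*)$ is bounded on $L^q(\mathbb R^d)$ for some $q\in(1,\infty)$. Cubes are closed, with sides parallel to the axes and positive side length, and $3Q$ is the cube concentric with $Q$ with three times its side length. For a cube $Q_0$ let $$\mathcal M_{\mathcal V_\rho(\mathcal T_*),Q_0}f(x)=\sup_{Q\ni x,\ Q\subset Q_0}\ \operatorname*{ess\,sup}_{\xi\in Q}\ \mathcal V_\rho\big(\mathcal T_*(f\chi_{3Q_0\setminus 3Q})\big)(\xi)\quad (x\in Q_0),$$ and $\mathcal M_{\mathcal V_\rho(\mathcal T_*),Q_0}f(x)=0$ for $x\notin Q_0$; let also $$\mathcal M_{\mathcal V_\rho(\mathcal T_*)}f(x)=\sup_{Q\ni x}\ \operatorname*{ess\,sup}_{\xi\in Q}\ \mathcal V_\rho\big(\mathcal T_*(f\chi_{\mathbb R^d\setminus 3Q})\big)(\xi)\quad(x\in\mathbb R^d).$$ Then, for every $p\in(1,q]$, $\mathcal M_{\mathcal V_\rho(\mathcal T_*),Q_0}$ is bounded on $L^p(\mathbb R^d)$ with a bound on its norm that does not depend on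 the cube $Q_0$; and $\mathcal M_{\mathcal V_\rho(\mathcal T_*),Q_0}$ is of weak type $(1,1)$ (that is, bounded from $L^1(\mathbb R^d)$ to $L^{1,\infty}(\mathbb R^d)$), with a bound on its norm that does not depend on $Q_0$. Likewise, the global operator $\mathcal M_{\mathcal V_\rho(\mathcal T_*)}$ is bounded on $L^p(\mathbb R^d)$ for every $p\in(1,q]$ and is of weak type $(1,1)$. -/

import Mathlib

open MeasureTheory Set Filter Topology
open scoped NNReal ENNReal

noncomputable section

namespace CZVariation

/-- The space `ℝ^d` with its Euclidean norm and Lebesgue measure. -/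
abbrev Rd (d : ℕ) : Type := EuclideanSpace ℝ (Fin d)

/-- A modulus of continuity on `[0, ∞)` that satisfies the Dini condition. -/
structure IsDiniModulus (ω : ℝ → ℝ) : Prop where
  mono : MonotoneOn ω (Ici 0)
  subadd : ∀ s t : ℝ, 0 ≤ s → 0 ≤ t → ω (s + t) ≤ ω s + ω t
  zero : ω 0 = 0
  dini : IntegrableOn (fun t : ℝ => ω t / t) (Ioc 0 1) volume

/-- Size and smoothness conditions for a kernel off the diagonal, with constant `C` and
modulus `ω`.  The values of `K` on the diagonal play no role. -/
structure IsCZKernel {d : ℕ} (K : Rd d → Rd d → ℝ) (C : ℝ) (ω : ℝ → ℝ) : Prop where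
  size : ∀ x y : Rd d, x ≠ y → |K x y| ≤ C / ‖x - y‖ ^ d
  smooth : ∀ x x' y : Rd d, x ≠ y → ‖x - x'‖ ≤ ‖x - y‖ / 2 →
    |K x y - K x' y| + |K y x - K y x'| ≤
      C * ω (‖x - x'‖ / ‖x - y‖) * (1 / ‖x - y‖ ^ d)

/-- `T` is a (scalar) Calderón–Zygmund operator with kernel `K`: it is a bounded linear operator
on the real space `L²(ℝ^d)`, the kernel satisfies the size and smoothness conditions for some
Dini modulus, and `T f (x) = ∫ K(x, y) f(y) dy` off the support of every compactly supported
`f` in `L²`. -/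
structure IsCZOperator {d : ℕ}
    (T : Lp ℝ 2 (volume : Measure (Rd d)) →L[ℝ] Lp ℝ 2 (volume : Measure (Rd d)))
    (K : Rd d → Rd d → ℝ) : Prop where
  kernel : ∃ (C : ℝ) (ω : ℝ → ℝ), IsDiniModulus ω ∧ IsCZKernel K C ω
  repr : ∀ (f : Rd d → ℝ) (hf : MemLp f 2 volume), HasCompactSupport f →
    ∀ᵐ x : Rd d, x ∉ tsupport f → (T (hf.toLp f)) x = ∫ y, K x y * f y

/-- The truncation `T_ε f (x) = ∫_{|x - y| > ε} K(x, y) f(y) dy`. -/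
def truncation {d : ℕ} (K : Rd d → Rd d → ℝ) (ε : ℝ) (f : Rd d → ℝ) (x : Rd d) : ℝ :=
  ∫ y in {y : Rd d | ε < ‖x - y‖}, K x y * f y

/-- A sequence of positive numbers that decreases to zero. -/
def DecreasesToZero (ε : ℕ → ℝ) : Prop :=
  (∀ i, 0 < ε i) ∧ Antitone ε ∧ Tendsto ε atTop (𝓝 0)

/-- The `ρ`-variation of the family of truncations, with values in `[0, ∞]`. -/
def variation {d : ℕ} (K : Rd d → Rd d → ℝ) (ρ : ℝ) (f : Rd d → ℝ) (x : Rd d) : ℝ≥0∞ :=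
  ⨆ (ε : ℕ → ℝ) (_ : DecreasesToZero ε),
    (∑' i : ℕ, ‖truncation K (ε (i + 1)) f x - truncation K (ε i) f x‖ₑ ^ ρ) ^ (1 / ρ)

/-- The closed cube, with sides parallel to the axes, of centre `c` and side length `l`.
The concentric dilate `3Q` of `Q = cube c l` is `cube c (3 * l)`. -/
def cube {d : ℕ} (c : Rd d) (l : ℝ) : Set (Rd d) :=
  {y | ∀ i, |y i - c i| ≤ l / 2}

/-- The local grand maximal truncated operator of the variation, relative to the cube
`Q₀ = cube c₀ l₀`.  It vanishes off `Q₀`. -/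
def localGrandMaximal {d : ℕ} (K : Rd d → Rd d → ℝ) (ρ : ℝ) (c₀ : Rd d) (l₀ : ℝ)
    (f : Rd d → ℝ) : Rd d → ℝ≥0∞ :=
  (cube c₀ l₀).indicator fun x =>
    ⨆ (c : Rd d) (l : ℝ) (_ : 0 < l) (_ : x ∈ cube c l) (_ : cube c l ⊆ cube c₀ l₀),
      essSup (variation K ρ ((cube c₀ (3 * l₀) \ cube c (3 * l)).indicator f))
        (volume.restrict (cube c l))

/-- The global grand maximal truncated operator of the variation. -/
def grandMaximal {d : ℕ} (K : Rd d → Rd d → ℝ) (ρ : ℝ) (f : Rd d → ℝ) (x : Rd d) : ℝ≥0∞ :=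
  ⨆ (c : Rd d) (l : ℝ) (_ : 0 < l) (_ : x ∈ cube c l),
    essSup (variation K ρ ((cube c (3 * l))ᶜ.indicator f)) (volume.restrict (cube c l))

/-- The operator `S` is bounded on `L^p(ℝ^d)` with norm at most `C`. -/
def BoundedOnLpWith {d : ℕ} (S : (Rd d → ℝ) → Rd d → ℝ≥0∞) (p : ℝ) (C : ℝ≥0) : Prop :=
  ∀ f : Rd d → ℝ, MemLp f (ENNReal.ofReal p) volume →
    AEMeasurable (S f) volume ∧
      eLpNorm (S f) (ENNReal.ofReal p) volume ≤ C * eLpNorm f (ENNReal.ofReal p) volume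

/-- The operator `S` is of weak type `(1,1)` with norm at most `C`. -/
def WeakTypeOneOneWith {d : ℕ} (S : (Rd d → ℝ) → Rd d → ℝ≥0∞) (C : ℝ≥0) : Prop :=
  ∀ f : Rd d → ℝ, MemLp f 1 volume →
    AEMeasurable (S f) volume ∧
      ∀ t : ℝ≥0, t * volume {x | (t : ℝ≥0∞) < S f x} ≤ C * eLpNorm f 1 volume

end CZVariation

end

open CZVariation

/-! The local operator applied to `f` is dominated pointwise by the global one applied to `f
χ_{3Q₀}`, so bounds uniform in `Q₀` follow from bounds for the global operator
(`grandMaximal_bounds`). For the latter one proves a strong `(q,q)` bound and a weak `(1,1)` bound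
and interpolates.

The obstacle is that the variation has no pointwise regularity built in. When the centre moves from
`ξ` to `ξ'` inside a cube `Q` of side `l`, the kernel changes smoothly, but the annuli also shift,
and on the shells where they differ only the size of the kernel is available. The smooth part is
summed over the annuli in `ℓ¹`: they are disjoint, so the Dini condition gives a multiple of the
maximal function `M f`. The shells are summed in `ℓ^r` with `1 < r ≤ ρ`, by the weighted Hölder
inequality `tsum_lintegral_rpow_le` with weight `(l/|x-y|)^{1/2}`. The kernel against the inverse
weight has bounded integral over a shell (`exists_lintegral_shell_le`), because an inverse square
root singularity on a sphere is integrable, and the power of the weight that remains decays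
radially. This yields `exists_variation_le_of_mem_cube`: for `f` cut off outside `3Q`, the variation
oscillates over `Q` by at most `M f + (M |f|^r)^{1/r}`.

The same two mechanisms control a sum of atoms (`exists_variation_atomicSum_le`). An atom inside an
annulus has cancellation and is charged to a Dini tail. An atom that crosses the boundary of an
annulus is handled by a weighted Cauchy–Schwarz inequality in `ℓ²`, which is where `ρ ≥ 2` enters;
the result is the geometric mean of the height of the atoms and the tail. An atom that crosses the
boundary of `3Q` lies at distance comparable to `l`, and all of these together contribute at most
the height. The bound depends only on `x` and not on the cube or the point `ξ` in it, so it serves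
both the variation and the grand maximal operator.

The logic is then a ladder. The assumed `(q,q)` bound and the atomic estimate give weak type `(1,1)`
of the variation, by a Calderón–Zygmund decomposition (`exists_weak_type_one`). Chebyshev's
inequality for `V f` and for `V (f χ_{3Q})` finds a point `ξ'` of `Q` at which both are small;
comparing with it bounds the grand maximal function by `M f + (M |f|^r)^{1/r} + M (V f)`
(`exists_grandMaximal_le`), hence the `(q,q)` bound. Feeding this bound back into
`exists_weak_type_one` gives weak type `(1,1)`, and Marcinkiewicz interpolation covers the exponents
between. -/

noncomputable section

namespace CZVariation

open Metric

/-! ### The centred ball maximal function -/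

/-- The centred maximal function over balls, normalised by `R ^ d`. -/
def ballMaximal {d : ℕ} (u : Rd d → ℝ≥0∞) (x : Rd d) : ℝ≥0∞ :=
  ⨆ (R : ℝ) (_ : 0 < R), (∫⁻ y in closedBall x R, u y) / ENNReal.ofReal (R ^ d)

/-- The volume of the unit ball of `ℝ^d`. -/
def unitBallVolume (d : ℕ) : ℝ≥0∞ := volume (closedBall (0 : Rd d) 1)

theorem unitBallVolume_ne_top (d : ℕ) : unitBallVolume d ≠ ∞ :=
  measure_closedBall_lt_top.ne

theorem unitBallVolume_ne_zero (d : ℕ) : unitBallVolume d ≠ 0 :=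
  (measure_closedBall_pos _ _ one_pos).ne'

theorem volume_closedBall_eq {d : ℕ} (x : Rd d) {R : ℝ} (hR : 0 ≤ R) :
    volume (closedBall x R) = ENNReal.ofReal (R ^ d) * unitBallVolume d := by
  rw [Measure.addHaar_closedBall' _ _ hR, unitBallVolume]
  simp

theorem lintegral_closedBall_le_ballMaximal {d : ℕ} (u : Rd d → ℝ≥0∞) (x : Rd d) {R : ℝ}
    (hR : 0 < R) : ∫⁻ y in closedBall x R, u y ≤ ENNReal.ofReal (R ^ d) * ballMaximal u x := by
  have h : (∫⁻ y in closedBall x R, u y) / ENNReal.ofReal (R ^ d) ≤ ballMaximal u x :=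
    le_iSup₂ (f := fun (R : ℝ) (_ : 0 < R) =>
      (∫⁻ y in closedBall x R, u y) / ENNReal.ofReal (R ^ d)) R hR
  have h0 : ENNReal.ofReal (R ^ d) ≠ 0 := by simpa using pow_pos hR d
  rwa [ENNReal.div_le_iff h0 ENNReal.ofReal_ne_top, mul_comm] at h

theorem lintegral_subset_le_ballMaximal {d : ℕ} (u : Rd d → ℝ≥0∞) {x : Rd d} {R : ℝ}
    (hR : 0 < R) {s : Set (Rd d)} (hs : s ⊆ closedBall x R) :
    ∫⁻ y in s, u y ≤ ENNReal.ofReal (R ^ d) * ballMaximal u x :=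
  (lintegral_mono_set hs).trans (lintegral_closedBall_le_ballMaximal u x hR)

theorem lt_ballMaximal_iff {d : ℕ} {u : Rd d → ℝ≥0∞} {x : Rd d} {t : ℝ≥0∞} :
    t < ballMaximal u x ↔
      ∃ R : ℝ, 0 < R ∧ t * ENNReal.ofReal (R ^ d) < ∫⁻ y in closedBall x R, u y := by
  simp only [ballMaximal, lt_iSup_iff]
  refine exists_congr fun R => ?_
  rw [exists_prop]
  refine and_congr_right fun hR => ?_
  have h0 : ENNReal.ofReal (R ^ d) ≠ 0 := by simpa using pow_pos hR d
  rw [ENNReal.lt_div_iff_mul_lt (Or.inl h0) (Or.inl ENNReal.ofReal_ne_top)]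

theorem ballMaximal_le_of_le {d : ℕ} {u : Rd d → ℝ≥0∞} {a : ℝ≥0∞} (h : ∀ y, u y ≤ a) (x : Rd d) :
    ballMaximal u x ≤ a * unitBallVolume d := by
  refine iSup₂_le fun R hR => ?_
  have h0 : ENNReal.ofReal (R ^ d) ≠ 0 := by simpa using pow_pos hR d
  rw [ENNReal.div_le_iff h0 ENNReal.ofReal_ne_top]
  calc ∫⁻ y in closedBall x R, u y ≤ ∫⁻ _ in closedBall x R, a := lintegral_mono fun y => h y
    _ = a * volume (closedBall x R) := by rw [setLIntegral_const]
    _ = _ := by rw [volume_closedBall_eq x hR.le]; ring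

theorem ballMaximal_add_le {d : ℕ} {u v w : Rd d → ℝ≥0∞} (hu : AEMeasurable u volume)
    (h : ∀ y, w y ≤ u y + v y) (x : Rd d) :
    ballMaximal w x ≤ ballMaximal u x + ballMaximal v x := by
  refine iSup₂_le fun R hR => ?_
  have h0 : ENNReal.ofReal (R ^ d) ≠ 0 := by simpa using pow_pos hR d
  rw [ENNReal.div_le_iff h0 ENNReal.ofReal_ne_top]
  calc ∫⁻ y in closedBall x R, w y ≤ ∫⁻ y in closedBall x R, u y + v y := lintegral_mono h
    _ = (∫⁻ y in closedBall x R, u y) + ∫⁻ y in closedBall x R, v y :=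
        lintegral_add_left' hu.restrict _
    _ ≤ _ := by
        rw [add_mul, mul_comm (ballMaximal u x), mul_comm (ballMaximal v x)]
        exact add_le_add (lintegral_closedBall_le_ballMaximal u x hR)
          (lintegral_closedBall_le_ballMaximal v x hR)

/-- The ball of radius `R` about `x` lies in the ball of radius `R + δ` about any point within `δ`
of `x`, and a strict inequality survives a small increase of the normalising factor. Measurability
of the maximal function thus needs no assumption on `u`. -/
theorem isOpen_lt_ballMaximal {d : ℕ} (u : Rd d → ℝ≥0∞) (t : ℝ≥0∞) :
    IsOpen {x | t < ballMaximal u x} := by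
  rw [Metric.isOpen_iff]
  intro x hx
  obtain ⟨R, hR, hlt⟩ := lt_ballMaximal_iff.1 hx
  have htop : t ≠ ∞ := (lt_of_lt_of_le hx le_top).ne
  have hcont : Tendsto (fun δ : ℝ => t * ENNReal.ofReal ((R + δ) ^ d)) (𝓝[>] 0)
      (𝓝 (t * ENNReal.ofReal (R ^ d))) := by
    refine ENNReal.Tendsto.const_mul ?_ (Or.inr htop)
    refine (ENNReal.continuous_ofReal.tendsto _).comp ?_
    have : Continuous fun δ : ℝ => (R + δ) ^ d := by fun_prop
    simpa using (this.tendsto 0).mono_left nhdsWithin_le_nhds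
  have hev := (hcont.eventually_lt_const hlt).and self_mem_nhdsWithin
  obtain ⟨δ, hδ, hδ0⟩ := hev.exists
  refine ⟨δ, hδ0, fun z hz => ?_⟩
  refine lt_ballMaximal_iff.2 ⟨R + δ, add_pos hR hδ0, hδ.trans_le ?_⟩
  refine lintegral_mono_set fun y hy => ?_
  rw [mem_closedBall] at hy ⊢
  rw [mem_ball'] at hz
  linarith [dist_triangle y x z]

theorem measurable_ballMaximal {d : ℕ} (u : Rd d → ℝ≥0∞) : Measurable (ballMaximal u) :=
  measurable_of_Ioi fun t => (isOpen_lt_ballMaximal u t).measurableSet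

/-- Vitali selection for the superlevel sets of the maximal function: disjoint balls over which
the average is large, whose fivefold dilates cover and have small average. -/
theorem exists_ball_covering {d : ℕ} (hd : 0 < d) {u : Rd d → ℝ≥0∞} (hu : ∫⁻ y, u y ≠ ∞)
    {t : ℝ≥0∞} (ht0 : t ≠ 0) (ht : t ≠ ∞) :
    ∃ J : Set (Rd d × ℝ), J.Countable ∧ (∀ j ∈ J, 0 < j.2) ∧
      (J.PairwiseDisjoint fun j => closedBall j.1 j.2) ∧
      (∀ j ∈ J, t * ENNReal.ofReal (j.2 ^ d) ≤ ∫⁻ y in closedBall j.1 j.2, u y) ∧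
      (∀ j ∈ J, ∫⁻ y in closedBall j.1 (5 * j.2), u y ≤ t * ENNReal.ofReal ((5 * j.2) ^ d)) ∧
      {x | t < ballMaximal u x} ⊆ ⋃ j ∈ J, closedBall j.1 (5 * j.2) := by
  -- Balls at a stopping scale: heavy at level `t`, but no longer heavy after dilation by five.
  set I : Set (Rd d × ℝ) := {j | 0 < j.2 ∧
    t * ENNReal.ofReal (j.2 ^ d) < ∫⁻ y in closedBall j.1 j.2, u y ∧
    ∫⁻ y in closedBall j.1 (5 * j.2), u y ≤ t * ENNReal.ofReal ((5 * j.2) ^ d)} with hI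
  set A : ℝ := (∫⁻ y, u y).toReal / t.toReal with hA
  have htpos : 0 < t.toReal := ENNReal.toReal_pos ht0 ht
  have hbd : ∀ x : Rd d, ∀ r : ℝ, 0 < r →
      t * ENNReal.ofReal (r ^ d) < ∫⁻ y in closedBall x r, u y → r ^ d ≤ A := by
    intro x r hr h
    have h1 := h.le.trans (setLIntegral_le_lintegral _ _)
    have h2 := ENNReal.toReal_mono hu h1
    rw [ENNReal.toReal_mul, ENNReal.toReal_ofReal (by positivity)] at h2
    rw [hA, le_div_iff₀ htpos]
    linarith
  have hA0 : 0 ≤ A := by positivity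
  -- Vitali's lemma needs bounded radii. A heavy ball has `r ^ d ≤ A`, and `r ≤ r ^ d` once `r ≥ 1`,
  -- as `d > 0`.
  have hbd' : ∀ j ∈ I, j.2 ≤ A + 1 := by
    rintro j ⟨h0, h1, -⟩
    by_contra! hcon
    have h3 := hbd j.1 j.2 h0 h1
    have h4 : j.2 ≤ j.2 ^ d := le_self_pow₀ (by linarith) hd.ne'
    linarith
  obtain ⟨J, hJI, hdisj, hcov⟩ := Vitali.exists_disjoint_subfamily_covering_enlargement_closedBall
    I (fun j => j.1) (fun j => j.2) (A + 1) hbd' 5 (by norm_num)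
  refine ⟨J, ?_, fun j hj => (hJI hj).1, hdisj, fun j hj => (hJI hj).2.1.le,
    fun j hj => (hJI hj).2.2, ?_⟩
  · have : J.PairwiseDisjoint fun j => ball j.1 j.2 :=
      hdisj.mono fun j => ball_subset_closedBall
    exact this.countable_of_isOpen (fun j _ => isOpen_ball)
      fun j hj => nonempty_ball.2 (hJI hj).1
  · intro x hx
    obtain ⟨R, hR, hlt⟩ := lt_ballMaximal_iff.1 hx
    -- A heavy ball about `x` stays heavy under only finitely many dilations by five, since the mass
    -- is finite; the last heavy one is at the stopping scale.
    have hex : ∃ n : ℕ, ¬ (t * ENNReal.ofReal ((5 ^ n * R) ^ d) <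
        ∫⁻ y in closedBall x (5 ^ n * R), u y) := by
      by_contra! hcon
      have hlim : Tendsto (fun n : ℕ => (5 : ℝ) ^ n * R) atTop atTop :=
        (tendsto_pow_atTop_atTop_of_one_lt (by norm_num)).atTop_mul_const hR
      obtain ⟨n, hn⟩ := (hlim.eventually_gt_atTop (A + 1)).exists
      have h3 := hbd x _ (by positivity) (hcon n)
      have h4 : (5 : ℝ) ^ n * R ≤ (5 ^ n * R) ^ d := le_self_pow₀ (by linarith) hd.ne'
      linarith
    classical
    have hn := Nat.find_spec hex
    have hn0 : Nat.find hex ≠ 0 := fun h0 => by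
      rw [h0] at hn
      simp only [pow_zero, one_mul] at hn
      exact hn hlt
    obtain ⟨m, hm⟩ := Nat.exists_eq_succ_of_ne_zero hn0
    have hm' := Nat.find_min hex (m := m) (by omega)
    rw [not_not] at hm'
    rw [hm, not_lt, Nat.succ_eq_add_one] at hn
    have hmem : ((x, 5 ^ m * R) : Rd d × ℝ) ∈ I := by
      refine ⟨by positivity, hm', ?_⟩
      have : (5 : ℝ) * (5 ^ m * R) = 5 ^ (m + 1) * R := by ring
      simpa only [this] using hn
    obtain ⟨b, hb, hsub⟩ := hcov _ hmem
    exact mem_biUnion hb (hsub (mem_closedBall_self (by positivity)))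

/-- The weak type `(1,1)` inequality of the maximal function. -/
theorem volume_lt_ballMaximal_le {d : ℕ} (hd : 0 < d) (u : Rd d → ℝ≥0∞) (t : ℝ≥0∞) :
    t * volume {x | t < ballMaximal u x} ≤
      unitBallVolume d * 5 ^ d * ∫⁻ y, u y := by
  rcases eq_or_ne t 0 with rfl | ht0
  · simp
  rcases eq_or_ne t ∞ with rfl | ht
  · simp
  by_cases hu : ∫⁻ y, u y = ∞
  · rw [hu, ENNReal.mul_top]
    · exact le_top
    · exact mul_ne_zero (unitBallVolume_ne_zero d) (by simp)
  obtain ⟨J, hJ, hpos, hdisj, hlow, -, hcov⟩ := exists_ball_covering hd hu ht0 ht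
  calc t * volume {x | t < ballMaximal u x}
      ≤ t * volume (⋃ j ∈ J, closedBall j.1 (5 * j.2)) := by gcongr
    _ ≤ t * ∑' j : J, volume (closedBall j.1.1 (5 * j.1.2)) := by
        gcongr
        exact measure_biUnion_le _ hJ _
    _ = ∑' j : J, unitBallVolume d * 5 ^ d * (t * ENNReal.ofReal (j.1.2 ^ d)) := by
        rw [← ENNReal.tsum_mul_left]
        congr 1
        ext j
        have := hpos j.1 j.2
        rw [volume_closedBall_eq _ (by positivity), mul_pow,
          ENNReal.ofReal_mul (by positivity), ENNReal.ofReal_pow (by norm_num)]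
        simp
        ring
    _ ≤ ∑' j : J, unitBallVolume d * 5 ^ d * ∫⁻ y in closedBall j.1.1 j.1.2, u y :=
        ENNReal.tsum_le_tsum fun j => mul_le_mul_right (hlow j.1 j.2) _
    _ = unitBallVolume d * 5 ^ d * ∫⁻ y in ⋃ j ∈ J, closedBall j.1 j.2, u y := by
        rw [ENNReal.tsum_mul_left, lintegral_biUnion hJ (fun j _ => measurableSet_closedBall) hdisj]
    _ ≤ _ := by
        gcongr
        exact Measure.restrict_le_self

/-! ### Marcinkiewicz interpolation -/

/-- The inner integral left by Tonelli's theorem in the interpolation argument. Both sides are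
infinite for `a = ∞`, so the layer-cake formula also covers points where the function is infinite.
-/
theorem setLIntegral_rpow_lt {s : ℝ} (hs : -1 < s) (a : ℝ≥0∞) :
    ∫⁻ t in Ioi 0 ∩ {t : ℝ | ENNReal.ofReal t < a}, ENNReal.ofReal (t ^ s) =
      a ^ (s + 1) * ENNReal.ofReal (1 / (s + 1)) := by
  have key : ∀ A : ℝ, 0 ≤ A → ∫⁻ t in Ioc 0 A, ENNReal.ofReal (t ^ s) =
      ENNReal.ofReal A ^ (s + 1) * ENNReal.ofReal (1 / (s + 1)) := by
    intro A hA
    rw [← ofReal_integral_eq_lintegral_ofReal, ← intervalIntegral.integral_of_le hA,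
      integral_rpow (Or.inl hs), Real.zero_rpow (by linarith), sub_zero,
      ENNReal.ofReal_rpow_of_nonneg hA (by linarith), ← ENNReal.ofReal_mul (by positivity)]
    · congr 1; ring
    · have := intervalIntegral.intervalIntegrable_rpow' (a := 0) (b := A) hs
      exact (intervalIntegrable_iff_integrableOn_Ioc_of_le hA).1 this
    · refine (ae_restrict_iff' measurableSet_Ioc).2 (ae_of_all _ fun t ht => ?_)
      exact Real.rpow_nonneg ht.1.le _
  rcases eq_or_ne a ∞ with rfl | ha
  · rw [ENNReal.top_rpow_of_pos (by linarith), ENNReal.top_mul]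
    · refine ENNReal.eq_top_of_forall_nnreal_le fun r => ?_
      have hlim : Tendsto (fun A : ℝ =>
          ENNReal.ofReal (A ^ (s + 1) * (1 / (s + 1)))) atTop (𝓝 ∞) :=
        ENNReal.tendsto_ofReal_atTop.comp
          ((tendsto_rpow_atTop (by linarith)).atTop_mul_const (by
            have : 0 < s + 1 := by linarith
            positivity))
      obtain ⟨A, hA, hA0⟩ := ((hlim.eventually (eventually_gt_nhds
        (ENNReal.coe_lt_top (r := r)))).and (eventually_ge_atTop 0)).exists
      rw [ENNReal.ofReal_mul (by positivity),
        ← ENNReal.ofReal_rpow_of_nonneg hA0 (by linarith), ← key A hA0] at hA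
      refine hA.le.trans (lintegral_mono_set fun t ht => ⟨ht.1, by simp⟩)
    · have : 0 < s + 1 := by linarith
      simpa using this
  · have hae : (Ioi 0 ∩ {t : ℝ | ENNReal.ofReal t < a} : Set ℝ) =ᵐ[volume] Ioc 0 a.toReal := by
      have : (Ioi 0 ∩ {t : ℝ | ENNReal.ofReal t < a} : Set ℝ) = Ioo 0 a.toReal := by
        ext t
        simp only [mem_inter_iff, mem_Ioi, mem_ofPred_eq, mem_Ioo]
        refine and_congr_right fun h => ?_
        rw [ENNReal.ofReal_lt_iff_lt_toReal h.le ha]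
      rw [this]
      exact Ioo_ae_eq_Ioc
    rw [setLIntegral_congr hae, key _ ENNReal.toReal_nonneg, ENNReal.ofReal_toReal ha]

theorem setLIntegral_rpow_ge {s : ℝ} (hs : s < -1) {a : ℝ≥0∞} (h0 : a ≠ 0) (ha : a ≠ ∞) :
    ∫⁻ t in Ioi 0 ∩ {t : ℝ | a ≤ ENNReal.ofReal t}, ENNReal.ofReal (t ^ s) =
      a ^ (s + 1) * ENNReal.ofReal (1 / (-(s + 1))) := by
  have hpos : 0 < a.toReal := ENNReal.toReal_pos h0 ha
  have hae : (Ioi 0 ∩ {t : ℝ | a ≤ ENNReal.ofReal t} : Set ℝ) =ᵐ[volume] Ioi a.toReal := by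
    have : (Ioi 0 ∩ {t : ℝ | a ≤ ENNReal.ofReal t} : Set ℝ) = Ici a.toReal := by
      ext t
      simp only [mem_inter_iff, mem_Ioi, mem_ofPred_eq, mem_Ici]
      constructor
      · rintro ⟨h, h'⟩
        exact (ENNReal.le_ofReal_iff_toReal_le ha h.le).1 h'
      · intro h
        have h1 : 0 < t := hpos.trans_le h
        exact ⟨h1, (ENNReal.le_ofReal_iff_toReal_le ha h1.le).2 h⟩
    rw [this]
    exact Ioi_ae_eq_Ici.symm
  rw [setLIntegral_congr hae, ← ofReal_integral_eq_lintegral_ofReal,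
    integral_Ioi_rpow_of_lt hs hpos]
  · nth_rewrite 2 [← ENNReal.ofReal_toReal ha]
    rw [ENNReal.ofReal_rpow_of_pos hpos, ← ENNReal.ofReal_mul (by positivity)]
    congr 1
    have : s + 1 ≠ 0 := by linarith
    field_simp
  · exact integrableOn_Ioi_rpow_of_lt hs hpos
  · refine (ae_restrict_iff' measurableSet_Ioi).2 (ae_of_all _ fun t ht => ?_)
    exact Real.rpow_nonneg (hpos.trans ht).le _

theorem setLIntegral_inter_eq_lintegral_ite {α : Type*} [MeasurableSpace α] {μ : Measure α}
    {s : Set α} (P : α → Prop) [DecidablePred P] (hP : MeasurableSet {a | P a}) (f : α → ℝ≥0∞) :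
    ∫⁻ a in s ∩ {a | P a}, f a ∂μ = ∫⁻ a in s, (if P a then f a else 0) ∂μ := by
  rw [inter_comm, ← Measure.restrict_restrict hP, ← lintegral_indicator hP]
  congr 1
  ext a
  by_cases h : P a <;> simp [h]

/-- The Marcinkiewicz interpolation argument between weak type `(1,1)` and weak type `(q,q)`,
in terms of the distribution function. -/
theorem lintegral_rpow_le_of_measurable {α : Type*} [MeasurableSpace α] {μ : Measure α}
    [SFinite μ] {F u : α → ℝ≥0∞} (hF : Measurable F) (hu : Measurable u) {p q : ℝ} (hp : 1 < p)
    (hpq : p < q) {A B : ℝ≥0∞}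
    (h : ∀ t : ℝ, 0 < t → μ {x | ENNReal.ofReal t < F x} ≤
      A * ENNReal.ofReal (t ^ (-1 : ℝ)) * (∫⁻ x in {x | ENNReal.ofReal t < u x}, u x ∂μ) +
      B * ENNReal.ofReal (t ^ (-q)) * ∫⁻ x in {x | u x ≤ ENNReal.ofReal t}, u x ^ q ∂μ) :
    ∫⁻ x, F x ^ p ∂μ ≤ ENNReal.ofReal p *
      (A * ENNReal.ofReal (1 / (p - 1)) + B * ENNReal.ofReal (1 / (q - p))) *
        ∫⁻ x, u x ^ p ∂μ := by
  classical
  have hm1 : ∀ s : ℝ, Measurable fun t : ℝ => ENNReal.ofReal (t ^ s) := fun s => by fun_prop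
  have hlt : ∀ G : α → ℝ≥0∞, Measurable G → MeasurableSet
      {z : α × ℝ | ENNReal.ofReal z.2 < G z.1} := fun G hG =>
    measurableSet_lt (by fun_prop) (by fun_prop)
  have hle : MeasurableSet {z : α × ℝ | u z.1 ≤ ENNReal.ofReal z.2} :=
    measurableSet_le (by fun_prop) (by fun_prop)
  -- Tonelli's theorem in the one form needed for the layer-cake formula of `F` and for the two
  -- parts of `u`.
  have hswap : ∀ (P : α → ℝ → Prop) [∀ x t, Decidable (P x t)],
      MeasurableSet {z : α × ℝ | P z.1 z.2} → ∀ (s : ℝ) (v : α → ℝ≥0∞), Measurable v →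
      ∫⁻ x, v x * (∫⁻ t in Ioi (0 : ℝ) ∩ {t | P x t}, ENNReal.ofReal (t ^ s)) ∂μ =
      ∫⁻ t in Ioi (0 : ℝ), ENNReal.ofReal (t ^ s) * ∫⁻ x in {x | P x t}, v x ∂μ := by
    intro P _ hP s v hv
    have hP1 : ∀ x, MeasurableSet {t | P x t} := fun x => measurable_prodMk_left hP
    have hP2 : ∀ t, MeasurableSet {x | P x t} := fun t => measurable_prodMk_right hP
    calc _ = ∫⁻ x, (∫⁻ t in Ioi (0 : ℝ), (if P x t then v x * ENNReal.ofReal (t ^ s) else 0)) ∂μ := by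
          refine lintegral_congr fun x => ?_
          rw [setLIntegral_inter_eq_lintegral_ite _ (hP1 x), ← lintegral_const_mul]
          · simp only [mul_ite, mul_zero]
          · exact Measurable.ite (hP1 x) (hm1 s) measurable_const
      _ = ∫⁻ t in Ioi (0 : ℝ), ∫⁻ x, (if P x t then v x * ENNReal.ofReal (t ^ s) else 0) ∂μ := by
          rw [lintegral_lintegral_swap]
          refine (Measurable.ite hP ?_ measurable_const).aemeasurable
          exact (hv.comp measurable_fst).mul ((hm1 s).comp measurable_snd)
      _ = _ := by
          refine lintegral_congr fun t => ?_
          rw [← lintegral_const_mul _ hv, ← lintegral_indicator (hP2 t)]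
          refine lintegral_congr fun x => ?_
          by_cases hx : P x t
          · simp [hx, mul_comm]
          · simp [hx]
  have hFp : ∀ x, F x ^ p = ENNReal.ofReal p * (1 *
      ∫⁻ t in Ioi 0 ∩ {t : ℝ | ENNReal.ofReal t < F x}, ENNReal.ofReal (t ^ (p - 1))) := by
    intro x
    rw [setLIntegral_rpow_lt (by linarith), sub_add_cancel, one_mul, mul_comm, mul_assoc,
      ← ENNReal.ofReal_mul (by positivity)]
    rw [one_div_mul_cancel (by positivity)]
    simp
  calc ∫⁻ x, F x ^ p ∂μ
      = ENNReal.ofReal p * ∫⁻ t in Ioi (0 : ℝ), ENNReal.ofReal (t ^ (p - 1)) *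
          ∫⁻ x in {x | ENNReal.ofReal t < F x}, 1 ∂μ := by
        simp_rw [hFp]
        rw [lintegral_const_mul', hswap _ (hlt F hF) _ _ measurable_const]
        exact ENNReal.ofReal_ne_top
    _ ≤ ENNReal.ofReal p * ∫⁻ t in Ioi (0 : ℝ),
          (A * (ENNReal.ofReal (t ^ (p - 2)) * ∫⁻ x in {x | ENNReal.ofReal t < u x}, u x ∂μ) +
          B * (ENNReal.ofReal (t ^ (p - 1 - q)) *
            ∫⁻ x in {x | u x ≤ ENNReal.ofReal t}, u x ^ q ∂μ)) := by
        gcongr ENNReal.ofReal p * ?_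
        refine setLIntegral_mono' measurableSet_Ioi fun t ht => ?_
        have ht0 : 0 < t := ht
        rw [setLIntegral_one]
        refine (mul_le_mul_right (h t ht0) _).trans (le_of_eq ?_)
        have e1 : ENNReal.ofReal (t ^ (p - 2)) =
            ENNReal.ofReal (t ^ (p - 1)) * ENNReal.ofReal (t ^ (-1 : ℝ)) := by
          rw [← ENNReal.ofReal_mul (by positivity), ← Real.rpow_add ht0]
          congr 2; ring
        have e2 : ENNReal.ofReal (t ^ (p - 1 - q)) =
            ENNReal.ofReal (t ^ (p - 1)) * ENNReal.ofReal (t ^ (-q)) := by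
          rw [← ENNReal.ofReal_mul (by positivity), ← Real.rpow_add ht0]
          congr 2
        rw [e1, e2]
        ring
    _ ≤ ENNReal.ofReal p * (A * (∫⁻ x, u x *
          (∫⁻ t in Ioi (0 : ℝ) ∩ {t | ENNReal.ofReal t < u x}, ENNReal.ofReal (t ^ (p - 2))) ∂μ) +
          B * ∫⁻ x, u x ^ q *
          (∫⁻ t in Ioi (0 : ℝ) ∩ {t | u x ≤ ENNReal.ofReal t},
            ENNReal.ofReal (t ^ (p - 1 - q))) ∂μ) := by
        rw [hswap _ (hlt u hu) _ _ hu, hswap _ hle _ _ (hu.pow_const q)]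
        gcongr ENNReal.ofReal p * ?_
        have hmA : Measurable fun t : ℝ =>
            ENNReal.ofReal (t ^ (p - 2)) * ∫⁻ x in {x | ENNReal.ofReal t < u x}, u x ∂μ := by
          refine (hm1 _).mul ?_
          have : (fun t : ℝ => ∫⁻ x in {x | ENNReal.ofReal t < u x}, u x ∂μ) = fun t =>
              ∫⁻ x, (if ENNReal.ofReal t < u x then u x else 0) ∂μ := by
            ext t
            have hm : MeasurableSet {x | ENNReal.ofReal t < u x} :=
              measurableSet_lt measurable_const hu
            rw [← lintegral_indicator hm]
            refine lintegral_congr fun x => ?_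
            by_cases h : ENNReal.ofReal t < u x <;> simp [h]
          rw [this]
          refine Measurable.lintegral_prod_right' (f := fun z : ℝ × α =>
            if ENNReal.ofReal z.1 < u z.2 then u z.2 else 0) ?_
          exact Measurable.ite (measurableSet_lt (by fun_prop) (by fun_prop))
            (by fun_prop) measurable_const
        have hmB : Measurable fun t : ℝ => ENNReal.ofReal (t ^ (p - 1 - q)) *
            ∫⁻ x in {x | u x ≤ ENNReal.ofReal t}, u x ^ q ∂μ := by
          refine (hm1 _).mul ?_
          have : (fun t : ℝ => ∫⁻ x in {x | u x ≤ ENNReal.ofReal t}, u x ^ q ∂μ) = fun t =>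
              ∫⁻ x, (if u x ≤ ENNReal.ofReal t then u x ^ q else 0) ∂μ := by
            ext t
            have hm : MeasurableSet {x | u x ≤ ENNReal.ofReal t} :=
              measurableSet_le hu measurable_const
            rw [← lintegral_indicator hm]
            refine lintegral_congr fun x => ?_
            by_cases h : u x ≤ ENNReal.ofReal t <;> simp [h]
          rw [this]
          refine Measurable.lintegral_prod_right' (f := fun z : ℝ × α =>
            if u z.2 ≤ ENNReal.ofReal z.1 then u z.2 ^ q else 0) ?_
          exact Measurable.ite (measurableSet_le (by fun_prop) (by fun_prop))
            (by fun_prop) measurable_const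
        rw [lintegral_add_left (hmA.const_mul A), lintegral_const_mul _ hmA,
          lintegral_const_mul _ hmB]
    _ ≤ ENNReal.ofReal p * (A * (∫⁻ x, u x ^ p * ENNReal.ofReal (1 / (p - 1)) ∂μ) +
          B * ∫⁻ x, u x ^ p * ENNReal.ofReal (1 / (q - p)) ∂μ) := by
        refine mul_le_mul_right (add_le_add (mul_le_mul_right (lintegral_mono fun x => ?_) _)
          (mul_le_mul_right (lintegral_mono fun x => ?_) _)) _
        · dsimp only
          rw [setLIntegral_rpow_lt (by linarith), ← mul_assoc]
          refine mul_le_mul' ?_ (le_of_eq (by ring_nf))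
          nth_rewrite 1 [← ENNReal.rpow_one (u x)]
          rw [← ENNReal.rpow_add_of_nonneg _ _ (by norm_num) (by linarith)]
          exact le_of_eq (by ring_nf)
        · rcases eq_or_ne (u x) 0 with h0 | h0
          · rw [h0, ENNReal.zero_rpow_of_pos (by linarith)]; simp
          rcases eq_or_ne (u x) ∞ with h1 | h1
          · rw [h1]; simp
          rw [setLIntegral_rpow_ge (by linarith) h0 h1, ← mul_assoc]
          refine mul_le_mul' ?_ (le_of_eq (by ring_nf))
          rw [← ENNReal.rpow_add _ _ h0 h1]
          exact le_of_eq (by ring_nf)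
    _ = _ := by
        rw [lintegral_mul_const' _ _ ENNReal.ofReal_ne_top,
          lintegral_mul_const' _ _ ENNReal.ofReal_ne_top]
        ring

theorem lintegral_rpow_le_of_distribution {α : Type*} [MeasurableSpace α] {μ : Measure α}
    [SFinite μ] {F u : α → ℝ≥0∞} (hF : AEMeasurable F μ) (hu : AEMeasurable u μ) {p q : ℝ}
    (hp : 1 < p) (hpq : p < q) {A B : ℝ≥0∞}
    (h : ∀ t : ℝ, 0 < t → μ {x | ENNReal.ofReal t < F x} ≤
      A * ENNReal.ofReal (t ^ (-1 : ℝ)) * (∫⁻ x in {x | ENNReal.ofReal t < u x}, u x ∂μ) +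
      B * ENNReal.ofReal (t ^ (-q)) * ∫⁻ x in {x | u x ≤ ENNReal.ofReal t}, u x ^ q ∂μ) :
    ∫⁻ x, F x ^ p ∂μ ≤ ENNReal.ofReal p *
      (A * ENNReal.ofReal (1 / (p - 1)) + B * ENNReal.ofReal (1 / (q - p))) *
        ∫⁻ x, u x ^ p ∂μ := by
  have e1 : ∫⁻ x, F x ^ p ∂μ = ∫⁻ x, hF.mk F x ^ p ∂μ :=
    lintegral_congr_ae (hF.ae_eq_mk.mono fun x hx => by simp only [hx])
  have e2 : ∫⁻ x, u x ^ p ∂μ = ∫⁻ x, hu.mk u x ^ p ∂μ :=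
    lintegral_congr_ae (hu.ae_eq_mk.mono fun x hx => by simp only [hx])
  rw [e1, e2]
  refine lintegral_rpow_le_of_measurable hF.measurable_mk hu.measurable_mk hp hpq fun t ht => ?_
  have s0 : {x | ENNReal.ofReal t < hF.mk F x} =ᵐ[μ] {x | ENNReal.ofReal t < F x} :=
    eventuallyEq_set.2 (hF.ae_eq_mk.mono fun x hx => by simp [hx])
  have s1 : {x | ENNReal.ofReal t < hu.mk u x} =ᵐ[μ] {x | ENNReal.ofReal t < u x} :=
    eventuallyEq_set.2 (hu.ae_eq_mk.mono fun x hx => by simp [hx])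
  have s2 : {x | hu.mk u x ≤ ENNReal.ofReal t} =ᵐ[μ] {x | u x ≤ ENNReal.ofReal t} :=
    eventuallyEq_set.2 (hu.ae_eq_mk.mono fun x hx => by simp [hx])
  rw [measure_congr s0, setLIntegral_congr s1, setLIntegral_congr s2]
  refine (h t ht).trans (le_of_eq ?_)
  congr 2
  · exact lintegral_congr_ae (ae_restrict_of_ae hu.ae_eq_mk)
  · exact lintegral_congr_ae (ae_restrict_of_ae (hu.ae_eq_mk.mono fun x hx => by simp only [hx]))

/-- The maximal function is bounded on `L^p`, `1 < p`. -/
theorem exists_lintegral_ballMaximal_rpow_le {d : ℕ} (hd : 0 < d) {p : ℝ} (hp : 1 < p) :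
    ∃ C : ℝ≥0, ∀ u : Rd d → ℝ≥0∞, AEMeasurable u volume →
      ∫⁻ x, ballMaximal u x ^ p ≤ C * ∫⁻ x, u x ^ p := by
  set v := unitBallVolume d with hv
  have hvt : v ≠ ∞ := unitBallVolume_ne_top d
  set A : ℝ≥0∞ := v * 5 ^ d with hA
  have hAt : A ≠ ∞ := ENNReal.mul_ne_top hvt (by simp)
  -- The part of `u` below `τ` has maximal function at most `τ v`, as the normalisation is by `R ^
  -- d`. Hence the maximal function of `u` exceeds `(1 + v) τ` only where that of the part above `τ`
  -- exceeds `τ`.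
  set c : ℝ≥0∞ := 1 + v with hc
  have hc0 : c ≠ 0 := by simp [hc]
  have hct : c ≠ ∞ := by simp [hc, hvt]
  -- The term of the upper exponent has coefficient zero, so `p + 1` is an arbitrary choice of that
  -- exponent.
  set D : ℝ≥0∞ := c ^ p * (ENNReal.ofReal p * (A * ENNReal.ofReal (1 / (p - 1)) +
    0 * ENNReal.ofReal (1 / (p + 1 - p)))) with hD
  have hDt : D ≠ ∞ := by
    refine ENNReal.mul_ne_top (ENNReal.rpow_ne_top_of_nonneg (by linarith) hct) ?_
    refine ENNReal.mul_ne_top ENNReal.ofReal_ne_top ?_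
    rw [zero_mul, add_zero]
    exact ENNReal.mul_ne_top hAt ENNReal.ofReal_ne_top
  refine ⟨D.toNNReal, fun u hu => ?_⟩
  rw [ENNReal.coe_toNNReal hDt]
  have key : ∫⁻ x, (c⁻¹ * ballMaximal u x) ^ p ≤ ENNReal.ofReal p *
      (A * ENNReal.ofReal (1 / (p - 1)) + 0 * ENNReal.ofReal (1 / (p + 1 - p))) *
        ∫⁻ x, u x ^ p := by
    refine lintegral_rpow_le_of_distribution
      ((measurable_ballMaximal u).const_mul _).aemeasurable hu hp (lt_add_one p) fun t ht => ?_
    set τ := ENNReal.ofReal t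
    have hτ0 : τ ≠ 0 := by simpa [τ] using ht
    have hτt : τ ≠ ∞ := ENNReal.ofReal_ne_top
    have hns : NullMeasurableSet {x | τ < u x} volume := nullMeasurableSet_lt (by fun_prop) hu
    have hsub : {x | τ < c⁻¹ * ballMaximal u x} ⊆
        {x | τ < ballMaximal ({x | τ < u x}.indicator u) x} := by
      intro x hx
      simp only [mem_ofPred_eq] at hx ⊢
      by_contra! hcon
      refine hx.not_ge ?_
      rw [mul_comm, ← div_eq_mul_inv, ENNReal.div_le_iff hc0 hct]
      calc ballMaximal u x ≤ ballMaximal ({x | τ < u x}.indicator u) x +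
            ballMaximal ({x | τ < u x}ᶜ.indicator u) x :=
            ballMaximal_add_le (hu.indicator₀ hns)
              (fun y => by rw [← Pi.add_apply, indicator_self_add_compl]) x
        _ ≤ τ + τ * v := by
            refine add_le_add hcon (ballMaximal_le_of_le (fun y => ?_) x)
            by_cases hy : τ < u y
            · simp [hy]
            · rw [indicator_of_mem (show y ∈ {x | τ < u x}ᶜ from hy)]
              exact not_lt.1 hy
        _ = τ * c := by rw [hc]; ring
    rw [zero_mul, zero_mul, add_zero]
    refine (measure_mono hsub).trans ?_
    have hw := volume_lt_ballMaximal_le hd ({x | τ < u x}.indicator u) τ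
    rw [lintegral_indicator₀ hns, mul_comm, ← ENNReal.le_div_iff_mul_le (Or.inl hτ0) (Or.inl hτt)]
      at hw
    refine hw.trans (le_of_eq ?_)
    rw [Real.rpow_neg_one, ENNReal.ofReal_inv_of_pos ht, div_eq_mul_inv]
    ring
  calc ∫⁻ x, ballMaximal u x ^ p = ∫⁻ x, c ^ p * (c⁻¹ * ballMaximal u x) ^ p := by
        refine lintegral_congr fun x => ?_
        rw [← ENNReal.mul_rpow_of_nonneg _ _ (by linarith), ← mul_assoc,
          ENNReal.mul_inv_cancel hc0 hct, one_mul]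
    _ = c ^ p * ∫⁻ x, (c⁻¹ * ballMaximal u x) ^ p :=
        lintegral_const_mul' _ _ (ENNReal.rpow_ne_top_of_nonneg (by linarith) hct)
    _ ≤ c ^ p * _ := mul_le_mul_right key _
    _ = _ := by rw [hD]; ring

/-! ### Cubes -/

theorem measurableSet_cube {d : ℕ} (c : Rd d) (l : ℝ) : MeasurableSet (cube c l) := by
  have : cube c l = ⋂ i, {y : Rd d | |y i - c i| ≤ l / 2} := by ext; simp [cube]
  rw [this]
  exact MeasurableSet.iInter fun i => (isClosed_le (by fun_prop) (by fun_prop)).measurableSet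

/-- Passing from the largest coordinate to the Euclidean norm costs `√d`, here estimated by `d`. -/
theorem norm_sub_le_of_mem_cube {d : ℕ} {c x y : Rd d} {l m : ℝ}
    (hx : x ∈ cube c l) (hy : y ∈ cube c m) : ‖x - y‖ ≤ d * ((l + m) / 2) := by
  rcases Nat.eq_zero_or_pos d with rfl | hd
  · have : x - y = 0 := Subsingleton.elim _ _
    simp [this]
  have hc : ∀ i, |(x - y) i| ≤ (l + m) / 2 := fun i => by
    have h1 := hx i
    have h2 := hy i
    have : (x - y) i = (x i - c i) - (y i - c i) := by simp
    rw [this]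
    linarith [abs_sub (x i - c i) (y i - c i)]
  have h0 : 0 ≤ (l + m) / 2 := (abs_nonneg _).trans (hc ⟨0, hd⟩)
  calc ‖x - y‖ = √(∑ i, ‖(x - y) i‖ ^ 2) := EuclideanSpace.norm_eq _
    _ ≤ √(∑ i : Fin d, ((d : ℝ) * ((l + m) / 2) ^ 2)) := by
        refine Real.sqrt_le_sqrt (Finset.sum_le_sum fun i _ => ?_)
        have h1 : (1 : ℝ) ≤ d := by exact_mod_cast hd
        have h2 : ‖(x - y) i‖ ^ 2 ≤ ((l + m) / 2) ^ 2 := by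
          have := hc i
          rw [← Real.norm_eq_abs] at this
          gcongr
        nlinarith [sq_nonneg ((l + m) / 2)]
    _ = √((d * ((l + m) / 2)) ^ 2) := by
        congr 1
        simp
        ring
    _ = _ := Real.sqrt_sq (by positivity)

theorem le_norm_sub_of_notMem_cube {d : ℕ} {c x y : Rd d} {l : ℝ}
    (hx : x ∈ cube c l) (hy : y ∉ cube c (3 * l)) : l ≤ ‖x - y‖ := by
  simp only [cube, mem_ofPred_eq, not_forall, not_le] at hy
  obtain ⟨i, hi⟩ := hy
  have h1 := hx i
  have h2 : ‖(x - y) i‖ ≤ ‖x - y‖ := PiLp.norm_apply_le (x - y) i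
  have h3 : (y i - c i) = (x i - c i) - (x - y) i := by simp
  rw [h3] at hi
  rw [Real.norm_eq_abs] at h2
  linarith [abs_sub (x i - c i) ((x - y) i)]

theorem closedBall_subset_cube {d : ℕ} (c : Rd d) (l : ℝ) : closedBall c (l / 2) ⊆ cube c l := by
  intro y hy i
  rw [mem_closedBall, dist_eq_norm] at hy
  have h2 : ‖(y - c) i‖ ≤ ‖y - c‖ := PiLp.norm_apply_le (y - c) i
  rw [Real.norm_eq_abs] at h2
  simpa using h2.trans hy

/-- An uncountable union of closed cubes need not be Borel, but it differs from the union `U` of the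
open cubes by a null set. A point of a closed cube that is not in `U` sees, at every small scale, a
ball inside the open cube of radius comparable to its distance from the point; so it is not a
density point of `Uᶜ`. -/
theorem nullMeasurableSet_biUnion_cube {d : ℕ} (S : Set (Rd d × ℝ)) (hS : ∀ j ∈ S, 0 < j.2) :
    NullMeasurableSet (⋃ j ∈ S, cube j.1 j.2) volume := by
  set U : Set (Rd d) := ⋃ j ∈ S, {y | ∀ i, |y i - j.1 i| < j.2 / 2} with hU
  have hUo : IsOpen U := by
    refine isOpen_biUnion fun j _ => ?_
    have : {y : Rd d | ∀ i, |y i - j.1 i| < j.2 / 2} =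
        ⋂ i, {y : Rd d | |y i - j.1 i| < j.2 / 2} := by ext; simp
    rw [this]
    exact isOpen_iInter_of_finite fun i => isOpen_lt (by fun_prop) (by fun_prop)
  have hsub : U ⊆ ⋃ j ∈ S, cube j.1 j.2 :=
    iUnion₂_mono fun j _ y hy i => (hy i).le
  have hae : ∀ᵐ x ∂(volume.restrict Uᶜ), ∀ n : ℕ, ∀ (w : ℕ → Rd d) (δ : ℕ → ℝ),
      Tendsto δ atTop (𝓝[>] 0) → (∀ᶠ j in atTop, x ∈ closedBall (w j) (n * δ j)) →
      Tendsto (fun j => volume (Uᶜ ∩ closedBall (w j) (δ j)) / volume (closedBall (w j) (δ j)))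
        atTop (𝓝 1) := by
    rw [ae_all_iff]
    intro n
    filter_upwards [IsUnifLocDoublingMeasure.ae_tendsto_measure_inter_div
      (volume : Measure (Rd d)) Uᶜ n] with x hx w δ h1 h2
    exact hx w δ h1 h2
  rw [ae_restrict_iff' hUo.measurableSet.compl] at hae
  have hnull : volume ((⋃ j ∈ S, cube j.1 j.2) \ U) = 0 := by
    refine measure_mono_null ?_ hae
    rintro x ⟨hx, hxU⟩ hcon
    have hcon := hcon hxU
    simp only [mem_iUnion] at hx
    obtain ⟨⟨c, l⟩, hj, hx⟩ := hx
    have hl : 0 < l := hS _ hj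
    dsimp only at hx
    -- The balls used have centre `x + s k • (c - x)` and radius `s k * l / 4`. They shrink to `x`
    -- and lie in the open cube, and `x` is within `n` radii of their centres.
    obtain ⟨n, hn⟩ := exists_nat_ge (4 * ‖c - x‖ / l)
    rw [div_le_iff₀ hl] at hn
    set s : ℕ → ℝ := fun k => 1 / ((k : ℝ) + 1) with hs
    have hs0 : ∀ k, 0 < s k := fun k => by positivity
    have hs1 : ∀ k, s k ≤ 1 := fun k => by
      rw [hs]
      simp only
      rw [div_le_one (by positivity)]
      linarith [k.cast_nonneg (α := ℝ)]
    have hlim : Tendsto (fun k => s k * l / 4) atTop (𝓝[>] 0) := by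
      refine tendsto_nhdsWithin_iff.2 ⟨?_, Eventually.of_forall fun k => ?_⟩
      · have := (tendsto_one_div_add_atTop_nhds_zero_nat (𝕜 := ℝ)).mul_const (l / 4)
        simp only [zero_mul] at this
        refine this.congr fun k => ?_
        rw [hs]; ring
      · have := hs0 k
        simp only [mem_Ioi]
        positivity
    have h1 := hcon n (fun k => x + s k • (c - x)) (fun k => s k * l / 4) hlim
      (Eventually.of_forall fun k => by
        rw [mem_closedBall, dist_eq_norm, sub_add_cancel_left, norm_neg, norm_smul,
          Real.norm_of_nonneg (hs0 k).le]
        nlinarith [hs0 k])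
    have h2 : ∀ k, Uᶜ ∩ closedBall (x + s k • (c - x)) (s k * l / 4) = ∅ := by
      intro k
      rw [← disjoint_iff_inter_eq_empty, disjoint_compl_left_iff_subset]
      intro z hz
      refine mem_biUnion hj fun i => ?_
      rw [mem_closedBall, dist_eq_norm] at hz
      have h3 : ‖(z - (x + s k • (c - x))) i‖ ≤ s k * l / 4 :=
        (PiLp.norm_apply_le (z - (x + s k • (c - x))) i).trans hz
      rw [Real.norm_eq_abs] at h3
      have h4 : z i - c i = (z - (x + s k • (c - x))) i + (1 - s k) * (x i - c i) := by
        simp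
        ring
      have h5 := hx i
      dsimp only
      rw [h4]
      refine (abs_add_le _ _).trans_lt ?_
      rw [abs_mul, abs_of_nonneg (sub_nonneg.2 (hs1 k))]
      have h6 : (1 - s k) * |x i - c i| ≤ (1 - s k) * (l / 2) :=
        mul_le_mul_of_nonneg_left h5 (sub_nonneg.2 (hs1 k))
      nlinarith [mul_pos (hs0 k) hl]
    simp only [h2, measure_empty, ENNReal.zero_div] at h1
    exact zero_ne_one (tendsto_nhds_unique tendsto_const_nhds h1)
  rw [← union_sdiff_cancel hsub]
  exact hUo.measurableSet.nullMeasurableSet.union (NullMeasurableSet.of_null hnull)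

/-- A superlevel set is the union of the admissible cubes whose value exceeds the level, whatever
the function `a` of the cube may be. -/
theorem aemeasurable_iSup_cube {d : ℕ} (P : Rd d → ℝ → Prop) (a : Rd d → ℝ → ℝ≥0∞) :
    AEMeasurable (fun x => ⨆ (c : Rd d) (l : ℝ) (_ : 0 < l) (_ : x ∈ cube c l) (_ : P c l), a c l)
      volume := by
  set F : Rd d → ℝ≥0∞ :=
    fun x => ⨆ (c : Rd d) (l : ℝ) (_ : 0 < l) (_ : x ∈ cube c l) (_ : P c l), a c l with hF
  have key : ∀ t, NullMeasurableSet (F ⁻¹' Ioi t) volume := fun t => by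
    have : F ⁻¹' Ioi t =
        ⋃ j ∈ {j : Rd d × ℝ | 0 < j.2 ∧ P j.1 j.2 ∧ t < a j.1 j.2}, cube j.1 j.2 := by
      ext x
      simp only [hF, mem_preimage, mem_Ioi, lt_iSup_iff, mem_iUnion, Prod.exists, mem_ofPred_eq,
        exists_prop]
      refine exists_congr fun c => exists_congr fun l => ?_
      tauto
    rw [this]
    exact nullMeasurableSet_biUnion_cube _ fun j hj => hj.1
  have hm : Measurable (α := NullMeasurableSpace (Rd d) volume) F := measurable_of_Ioi key
  exact NullMeasurable.aemeasurable fun s hs => hm hs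

theorem aemeasurable_grandMaximal {d : ℕ} (K : Rd d → Rd d → ℝ) (ρ : ℝ) (f : Rd d → ℝ) :
    AEMeasurable (grandMaximal K ρ f) volume := by
  simpa [grandMaximal] using! aemeasurable_iSup_cube (fun _ _ => True) fun c l =>
    essSup (variation K ρ ((cube c (3 * l))ᶜ.indicator f)) (volume.restrict (cube c l))

theorem aemeasurable_localGrandMaximal {d : ℕ} (K : Rd d → Rd d → ℝ) (ρ : ℝ) (c₀ : Rd d) (l₀ : ℝ)
    (f : Rd d → ℝ) : AEMeasurable (localGrandMaximal K ρ c₀ l₀ f) volume :=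
  (aemeasurable_iSup_cube (fun c l => cube c l ⊆ cube c₀ l₀) fun c l =>
    essSup (variation K ρ ((cube c₀ (3 * l₀) \ cube c (3 * l)).indicator f))
      (volume.restrict (cube c l))).indicator (measurableSet_cube c₀ l₀)

/-- The local operator is dominated by the global one, applied to a restriction of `f`. -/
theorem localGrandMaximal_le {d : ℕ} (K : Rd d → Rd d → ℝ) (ρ : ℝ) (c₀ : Rd d) (l₀ : ℝ)
    (f : Rd d → ℝ) (x : Rd d) :
    localGrandMaximal K ρ c₀ l₀ f x ≤ grandMaximal K ρ ((cube c₀ (3 * l₀)).indicator f) x := by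
  refine indicator_apply_le fun _ => ?_
  refine iSup₂_le fun c l => iSup₂_le fun hl hx => iSup_le fun _ => ?_
  have : (cube c₀ (3 * l₀) \ cube c (3 * l)).indicator f =
      (cube c (3 * l))ᶜ.indicator ((cube c₀ (3 * l₀)).indicator f) := by
    rw [indicator_indicator, sdiff_eq, inter_comm]
  rw [this]
  exact le_iSup₂_of_le c l (le_iSup₂_of_le hl hx le_rfl)

/-! ### Radial majorants -/

/-- Integrals against radially decreasing kernels are controlled by the maximal function. -/
theorem lintegral_radial_le {d : ℕ} {φ : ℝ → ℝ} (hφ : Monotone φ) (u : Rd d → ℝ≥0∞) (x : Rd d)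
    {l : ℝ} (hl : 0 < l) :
    ∫⁻ y in {y | l ≤ ‖x - y‖}, ENNReal.ofReal (φ (l / ‖x - y‖)) *
        ENNReal.ofReal (‖x - y‖ ^ d)⁻¹ * u y ≤
      2 ^ d * (∑' k : ℕ, ENNReal.ofReal (φ ((1 / 2) ^ k))) * ballMaximal u x := by
  -- Dyadic shells: on the `k`-th one `φ` is at most its value at `2^{-k}`, and the mismatch between
  -- inner and outer radius costs the factor `2 ^ d`.
  set R : ℕ → Set (Rd d) := fun k => {y | 2 ^ k * l ≤ ‖x - y‖ ∧ ‖x - y‖ < 2 ^ (k + 1) * l} with hR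
  have hRm : ∀ k, MeasurableSet (R k) := fun k =>
    (measurableSet_le (f := fun _ => 2 ^ k * l) (g := fun y : Rd d => ‖x - y‖) (by fun_prop)
      (by fun_prop)).inter (measurableSet_lt (f := fun y : Rd d => ‖x - y‖)
      (g := fun _ => 2 ^ (k + 1) * l) (by fun_prop) (by fun_prop))
  have hcov : {y | l ≤ ‖x - y‖} ⊆ ⋃ k, R k := by
    intro y hy
    have h1 : 1 ≤ ‖x - y‖ / l := (one_le_div hl).2 hy
    obtain ⟨k, hk1, hk2⟩ := exists_nat_pow_near h1 (one_lt_two)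
    refine mem_iUnion.2 ⟨k, ?_, ?_⟩
    · exact (le_div_iff₀ hl).1 hk1
    · exact (div_lt_iff₀ hl).1 hk2
  calc _ ≤ ∫⁻ y in ⋃ k, R k, ENNReal.ofReal (φ (l / ‖x - y‖)) *
        ENNReal.ofReal (‖x - y‖ ^ d)⁻¹ * u y := lintegral_mono_set hcov
    _ ≤ ∑' k, ∫⁻ y in R k, ENNReal.ofReal (φ (l / ‖x - y‖)) *
        ENNReal.ofReal (‖x - y‖ ^ d)⁻¹ * u y := lintegral_iUnion_le _ _
    _ ≤ ∑' k : ℕ, 2 ^ d * ENNReal.ofReal (φ ((1 / 2) ^ k)) * ballMaximal u x := by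
        refine ENNReal.tsum_le_tsum fun k => ?_
        have hk : (0 : ℝ) < 2 ^ k * l := by positivity
        calc _ ≤ ∫⁻ y in R k, ENNReal.ofReal (φ ((1 / 2) ^ k)) *
              ENNReal.ofReal ((2 ^ k * l) ^ d)⁻¹ * u y := by
              refine setLIntegral_mono' (hRm k) fun y hy => ?_
              gcongr
              · apply hφ
                calc l / ‖x - y‖ ≤ l / (2 ^ k * l) := by gcongr; exact hy.1
                  _ = (1 / 2) ^ k := by rw [one_div, inv_pow]; field_simp
              · exact hy.1
          _ = ENNReal.ofReal (φ ((1 / 2) ^ k)) *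
              ENNReal.ofReal ((2 ^ k * l) ^ d)⁻¹ * ∫⁻ y in R k, u y :=
              lintegral_const_mul' _ _ (by finiteness)
          _ ≤ ENNReal.ofReal (φ ((1 / 2) ^ k)) *
              ENNReal.ofReal ((2 ^ k * l) ^ d)⁻¹ *
                (ENNReal.ofReal ((2 ^ (k + 1) * l) ^ d) * ballMaximal u x) := by
              gcongr
              refine lintegral_subset_le_ballMaximal u (by positivity) fun y hy => ?_
              rw [mem_closedBall', dist_eq_norm]
              exact hy.2.le
          _ = ENNReal.ofReal (φ ((1 / 2) ^ k)) *
              (ENNReal.ofReal ((2 ^ k * l) ^ d)⁻¹ * ENNReal.ofReal ((2 ^ (k + 1) * l) ^ d)) *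
                ballMaximal u x := by ring
          _ = _ := by
              rw [← ENNReal.ofReal_mul (by positivity)]
              have : ((2 ^ k * l) ^ d)⁻¹ * (2 ^ (k + 1) * l) ^ d = 2 ^ d := by
                rw [← inv_pow, ← mul_pow]
                congr 1
                field_simp
                ring
              rw [this, ENNReal.ofReal_pow (by norm_num)]
              simp
              ring
    _ = _ := by rw [ENNReal.tsum_mul_right, ENNReal.tsum_mul_left]

/-! ### Kernels -/

/-- A Calderón–Zygmund kernel whose modulus of continuity is monotone on the whole line,
doubling, summable over dyadic scales, and at least the square root. -/
structure IsRegularKernel {d : ℕ} (K : Rd d → Rd d → ℝ) (C : ℝ) (Ω : ℝ → ℝ) : Prop where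
  nonneg : 0 ≤ C
  mono : Monotone Ω
  sqrt_le : ∀ t, √t ≤ Ω t
  double : ∀ t, 0 ≤ t → Ω (2 * t) ≤ 2 * Ω t
  tsum_ne_top : ∑' k : ℕ, ENNReal.ofReal (Ω ((1 / 2) ^ k)) ≠ ∞
  size : ∀ x y : Rd d, x ≠ y → |K x y| ≤ C * (‖x - y‖ ^ d)⁻¹
  smooth_left : ∀ x x' y : Rd d, x ≠ y → ‖x - x'‖ ≤ ‖x - y‖ / 2 →
    |K x y - K x' y| ≤ C * Ω (‖x - x'‖ / ‖x - y‖) * (‖x - y‖ ^ d)⁻¹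
  smooth_right : ∀ x x' y : Rd d, x ≠ y → ‖x - x'‖ ≤ ‖x - y‖ / 2 →
    |K y x - K y x'| ≤ C * Ω (‖x - x'‖ / ‖x - y‖) * (‖x - y‖ ^ d)⁻¹

namespace IsDiniModulus

variable {ω : ℝ → ℝ}

theorem apply_nonneg (hω : IsDiniModulus ω) {t : ℝ} (ht : 0 ≤ t) : 0 ≤ ω t := by
  rw [← hω.zero]
  exact hω.mono self_mem_Ici ht ht

/-- On `(2^{-(k+1)}, 2^{-k}]` monotonicity bounds `ω t / t` below by `ω (2^{-(k+1)}) / 2^{-k}`, so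
each dyadic piece of the Dini integral is at least half of a term of the series. -/
theorem tsum_ne_top (hω : IsDiniModulus ω) :
    ∑' k : ℕ, ENNReal.ofReal (ω ((1 / 2) ^ k)) ≠ ∞ := by
  set I : ℕ → Set ℝ := fun k => Ioc ((1 / 2) ^ (k + 1)) ((1 / 2) ^ k) with hI
  have hdisj : Pairwise (Function.onFun Disjoint I) := by
    have : Antitone fun k : ℕ => ((1 / 2 : ℝ)) ^ k :=
      pow_right_anti₀ (by norm_num) (by norm_num)
    exact this.pairwise_disjoint_on_Ioc_succ
  have hfin : ∫⁻ t in Ioc 0 1, ENNReal.ofReal (ω t / t) ≠ ∞ := by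
    have := hω.dini.2
    refine ne_top_of_le_ne_top this.ne (lintegral_mono fun t => ?_)
    exact Real.ofReal_le_enorm _
  have hle : ∑' k : ℕ, ENNReal.ofReal (ω ((1 / 2) ^ (k + 1))) * ENNReal.ofReal (1 / 2) ≤
      ∫⁻ t in Ioc 0 1, ENNReal.ofReal (ω t / t) := by
    calc _ ≤ ∑' k, ∫⁻ t in I k, ENNReal.ofReal (ω t / t) := by
          refine ENNReal.tsum_le_tsum fun k => ?_
          calc _ = ENNReal.ofReal (ω ((1 / 2) ^ (k + 1)) / (1 / 2) ^ k) *
                volume (I k) := by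
                rw [hI, Real.volume_Ioc, ← ENNReal.ofReal_mul (hω.apply_nonneg (by positivity)),
                  ← ENNReal.ofReal_mul
                    (div_nonneg (hω.apply_nonneg (by positivity)) (by positivity))]
                congr 1
                have : ((1 : ℝ) / 2) ^ k ≠ 0 := by positivity
                field_simp
                ring
            _ = ∫⁻ _ in I k, ENNReal.ofReal (ω ((1 / 2) ^ (k + 1)) / (1 / 2) ^ k) := by
                rw [setLIntegral_const]
            _ ≤ _ := by
                refine setLIntegral_mono' measurableSet_Ioc fun t ht => ?_
                have h0 : (0 : ℝ) < (1 / 2) ^ (k + 1) := by positivity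
                have ht0 : 0 < t := h0.trans ht.1
                apply ENNReal.ofReal_le_ofReal
                have h1 : ω ((1 / 2) ^ (k + 1)) ≤ ω t :=
                  hω.mono (mem_Ici.2 h0.le) (mem_Ici.2 ht0.le) ht.1.le
                have h2 := hω.apply_nonneg h0.le
                have h3 := hω.apply_nonneg ht0.le
                gcongr
                exact ht.2
      _ = ∫⁻ t in ⋃ k, I k, ENNReal.ofReal (ω t / t) :=
          (lintegral_iUnion (fun k => measurableSet_Ioc) hdisj _).symm
      _ ≤ _ := by
          refine lintegral_mono_set (iUnion_subset fun k t ht => ⟨?_, ?_⟩)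
          · exact lt_trans (by positivity) ht.1
          · exact ht.2.trans (pow_le_one₀ (by norm_num) (by norm_num))
  have h1 : ∑' k : ℕ, ENNReal.ofReal (ω ((1 / 2) ^ (k + 1))) ≠ ∞ := by
    rw [ENNReal.tsum_mul_right] at hle
    intro h
    rw [h, ENNReal.top_mul (by simp)] at hle
    exact hfin (top_le_iff.1 hle)
  rw [tsum_eq_zero_add' ENNReal.summable]
  exact ENNReal.add_ne_top.2 ⟨ENNReal.ofReal_ne_top, h1⟩

end IsDiniModulus

theorem tsum_sqrt_ne_top : ∑' k : ℕ, ENNReal.ofReal √((1 / 2) ^ k) ≠ ∞ := by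
  have h0 : √(1 / 2) < 1 := by
    rw [Real.sqrt_lt' one_pos]; norm_num
  have hs : Summable fun k : ℕ => √(1 / 2) ^ k :=
    summable_geometric_of_lt_one (Real.sqrt_nonneg _) h0
  have : (fun k : ℕ => ENNReal.ofReal √((1 / 2) ^ k)) =
      fun k : ℕ => ENNReal.ofReal (√(1 / 2) ^ k) := by
    ext k
    congr 1
    rw [Real.sqrt_eq_iff_mul_self_eq (by positivity) (by positivity), ← mul_pow,
      Real.mul_self_sqrt (by norm_num)]
  rw [this]
  exact hs.tsum_ofReal_ne_top

/-- The modulus is `ω (max t 0) + √t`. The square root is itself Dini and doubling, so adding it is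
harmless, and it supplies a lower bound that `ω` need not have: square root weights and terms with
no smoothness at distance comparable to `l` can then be charged to the modulus. -/
theorem IsCZKernel.exists_isRegularKernel {d : ℕ} (hd : 0 < d) {K : Rd d → Rd d → ℝ} {C : ℝ}
    {ω : ℝ → ℝ} (hω : IsDiniModulus ω) (hK : IsCZKernel K C ω) :
    ∃ Ω : ℝ → ℝ, IsRegularKernel K C Ω := by
  have hC : 0 ≤ C := by
    have : Nontrivial (Rd d) := by
      have : Nonempty (Fin d) := ⟨⟨0, hd⟩⟩
      infer_instance
    obtain ⟨x, y, hxy⟩ := exists_pair_ne (Rd d)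
    have h1 := (abs_nonneg _).trans (hK.size x y hxy)
    have h2 : 0 < ‖x - y‖ ^ d := pow_pos (norm_pos_iff.2 (sub_ne_zero.2 hxy)) d
    have := mul_nonneg h1 h2.le
    rwa [div_mul_cancel₀ _ h2.ne'] at this
  have hle : ∀ t, 0 ≤ t → ω t ≤ ω (max t 0) + √t := fun t ht => by
    rw [max_eq_left ht]
    linarith [Real.sqrt_nonneg t]
  refine ⟨fun t => ω (max t 0) + √t, hC, ?_, ?_, ?_, ?_, ?_, ?_, ?_⟩
  · intro s t hst
    have h1 : max s 0 ≤ max t 0 := max_le_max_right 0 hst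
    exact add_le_add (hω.mono (mem_Ici.2 (le_max_right _ _)) (mem_Ici.2 (le_max_right _ _)) h1)
      (Real.sqrt_le_sqrt hst)
  · intro t
    have := hω.apply_nonneg (le_max_right t 0)
    linarith
  · intro t ht
    rw [max_eq_left ht, max_eq_left (by positivity)]
    have h1 := hω.subadd t t ht ht
    rw [← two_mul] at h1
    have h2 : √(2 * t) ≤ 2 * √t := by
      rw [Real.sqrt_le_left (by positivity), mul_pow, Real.sq_sqrt ht]
      linarith
    linarith
  · have : ∀ k : ℕ, ENNReal.ofReal (ω (max ((1 / 2) ^ k) 0) + √((1 / 2) ^ k)) =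
        ENNReal.ofReal (ω ((1 / 2) ^ k)) + ENNReal.ofReal √((1 / 2) ^ k) := fun k => by
      rw [max_eq_left (by positivity), ENNReal.ofReal_add (hω.apply_nonneg (by positivity))
        (by positivity)]
    simp_rw [this]
    rw [ENNReal.tsum_add]
    exact ENNReal.add_ne_top.2 ⟨hω.tsum_ne_top, tsum_sqrt_ne_top⟩
  · intro x y hxy
    rw [← div_eq_mul_inv]
    exact hK.size x y hxy
  · intro x x' y hxy h
    have h1 := hK.smooth x x' y hxy h
    have h2 := hle (‖x - x'‖ / ‖x - y‖) (by positivity)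
    rw [one_div] at h1
    calc _ ≤ C * ω (‖x - x'‖ / ‖x - y‖) * (‖x - y‖ ^ d)⁻¹ := by
          linarith [abs_nonneg (K y x - K y x')]
      _ ≤ _ := by gcongr
  · intro x x' y hxy h
    have h1 := hK.smooth x x' y hxy h
    have h2 := hle (‖x - x'‖ / ‖x - y‖) (by positivity)
    rw [one_div] at h1
    calc _ ≤ C * ω (‖x - x'‖ / ‖x - y‖) * (‖x - y‖ ^ d)⁻¹ := by
          linarith [abs_nonneg (K x y - K x' y)]
      _ ≤ _ := by gcongr

namespace IsRegularKernel

variable {d : ℕ} {K : Rd d → Rd d → ℝ} {C : ℝ} {Ω : ℝ → ℝ}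

theorem modulus_nonneg (hK : IsRegularKernel K C Ω) (t : ℝ) : 0 ≤ Ω t :=
  (Real.sqrt_nonneg t).trans (hK.sqrt_le t)

theorem modulus_mul_le (hK : IsRegularKernel K C Ω) (n : ℕ) {t : ℝ} (ht : 0 ≤ t) :
    Ω (2 ^ n * t) ≤ 2 ^ n * Ω t := by
  induction n with
  | zero => simp
  | succ n ih =>
    rw [pow_succ', mul_assoc, mul_assoc]
    exact (hK.double _ (by positivity)).trans (by linarith)

theorem modulus_le (hK : IsRegularKernel K C Ω) {n : ℕ} {s t : ℝ} (ht : 0 ≤ t)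
    (h : s ≤ 2 ^ n * t) : Ω s ≤ 2 ^ n * Ω t :=
  (hK.mono h).trans (hK.modulus_mul_le n ht)

theorem tendsto_modulus (hK : IsRegularKernel K C Ω) : Tendsto Ω (𝓝[≥] 0) (𝓝 0) := by
  have h1 := ENNReal.tendsto_atTop_zero_of_tsum_ne_top hK.tsum_ne_top
  rw [tendsto_order]
  refine ⟨fun a ha => Eventually.of_forall fun t => ha.trans_le (hK.modulus_nonneg t),
    fun a ha => ?_⟩
  have h2 : ∀ᶠ k : ℕ in atTop, ENNReal.ofReal (Ω ((1 / 2) ^ k)) < ENNReal.ofReal a :=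
    h1.eventually_lt_const (by simpa using ha)
  obtain ⟨k, hk⟩ := h2.exists
  rw [ENNReal.ofReal_lt_ofReal_iff ha] at hk
  have h3 : ∀ᶠ t : ℝ in 𝓝[≥] 0, t < (1 / 2) ^ k :=
    nhdsWithin_le_nhds (eventually_lt_nhds (by positivity))
  filter_upwards [h3] with t ht
  exact (hK.mono ht.le).trans_lt hk

/-- Smoothness in the second variable together with `Ω (0+) = 0`. The hypotheses on the kernel
contain no measurability; this is its source. -/
theorem continuousAt_right (hK : IsRegularKernel K C Ω) {x y : Rd d} (hxy : x ≠ y) :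
    ContinuousAt (K x) y := by
  have hpos : 0 < ‖y - x‖ := norm_pos_iff.2 (sub_ne_zero.2 hxy.symm)
  have h1 : Tendsto (fun z : Rd d => ‖y - z‖ / ‖y - x‖) (𝓝 y) (𝓝[≥] 0) := by
    refine tendsto_nhdsWithin_iff.2 ⟨?_, Eventually.of_forall fun z => ?_⟩
    · have : Continuous fun z : Rd d => ‖y - z‖ / ‖y - x‖ := by fun_prop
      simpa using this.tendsto y
    · exact mem_Ici.2 (by positivity)
  have h2 : Tendsto (fun z : Rd d => C * Ω (‖y - z‖ / ‖y - x‖) * (‖y - x‖ ^ d)⁻¹) (𝓝 y) (𝓝 0) := by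
    simpa using ((hK.tendsto_modulus.comp h1).const_mul C).mul_const _
  have h3 : ∀ᶠ z in 𝓝 y, ‖y - z‖ ≤ ‖y - x‖ / 2 := by
    have : Tendsto (fun z : Rd d => ‖y - z‖) (𝓝 y) (𝓝 0) := by
      have : Continuous fun z : Rd d => ‖y - z‖ := by fun_prop
      simpa using this.tendsto y
    exact this.eventually_le_const (by positivity)
  rw [ContinuousAt, tendsto_iff_norm_sub_tendsto_zero]
  refine squeeze_zero' (Eventually.of_forall fun z => norm_nonneg _) ?_ h2
  filter_upwards [h3] with z hz
  rw [norm_sub_rev, Real.norm_eq_abs]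
  exact hK.smooth_right y z x hxy.symm hz

theorem aestronglyMeasurable (hK : IsRegularKernel K C Ω) (x : Rd d) :
    AEStronglyMeasurable (K x) (volume.restrict {x}ᶜ) := by
  refine ContinuousOn.aestronglyMeasurable (fun y hy => ?_) (measurableSet_singleton x).compl
  exact (hK.continuousAt_right (fun h => hy (by simp [h]))).continuousWithinAt

theorem enorm_le (hK : IsRegularKernel K C Ω) {x y : Rd d} (hxy : x ≠ y) :
    ‖K x y‖ₑ ≤ ENNReal.ofReal C * ENNReal.ofReal (‖x - y‖ ^ d)⁻¹ := by
  rw [← ENNReal.ofReal_mul hK.nonneg, Real.enorm_eq_ofReal_abs]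
  exact ENNReal.ofReal_le_ofReal (hK.size x y hxy)

end IsRegularKernel

/-! ### Truncations and variation -/

theorem monotone_max_rpow {s : ℝ} (hs : 0 ≤ s) : Monotone fun t : ℝ => (max t 0) ^ s :=
  fun _ _ h => Real.rpow_le_rpow (le_max_right _ _) (max_le_max_right 0 h) hs

theorem tsum_max_rpow_ne_top {s : ℝ} (hs : 0 < s) :
    ∑' k : ℕ, ENNReal.ofReal ((max ((1 / 2) ^ k) 0) ^ s) ≠ ∞ := by
  have h0 : ((1 : ℝ) / 2) ^ s < 1 := Real.rpow_lt_one (by norm_num) (by norm_num) hs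
  have hsum : Summable fun k : ℕ => (((1 : ℝ) / 2) ^ s) ^ k :=
    summable_geometric_of_lt_one (by positivity) h0
  have : (fun k : ℕ => ENNReal.ofReal ((max ((1 / 2) ^ k) 0) ^ s)) =
      fun k : ℕ => ENNReal.ofReal ((((1 : ℝ) / 2) ^ s) ^ k) := by
    ext k
    rw [max_eq_left (by positivity), ← Real.rpow_natCast, ← Real.rpow_natCast,
      ← Real.rpow_mul (by norm_num), ← Real.rpow_mul (by norm_num), mul_comm]
  rw [this]
  exact hsum.tsum_ofReal_ne_top

/-- With `1 + σ` conjugate to `p`, this says that the kernel is in the dual `L^p` space away from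
`x`. After extraction of a power of `ε` the integrand is a radial kernel with `φ t = t^{dσ}`. -/
theorem lintegral_rpow_kernel_lt_top {d : ℕ} (hd : 0 < d) {σ : ℝ} (hσ : 0 < σ) (x : Rd d) {ε : ℝ}
    (hε : 0 < ε) :
    ∫⁻ y in {y | ε < ‖x - y‖}, ENNReal.ofReal (‖x - y‖ ^ d)⁻¹ *
      ENNReal.ofReal (‖x - y‖ ^ d)⁻¹ ^ σ < ∞ := by
  have hs : 0 < d * σ := by positivity
  calc _ ≤ ∫⁻ y in {y | ε ≤ ‖x - y‖}, ENNReal.ofReal (ε ^ d)⁻¹ ^ σ *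
        (ENNReal.ofReal ((max (ε / ‖x - y‖) 0) ^ (d * σ)) * ENNReal.ofReal (‖x - y‖ ^ d)⁻¹ * 1) := by
        refine (lintegral_mono_set (t := {y | ε ≤ ‖x - y‖}) fun y (hy : ε < ‖x - y‖) => hy.le).trans ?_
        refine setLIntegral_mono' (measurableSet_le (by fun_prop) (by fun_prop)) fun y hy => ?_
        have hy0 : 0 < ‖x - y‖ := hε.trans_le hy
        rw [mul_one, max_eq_left (by positivity), mul_comm (ENNReal.ofReal (_ ^ (d * σ))),
          mul_left_comm]
        refine le_of_eq ?_
        congr 1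
        rw [ENNReal.ofReal_rpow_of_pos (by positivity), ENNReal.ofReal_rpow_of_pos (by positivity),
          ← ENNReal.ofReal_mul (by positivity)]
        congr 1
        rw [Real.rpow_mul (by positivity), Real.rpow_natCast, ← Real.mul_rpow (by positivity)
          (by positivity), div_pow]
        congr 1
        field_simp
    _ = ENNReal.ofReal (ε ^ d)⁻¹ ^ σ * ∫⁻ y in {y | ε ≤ ‖x - y‖},
        (ENNReal.ofReal ((max (ε / ‖x - y‖) 0) ^ (d * σ)) * ENNReal.ofReal (‖x - y‖ ^ d)⁻¹ * 1) :=
        lintegral_const_mul' _ _ (ENNReal.rpow_ne_top_of_nonneg hσ.le ENNReal.ofReal_ne_top)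
    _ ≤ ENNReal.ofReal (ε ^ d)⁻¹ ^ σ * _ :=
        mul_le_mul_right (lintegral_radial_le (monotone_max_rpow hs.le) (fun _ => 1) x hε) _
    _ < ∞ := by
        have h1 := tsum_max_rpow_ne_top hs
        have h2 : ballMaximal (fun _ : Rd d => (1 : ℝ≥0∞)) x ≠ ∞ :=
          ne_top_of_le_ne_top (by simpa using unitBallVolume_ne_top d)
            (ballMaximal_le_of_le (fun _ => le_rfl) x)
        have h3 : ENNReal.ofReal (ε ^ d)⁻¹ ^ σ ≠ ∞ :=
          ENNReal.rpow_ne_top_of_nonneg hσ.le ENNReal.ofReal_ne_top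
        finiteness

/-- Young's inequality without sharp constants: the first term is `a` to the exponent conjugate to
`p`, and one compares `b` with `a ^ (1 / (p - 1))`. -/
theorem mul_le_mul_rpow_add_rpow {p : ℝ} (hp : 1 < p) (a b : ℝ≥0∞) :
    a * b ≤ a * a ^ (1 / (p - 1)) + b ^ p := by
  have hp' : 0 < p - 1 := by linarith
  rcases le_total b (a ^ (1 / (p - 1))) with h | h
  · exact (mul_le_mul_right h a).trans le_self_add
  · refine le_trans ?_ le_add_self
    have h1 : a ≤ b ^ (p - 1) := by
      have := ENNReal.rpow_le_rpow h hp'.le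
      rwa [← ENNReal.rpow_mul, one_div_mul_cancel hp'.ne', ENNReal.rpow_one] at this
    calc a * b ≤ b ^ (p - 1) * b ^ (1 : ℝ) := by
          rw [ENNReal.rpow_one]; gcongr
      _ = b ^ p := by
          rw [← ENNReal.rpow_add_of_nonneg _ _ hp'.le (by norm_num), sub_add_cancel]

/-- The truncated integrals of `f` against `K` all converge absolutely. -/
def IsTruncatable {d : ℕ} (K : Rd d → Rd d → ℝ) (f : Rd d → ℝ) : Prop :=
  ∀ (x : Rd d) (ε : ℝ), 0 < ε → IntegrableOn (fun y => K x y * f y) {y | ε < ‖x - y‖}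

theorem measurableSet_lt_norm_sub {d : ℕ} (x : Rd d) (ε : ℝ) :
    MeasurableSet {y : Rd d | ε < ‖x - y‖} :=
  measurableSet_lt (by fun_prop) (by fun_prop)

theorem IsRegularKernel.isTruncatable {d : ℕ} (hd : 0 < d) {K : Rd d → Rd d → ℝ} {C : ℝ}
    {Ω : ℝ → ℝ} (hK : IsRegularKernel K C Ω) {f : Rd d → ℝ} {p : ℝ} (hp : 1 ≤ p)
    (hf : MemLp f (ENNReal.ofReal p) volume) : IsTruncatable K f := by
  intro x ε hε
  have hsub : {y : Rd d | ε < ‖x - y‖} ⊆ {x}ᶜ := by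
    rintro y hy rfl
    simp only [mem_ofPred_eq, sub_self, norm_zero] at hy
    exact hy.not_gt hε
  have hmeas : AEStronglyMeasurable (fun y => K x y * f y)
      (volume.restrict {y | ε < ‖x - y‖}) :=
    ((hK.aestronglyMeasurable x).mono_set hsub).mul hf.1.restrict
  refine ⟨hmeas, ?_⟩
  have hp0 : 0 < p := by linarith
  have hfp : ∫⁻ y, ‖f y‖ₑ ^ p < ∞ := by
    have := lintegral_rpow_enorm_lt_top_of_eLpNorm_lt_top (by simpa using hp0)
      ENNReal.ofReal_ne_top hf.2
    rwa [ENNReal.toReal_ofReal hp0.le] at this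
  have key : ∫⁻ y in {y | ε < ‖x - y‖}, ENNReal.ofReal (‖x - y‖ ^ d)⁻¹ * ‖f y‖ₑ < ∞ := by
    rcases hp.eq_or_lt with rfl | hp1
    · simp only [ENNReal.rpow_one] at hfp
      calc _ ≤ ∫⁻ y in {y | ε < ‖x - y‖}, ENNReal.ofReal (ε ^ d)⁻¹ * ‖f y‖ₑ := by
            refine setLIntegral_mono' (measurableSet_lt_norm_sub x ε) fun y hy => ?_
            have : ε ≤ ‖x - y‖ := le_of_lt hy
            gcongr
        _ = ENNReal.ofReal (ε ^ d)⁻¹ * ∫⁻ y in {y | ε < ‖x - y‖}, ‖f y‖ₑ :=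
            lintegral_const_mul' _ _ ENNReal.ofReal_ne_top
        _ ≤ ENNReal.ofReal (ε ^ d)⁻¹ * ∫⁻ y, ‖f y‖ₑ := by
            gcongr
            exact Measure.restrict_le_self
        _ < ∞ := ENNReal.mul_lt_top ENNReal.ofReal_lt_top hfp
    · calc _ ≤ ∫⁻ y in {y | ε < ‖x - y‖}, (ENNReal.ofReal (‖x - y‖ ^ d)⁻¹ *
            ENNReal.ofReal (‖x - y‖ ^ d)⁻¹ ^ (1 / (p - 1)) + ‖f y‖ₑ ^ p) :=
            lintegral_mono fun y => mul_le_mul_rpow_add_rpow hp1 _ _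
        _ = (∫⁻ y in {y | ε < ‖x - y‖}, ENNReal.ofReal (‖x - y‖ ^ d)⁻¹ *
            ENNReal.ofReal (‖x - y‖ ^ d)⁻¹ ^ (1 / (p - 1))) +
            ∫⁻ y in {y | ε < ‖x - y‖}, ‖f y‖ₑ ^ p :=
            lintegral_add_left (by fun_prop) _
        _ < ∞ := by
            refine ENNReal.add_lt_top.2 ⟨lintegral_rpow_kernel_lt_top hd
              (by rw [one_div_pos]; linarith) x hε, ?_⟩
            exact (setLIntegral_le_lintegral _ _).trans_lt hfp
  calc ∫⁻ y in {y | ε < ‖x - y‖}, ‖K x y * f y‖ₑ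
      ≤ ∫⁻ y in {y | ε < ‖x - y‖}, ENNReal.ofReal C *
          (ENNReal.ofReal (‖x - y‖ ^ d)⁻¹ * ‖f y‖ₑ) := by
        refine setLIntegral_mono' (measurableSet_lt_norm_sub x ε) fun y hy => ?_
        rw [enorm_mul, ← mul_assoc]
        gcongr
        exact hK.enorm_le fun h => hsub hy (by simp [h])
    _ = ENNReal.ofReal C * _ := lintegral_const_mul' _ _ ENNReal.ofReal_ne_top
    _ < ∞ := ENNReal.mul_lt_top ENNReal.ofReal_lt_top key

theorem IsTruncatable.indicator {d : ℕ} {K : Rd d → Rd d → ℝ} {f : Rd d → ℝ}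
    (hf : IsTruncatable K f) {s : Set (Rd d)} (hs : MeasurableSet s) :
    IsTruncatable K (s.indicator f) := by
  intro x ε hε
  have : (fun y => K x y * s.indicator f y) = s.indicator fun y => K x y * f y := by
    ext y
    by_cases hy : y ∈ s <;> simp [hy]
  rw [this]
  exact (hf x ε hε).indicator hs

theorem IsTruncatable.add {d : ℕ} {K : Rd d → Rd d → ℝ} {f g : Rd d → ℝ}
    (hf : IsTruncatable K f) (hg : IsTruncatable K g) : IsTruncatable K (f + g) := by
  intro x ε hε
  simpa only [Pi.add_apply, mul_add] using! (hf x ε hε).add (hg x ε hε)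

/-- The annulus around `x` with inner radius `a` and outer radius `b`. -/
def annulus {d : ℕ} (x : Rd d) (a b : ℝ) : Set (Rd d) := {y | a < ‖x - y‖ ∧ ‖x - y‖ ≤ b}

theorem measurableSet_annulus {d : ℕ} (x : Rd d) (a b : ℝ) : MeasurableSet (annulus x a b) :=
  (measurableSet_lt_norm_sub x a).inter
    (measurableSet_le (f := fun y : Rd d => ‖x - y‖) (g := fun _ => b) (by fun_prop) (by fun_prop))

theorem IsTruncatable.integrableOn_annulus {d : ℕ} {K : Rd d → Rd d → ℝ} {f : Rd d → ℝ}
    (hf : IsTruncatable K f) (x : Rd d) {a : ℝ} (ha : 0 < a) (b : ℝ) :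
    IntegrableOn (fun y => K x y * f y) (annulus x a b) :=
  (hf x a ha).mono_set fun _ hy => hy.1

theorem IsTruncatable.truncation_sub {d : ℕ} {K : Rd d → Rd d → ℝ} {f : Rd d → ℝ}
    (hf : IsTruncatable K f) (x : Rd d) {a b : ℝ} (ha : 0 < a) (hab : a ≤ b) :
    truncation K a f x - truncation K b f x = ∫ y in annulus x a b, K x y * f y := by
  have hunion : {y : Rd d | a < ‖x - y‖} = annulus x a b ∪ {y | b < ‖x - y‖} := by
    ext y
    simp only [annulus, mem_union, mem_ofPred_eq]
    constructor
    · intro h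
      rcases le_or_gt ‖x - y‖ b with h' | h'
      · exact Or.inl ⟨h, h'⟩
      · exact Or.inr h'
    · rintro (h | h)
      · exact h.1
      · exact hab.trans_lt h
  have hdisj : Disjoint (annulus x a b) {y | b < ‖x - y‖} :=
    Set.disjoint_left.2 fun y hy hy' => not_lt.2 hy.2 hy'
  rw [truncation, truncation, hunion, setIntegral_union hdisj (measurableSet_lt_norm_sub x b)
    (hf.integrableOn_annulus x ha b) (hf x b (ha.trans_le hab))]
  ring

/-! ### Sequence norms and the increments of the truncations -/

/-- The `ℓ^ρ` norm of a sequence in `[0, ∞]`. -/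
def lpSeqNorm (ρ : ℝ) (a : ℕ → ℝ≥0∞) : ℝ≥0∞ := (∑' i, a i ^ ρ) ^ (1 / ρ)

theorem lpSeqNorm_mono {ρ : ℝ} (hρ : 0 < ρ) {a b : ℕ → ℝ≥0∞} (h : ∀ i, a i ≤ b i) :
    lpSeqNorm ρ a ≤ lpSeqNorm ρ b :=
  ENNReal.rpow_le_rpow (ENNReal.tsum_le_tsum fun i => ENNReal.rpow_le_rpow (h i) hρ.le)
    (by positivity)

theorem lpSeqNorm_add_le {ρ : ℝ} (hρ : 1 ≤ ρ) (a b : ℕ → ℝ≥0∞) :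
    lpSeqNorm ρ (fun i => a i + b i) ≤ lpSeqNorm ρ a + lpSeqNorm ρ b := by
  have := ENNReal.lintegral_Lp_add_le (μ := Measure.count) (f := a) (g := b) (p := ρ)
    (measurable_from_top).aemeasurable (measurable_from_top).aemeasurable hρ
  simpa only [lintegral_count, lpSeqNorm, Pi.add_apply] using this

/-- With `S` the sum of the `a i ^ r`, each of these is at most `S`, so `a i ^ ρ ≤ a i ^ r * S ^ (ρ
/ r - 1)`. It allows smooth terms to be summed in `ℓ¹` and boundary terms in `ℓ^r` or `ℓ²`. -/
theorem lpSeqNorm_anti {r ρ : ℝ} (hr : 0 < r) (h : r ≤ ρ) (a : ℕ → ℝ≥0∞) :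
    lpSeqNorm ρ a ≤ lpSeqNorm r a := by
  have hρ : 0 < ρ := hr.trans_le h
  have h1 : ∑' i, a i ^ ρ ≤ (∑' i, a i ^ r) ^ (ρ / r) := by
    set S := ∑' i, a i ^ r with hS
    have e : ∀ c : ℝ≥0∞, c ^ (ρ / r) = c * c ^ (ρ / r - 1) := fun c => by
      nth_rewrite 2 [← ENNReal.rpow_one c]
      rw [← ENNReal.rpow_add_of_nonneg _ _ zero_le_one (by
        rw [sub_nonneg, one_le_div hr]; exact h)]
      congr 1; ring
    calc ∑' i, a i ^ ρ = ∑' i, (a i ^ r) ^ (ρ / r) := by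
          congr 1; ext i
          rw [← ENNReal.rpow_mul, mul_div_cancel₀ _ hr.ne']
      _ ≤ ∑' i, a i ^ r * S ^ (ρ / r - 1) := by
          refine ENNReal.tsum_le_tsum fun i => ?_
          rw [e]
          gcongr
          · rw [sub_nonneg, one_le_div hr]; exact h
          · exact ENNReal.le_tsum i
      _ = S ^ (ρ / r) := by rw [ENNReal.tsum_mul_right, e]
  calc lpSeqNorm ρ a ≤ ((∑' i, a i ^ r) ^ (ρ / r)) ^ (1 / ρ) :=
        ENNReal.rpow_le_rpow h1 (by positivity)
    _ = lpSeqNorm r a := by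
        rw [← ENNReal.rpow_mul, lpSeqNorm]
        congr 1
        field_simp

theorem lpSeqNorm_le_tsum {ρ : ℝ} (hρ : 1 ≤ ρ) (a : ℕ → ℝ≥0∞) :
    lpSeqNorm ρ a ≤ ∑' i, a i := by
  simpa [lpSeqNorm] using lpSeqNorm_anti one_pos hρ a

/-- The integral of `f` against `K` over the `i`-th annulus. -/
def increment {d : ℕ} (K : Rd d → Rd d → ℝ) (ε : ℕ → ℝ) (f : Rd d → ℝ) (x : Rd d) (i : ℕ) : ℝ :=
  ∫ y in annulus x (ε (i + 1)) (ε i), K x y * f y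

theorem IsTruncatable.variation_eq {d : ℕ} {K : Rd d → Rd d → ℝ} {f : Rd d → ℝ}
    (hf : IsTruncatable K f) (ρ : ℝ) (x : Rd d) :
    variation K ρ f x = ⨆ (ε : ℕ → ℝ) (_ : DecreasesToZero ε),
      lpSeqNorm ρ fun i => ‖increment K ε f x i‖ₑ := by
  simp only [variation, lpSeqNorm, increment]
  congr! 8 with ε hε i
  rw [hf.truncation_sub x (hε.1 _) (hε.2.1 (Nat.le_succ i))]

theorem IsTruncatable.increment_add {d : ℕ} {K : Rd d → Rd d → ℝ} {f g : Rd d → ℝ}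
    (hf : IsTruncatable K f) (hg : IsTruncatable K g) {ε : ℕ → ℝ} (hε : DecreasesToZero ε)
    (x : Rd d) (i : ℕ) :
    increment K ε (f + g) x i = increment K ε f x i + increment K ε g x i := by
  simp only [increment, Pi.add_apply, mul_add]
  exact integral_add (hf.integrableOn_annulus x (hε.1 _) _) (hg.integrableOn_annulus x (hε.1 _) _)

theorem IsTruncatable.variation_add_le {d : ℕ} {K : Rd d → Rd d → ℝ} {f g : Rd d → ℝ}
    (hf : IsTruncatable K f) (hg : IsTruncatable K g) {ρ : ℝ} (hρ : 1 ≤ ρ) (x : Rd d) :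
    variation K ρ (f + g) x ≤ variation K ρ f x + variation K ρ g x := by
  rw [(hf.add hg).variation_eq, hf.variation_eq, hg.variation_eq]
  refine iSup₂_le fun ε hε => ?_
  calc lpSeqNorm ρ (fun i => ‖increment K ε (f + g) x i‖ₑ)
      ≤ lpSeqNorm ρ (fun i => ‖increment K ε f x i‖ₑ + ‖increment K ε g x i‖ₑ) := by
        refine lpSeqNorm_mono (by linarith) fun i => ?_
        rw [hf.increment_add hg hε]
        exact enorm_add_le _ _
    _ ≤ _ := lpSeqNorm_add_le hρ _ _
    _ ≤ _ := add_le_add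
        (le_iSup₂ (f := fun ε (_ : DecreasesToZero ε) =>
          lpSeqNorm ρ fun i => ‖increment K ε f x i‖ₑ) ε hε)
        (le_iSup₂ (f := fun ε (_ : DecreasesToZero ε) =>
          lpSeqNorm ρ fun i => ‖increment K ε g x i‖ₑ) ε hε)

theorem IsTruncatable.grandMaximal_add_le {d : ℕ} {K : Rd d → Rd d → ℝ} {f g : Rd d → ℝ}
    (hf : IsTruncatable K f) (hg : IsTruncatable K g) {ρ : ℝ} (hρ : 1 ≤ ρ) (x : Rd d) :
    grandMaximal K ρ (f + g) x ≤ grandMaximal K ρ f x + grandMaximal K ρ g x := by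
  refine iSup₂_le fun c l => iSup₂_le fun hl hx => ?_
  have hm := (measurableSet_cube c (3 * l)).compl
  have h1 : variation K ρ ((cube c (3 * l))ᶜ.indicator (f + g)) ≤
      variation K ρ ((cube c (3 * l))ᶜ.indicator f) +
        variation K ρ ((cube c (3 * l))ᶜ.indicator g) := fun z => by
    rw [indicator_add']
    exact (hf.indicator hm).variation_add_le (hg.indicator hm) hρ z
  refine (essSup_mono_ae (ae_of_all _ h1)).trans ((ENNReal.essSup_add_le _ _).trans ?_)
  exact add_le_add (le_iSup₂_of_le c l (le_iSup₂_of_le hl hx le_rfl))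
    (le_iSup₂_of_le c l (le_iSup₂_of_le hl hx le_rfl))

/-- A weighted Hölder inequality for sums of powers of integrals. -/
theorem tsum_lintegral_rpow_le {α : Type*} [MeasurableSpace α] {μ : Measure α}
    {a : ℕ → α → ℝ≥0∞} {g θ : α → ℝ≥0∞} (ha : ∀ i, AEMeasurable (a i) μ) (hg : AEMeasurable g μ)
    (hθ : AEMeasurable θ μ) (hθ0 : ∀ y, θ y ≠ 0) (hθt : ∀ y, θ y ≠ ∞) {r : ℝ} (hr : 1 < r)
    {Λ : ℝ≥0∞} (hΛ : ∀ i, ∫⁻ y, a i y * (θ y)⁻¹ ∂μ ≤ Λ) :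
    ∑' i, (∫⁻ y, a i y * g y ∂μ) ^ r ≤
      Λ ^ (r - 1) * ∫⁻ y, (∑' i, a i y) * (θ y ^ (r - 1) * g y ^ r) ∂μ := by
  have hr0 : 0 < r := by linarith
  have hr1 : 0 < r - 1 := by linarith
  have hi : ∀ i, (∫⁻ y, a i y * g y ∂μ) ^ r ≤
      Λ ^ (r - 1) * ∫⁻ y, a i y * (θ y ^ (r - 1) * g y ^ r) ∂μ := by
    intro i
    -- The powers of `θ` cancel. Hölder's inequality with exponents `r / (r - 1)` and `r` isolates
    -- the first factor, whose integral is bounded uniformly in `i`; the second is additive in `i`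
    -- after raising to the power `r`.
    have hpt : ∀ y, a i y * g y = (a i y * (θ y)⁻¹) ^ ((r - 1) / r) *
        (a i y * (θ y ^ (r - 1) * g y ^ r)) ^ (1 / r) := by
      intro y
      have e1 : (a i y) ^ ((r - 1) / r) * (a i y) ^ (1 / r) = a i y := by
        rw [← ENNReal.rpow_add_of_nonneg _ _ (by positivity) (by positivity)]
        have : (r - 1) / r + 1 / r = 1 := by field_simp; ring
        rw [this, ENNReal.rpow_one]
      have e2 : ((θ y)⁻¹) ^ ((r - 1) / r) * (θ y ^ (r - 1)) ^ (1 / r) = 1 := by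
        rw [← ENNReal.rpow_mul, mul_one_div, ← ENNReal.mul_rpow_of_nonneg _ _ (by positivity),
          ENNReal.inv_mul_cancel (hθ0 y) (hθt y), ENNReal.one_rpow]
      have e3 : (g y ^ r) ^ (1 / r) = g y := by
        rw [← ENNReal.rpow_mul, mul_one_div_cancel hr0.ne', ENNReal.rpow_one]
      rw [ENNReal.mul_rpow_of_nonneg _ _ (by positivity : 0 ≤ (r - 1) / r),
        ENNReal.mul_rpow_of_nonneg _ _ (by positivity : 0 ≤ 1 / r),
        ENNReal.mul_rpow_of_nonneg _ _ (by positivity : 0 ≤ 1 / r), e3]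
      calc a i y * g y = ((a i y) ^ ((r - 1) / r) * (a i y) ^ (1 / r)) *
            (((θ y)⁻¹) ^ ((r - 1) / r) * (θ y ^ (r - 1)) ^ (1 / r)) * g y := by
            rw [e1, e2, mul_one]
        _ = _ := by ring
    calc (∫⁻ y, a i y * g y ∂μ) ^ r
        ≤ ((∫⁻ y, a i y * (θ y)⁻¹ ∂μ) ^ ((r - 1) / r) *
            (∫⁻ y, a i y * (θ y ^ (r - 1) * g y ^ r) ∂μ) ^ (1 / r)) ^ r := by
          refine ENNReal.rpow_le_rpow ?_ hr0.le
          simp_rw [hpt]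
          exact ENNReal.lintegral_mul_norm_pow_le ((ha i).mul hθ.inv)
            ((ha i).mul ((hθ.pow_const _).mul (hg.pow_const _))) (by positivity) (by positivity)
            (by field_simp; ring)
      _ = (∫⁻ y, a i y * (θ y)⁻¹ ∂μ) ^ (r - 1) *
            ∫⁻ y, a i y * (θ y ^ (r - 1) * g y ^ r) ∂μ := by
          rw [ENNReal.mul_rpow_of_nonneg _ _ hr0.le, ← ENNReal.rpow_mul, ← ENNReal.rpow_mul,
            div_mul_cancel₀ _ hr0.ne', one_div_mul_cancel hr0.ne', ENNReal.rpow_one]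
      _ ≤ _ := by
          gcongr
          exact hΛ i
  calc _ ≤ ∑' i, Λ ^ (r - 1) * ∫⁻ y, a i y * (θ y ^ (r - 1) * g y ^ r) ∂μ :=
        ENNReal.tsum_le_tsum hi
    _ = _ := by
        rw [ENNReal.tsum_mul_left, ← lintegral_tsum]
        · simp_rw [ENNReal.tsum_mul_right]
        · exact fun i => (ha i).mul ((hθ.pow_const _).mul (hg.pow_const _))

/-! ### Integrals over thin shells -/

theorem lintegral_fun_norm {d : ℕ} (hd : 0 < d) {f : ℝ → ℝ≥0∞} (hf : Measurable f) :
    ∫⁻ x : Rd d, f ‖x‖ = (volume : Measure (Rd d)).toSphere univ *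
      ∫⁻ r in Ioi (0 : ℝ), ENNReal.ofReal (r ^ (d - 1)) * f r := by
  have : Nonempty (Fin d) := ⟨⟨0, hd⟩⟩
  have hdim : Module.finrank ℝ (Rd d) = d := by simp
  have hmp := (volume : Measure (Rd d)).measurePreserving_homeomorphUnitSphereProd
  have h1 : ∫⁻ x : Rd d, f ‖x‖ = ∫⁻ x : ({0}ᶜ : Set (Rd d)), f ‖x.1‖
      ∂((volume : Measure (Rd d)).comap Subtype.val) := by
    rw [lintegral_subtype_comap (measurableSet_singleton _).compl fun x : Rd d => f ‖x‖,
      restrict_compl_singleton]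
  have h2 := hmp.lintegral_comp (f := fun z : sphere (0 : Rd d) 1 × Ioi (0 : ℝ) => f z.2)
    (by fun_prop)
  simp only [homeomorphUnitSphereProd_apply_snd_coe] at h2
  rw [h1, h2, lintegral_prod _ (by fun_prop)]
  simp only [lintegral_const]
  rw [mul_comm]
  congr 1
  rw [Measure.volumeIoiPow, lintegral_withDensity_eq_lintegral_mul _ (by fun_prop) (by fun_prop),
    hdim]
  simp only [Pi.mul_apply]
  rw [lintegral_subtype_comap measurableSet_Ioi fun r : ℝ => ENNReal.ofReal (r ^ (d - 1)) * f r]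

theorem lintegral_abs_inv_sqrt_le {ε : ℝ} (hε : 0 < ε) :
    ∫⁻ r in Ico 0 (2 * ε), (ENNReal.ofReal |r - ε|)⁻¹ ^ (1 / 2 : ℝ) ≤
      4 * ENNReal.ofReal ε ^ (1 / 2 : ℝ) := by
  have hpos : ∫⁻ t in Ioo 0 ε, (ENNReal.ofReal t)⁻¹ ^ (1 / 2 : ℝ) =
      2 * ENNReal.ofReal ε ^ (1 / 2 : ℝ) := by
    have h := setLIntegral_rpow_lt (s := -(1 / 2)) (by norm_num) (ENNReal.ofReal ε)
    have hset : Ioi 0 ∩ {t : ℝ | ENNReal.ofReal t < ENNReal.ofReal ε} = Ioo 0 ε := by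
      ext t
      simp [ENNReal.ofReal_lt_ofReal_iff hε]
    rw [hset] at h
    calc _ = ∫⁻ t in Ioo 0 ε, ENNReal.ofReal (t ^ (-(1 / 2) : ℝ)) := by
          refine setLIntegral_congr_fun measurableSet_Ioo fun t ht => ?_
          rw [← ENNReal.ofReal_rpow_of_pos ht.1, ENNReal.inv_rpow, ENNReal.rpow_neg]
      _ = _ := by
          rw [h, mul_comm]
          norm_num
  have hemb : ∀ s : Set ℝ, MeasurableSet s → ∀ g : ℝ → ℝ, MeasurePreserving g volume volume →
      MeasurableEmbedding g → ∫⁻ r in g ⁻¹' s, (ENNReal.ofReal (g r))⁻¹ ^ (1 / 2 : ℝ) =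
        ∫⁻ t in s, (ENNReal.ofReal t)⁻¹ ^ (1 / 2 : ℝ) := fun s hs g hg he =>
    hg.setLIntegral_comp_preimage_emb he (fun t => (ENNReal.ofReal t)⁻¹ ^ (1 / 2 : ℝ)) s
  have e1 : ∫⁻ r in Ioo ε (2 * ε), (ENNReal.ofReal |r - ε|)⁻¹ ^ (1 / 2 : ℝ) =
      2 * ENNReal.ofReal ε ^ (1 / 2 : ℝ) := by
    rw [← hpos, ← hemb _ measurableSet_Ioo (fun r => r - ε) (measurePreserving_sub_right _ ε)
      (measurableEmbedding_subRight ε)]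
    have : (fun r => r - ε) ⁻¹' Ioo 0 ε = Ioo ε (2 * ε) := by
      ext r
      simp only [mem_preimage, mem_Ioo]
      constructor <;> rintro ⟨h1, h2⟩ <;> constructor <;> linarith
    rw [this]
    refine setLIntegral_congr_fun measurableSet_Ioo fun r hr => ?_
    rw [abs_of_pos (by linarith [hr.1])]
  have e2 : ∫⁻ r in Ioo 0 ε, (ENNReal.ofReal |r - ε|)⁻¹ ^ (1 / 2 : ℝ) =
      2 * ENNReal.ofReal ε ^ (1 / 2 : ℝ) := by
    rw [← hpos, ← hemb _ measurableSet_Ioo (fun r => ε - r)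
      (volume.measurePreserving_sub_left ε) (Homeomorph.subLeft ε).measurableEmbedding]
    have : (fun r => ε - r) ⁻¹' Ioo 0 ε = Ioo 0 ε := by
      ext r
      simp only [mem_preimage, mem_Ioo]
      constructor <;> rintro ⟨h1, h2⟩ <;> constructor <;> linarith
    rw [this]
    refine setLIntegral_congr_fun measurableSet_Ioo fun r hr => ?_
    rw [abs_of_neg (by linarith [hr.2])]
    congr 3
    ring
  have hsub : Ico 0 (2 * ε) ⊆ (Ioo 0 ε ∪ Ioo ε (2 * ε)) ∪ {0, ε} := by
    intro r hr
    simp only [mem_union, mem_Ioo, mem_insert_iff, mem_singleton_iff]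
    rcases hr.1.eq_or_lt with h | h
    · exact Or.inr (Or.inl h.symm)
    rcases lt_trichotomy r ε with h' | h' | h'
    · exact Or.inl (Or.inl ⟨h, h'⟩)
    · exact Or.inr (Or.inr h')
    · exact Or.inl (Or.inr ⟨h', hr.2⟩)
  calc _ ≤ ∫⁻ r in (Ioo 0 ε ∪ Ioo ε (2 * ε)) ∪ {0, ε},
        (ENNReal.ofReal |r - ε|)⁻¹ ^ (1 / 2 : ℝ) := lintegral_mono_set hsub
    _ ≤ (2 * ENNReal.ofReal ε ^ (1 / 2 : ℝ) + 2 * ENNReal.ofReal ε ^ (1 / 2 : ℝ)) + 0 := by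
        refine (lintegral_union_le _ _ _).trans (add_le_add ?_ (le_of_eq ?_))
        · refine (lintegral_union_le _ _ _).trans (le_of_eq ?_)
          rw [e1, e2]
        · exact setLIntegral_measure_zero _ _ ((Set.toFinite {0, ε}).measure_zero _)
    _ = _ := by ring

/-- The set of points whose distance to the sphere of centre `x` and radius `ε` is at most half
of their distance to `x`. -/
def shell {d : ℕ} (x : Rd d) (ε : ℝ) : Set (Rd d) := {y | |‖x - y‖ - ε| ≤ ‖x - y‖ / 2}

theorem measurableSet_shell {d : ℕ} (x : Rd d) (ε : ℝ) : MeasurableSet (shell x ε) :=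
  measurableSet_le (f := fun y : Rd d => |‖x - y‖ - ε|) (by fun_prop) (by fun_prop)

/-- The weight with an inverse square root singularity on the sphere of centre `x` and radius
`ε`. -/
def shellWeight {d : ℕ} (x : Rd d) (ε : ℝ) (y : Rd d) : ℝ≥0∞ :=
  (ENNReal.ofReal ‖x - y‖ * (ENNReal.ofReal |‖x - y‖ - ε|)⁻¹) ^ (1 / 2 : ℝ)

/-- In polar coordinates the integrand becomes `r^{-1/2} |r - ε|^{-1/2}` on `2ε/3 ≤ r ≤ 2ε`. This is
integrable at `r = ε` and invariant under scaling, so the bound depends on neither `x` nor `ε`. -/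
theorem exists_lintegral_shell_le {d : ℕ} (hd : 0 < d) :
    ∃ B : ℝ≥0, ∀ (x : Rd d) (ε : ℝ), 0 < ε →
      ∫⁻ y in shell x ε, ENNReal.ofReal (‖x - y‖ ^ d)⁻¹ * shellWeight x ε y ≤ B := by
  set σ := (volume : Measure (Rd d)).toSphere univ with hσ
  have hσt : σ ≠ ∞ := measure_ne_top _ _
  set c : ℝ≥0∞ := ENNReal.ofReal (3 / 2) ^ (1 / 2 : ℝ) with hc
  have hct : c ≠ ∞ := ENNReal.rpow_ne_top_of_nonneg (by norm_num) ENNReal.ofReal_ne_top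
  refine ⟨(σ * (c * 4)).toNNReal, fun x ε hε => ?_⟩
  rw [ENNReal.coe_toNNReal (by finiteness)]
  set F : ℝ → ℝ≥0∞ := {r | |r - ε| ≤ r / 2}.indicator fun r => ENNReal.ofReal (r ^ d)⁻¹ *
    (ENNReal.ofReal r * (ENNReal.ofReal |r - ε|)⁻¹) ^ (1 / 2 : ℝ) with hF
  have hFm : Measurable F :=
    Measurable.indicator (by fun_prop) (measurableSet_le (by fun_prop) (by fun_prop))
  have hεr : ENNReal.ofReal ε ^ (1 / 2 : ℝ) ≠ 0 := by
    simp [hε]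
  have hεt : ENNReal.ofReal ε ^ (1 / 2 : ℝ) ≠ ∞ :=
    ENNReal.rpow_ne_top_of_nonneg (by norm_num) ENNReal.ofReal_ne_top
  calc _ = ∫⁻ y : Rd d, F ‖y - x‖ := by
        rw [← lintegral_indicator (measurableSet_shell x ε)]
        refine lintegral_congr fun y => ?_
        rw [norm_sub_rev y x]
        simp only [indicator, shell, hF, shellWeight]
        rfl
    _ = ∫⁻ y : Rd d, F ‖y‖ := lintegral_sub_right_eq_self (fun y => F ‖y‖) x
    _ = σ * ∫⁻ r in Ioi (0 : ℝ), ENNReal.ofReal (r ^ (d - 1)) * F r := lintegral_fun_norm hd hFm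
    -- The constant `c` comes from `r ≥ 2ε/3`. The endpoint `r = 2ε` belongs to the shell but not to
    -- the half-open interval; the value `∞` on this null set absorbs it.
    _ ≤ σ * ∫⁻ r in Ioi (0 : ℝ), (Ico 0 (2 * ε)).indicator (fun r =>
          c * (ENNReal.ofReal ε ^ (1 / 2 : ℝ))⁻¹ *
            (ENNReal.ofReal |r - ε|)⁻¹ ^ (1 / 2 : ℝ)) r +
          ({2 * ε} : Set ℝ).indicator (fun _ => ∞) r := by
        gcongr σ * ?_
        refine setLIntegral_mono' measurableSet_Ioi fun r hr => ?_
        have hr0 : 0 < r := hr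
        by_cases hrε : |r - ε| ≤ r / 2
        · have h1 := abs_le.1 hrε
          rcases eq_or_ne r (2 * ε) with h2 | h2
          · simp [h2]
          have hmem : r ∈ Ico 0 (2 * ε) := ⟨hr0.le, lt_of_le_of_ne (by linarith) h2⟩
          rw [hF, indicator_of_mem (show r ∈ {r | |r - ε| ≤ r / 2} from hrε),
            indicator_of_mem hmem]
          refine le_trans ?_ le_self_add
          rw [ENNReal.mul_rpow_of_nonneg _ _ (by norm_num), ← mul_assoc, ← mul_assoc]
          refine mul_le_mul_left ?_ _
          rw [← ENNReal.inv_rpow, hc, ← ENNReal.mul_rpow_of_nonneg _ _ (by norm_num),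
            ← ENNReal.ofReal_inv_of_pos hε, ← ENNReal.ofReal_mul (pow_nonneg hr0.le _),
            ← ENNReal.ofReal_mul (by norm_num)]
          have e : r ^ (d - 1) * (r ^ d)⁻¹ = r⁻¹ := by
            obtain ⟨n, rfl⟩ := Nat.exists_eq_succ_of_ne_zero hd.ne'
            simp only [Nat.succ_sub_one]
            rw [pow_succ]
            field_simp
          rw [e]
          have e2 : ENNReal.ofReal r⁻¹ = ENNReal.ofReal r⁻¹ ^ (1 / 2 : ℝ) *
              ENNReal.ofReal r⁻¹ ^ (1 / 2 : ℝ) := by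
            rw [← ENNReal.rpow_add_of_nonneg _ _ (by norm_num) (by norm_num)]
            norm_num
          rw [e2, mul_assoc, ← ENNReal.mul_rpow_of_nonneg (ENNReal.ofReal r⁻¹) (ENNReal.ofReal r)
            (by norm_num), ← ENNReal.ofReal_mul (by positivity), inv_mul_cancel₀ hr0.ne',
            ENNReal.ofReal_one, ENNReal.one_rpow, mul_one]
          gcongr
          rw [inv_le_comm₀ hr0 (by positivity), mul_inv, inv_inv]
          linarith
        · rw [hF, indicator_of_notMem (show r ∉ {r | |r - ε| ≤ r / 2} from hrε), mul_zero]
          exact zero_le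
    _ ≤ σ * (c * (ENNReal.ofReal ε ^ (1 / 2 : ℝ))⁻¹ *
          (4 * ENNReal.ofReal ε ^ (1 / 2 : ℝ)) + 0) := by
        gcongr σ * ?_
        refine (setLIntegral_le_lintegral _ _).trans ?_
        rw [lintegral_add_right _ (measurable_const.indicator (measurableSet_singleton _)),
          lintegral_indicator measurableSet_Ico, lintegral_indicator (measurableSet_singleton _),
          lintegral_const_mul _ (by fun_prop)]
        gcongr
        · exact lintegral_abs_inv_sqrt_le hε
        · simp
    _ = σ * (c * 4 * ((ENNReal.ofReal ε ^ (1 / 2 : ℝ))⁻¹ * ENNReal.ofReal ε ^ (1 / 2 : ℝ))) := by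
        ring
    _ = _ := by rw [ENNReal.inv_mul_cancel hεr hεt, mul_one]

/-! ### Oscillation of the variation over a cube -/

/-- The weight `|x - y|^{-d}`. -/
def invPow {d : ℕ} (x y : Rd d) : ℝ≥0∞ := ENNReal.ofReal (‖x - y‖ ^ d)⁻¹

theorem measurable_invPow {d : ℕ} (x : Rd d) : Measurable (invPow x) := by
  unfold invPow
  fun_prop

theorem measurable_invPow_left {d : ℕ} (y : Rd d) : Measurable fun x => invPow x y := by
  unfold invPow
  fun_prop

theorem invPow_le {d : ℕ} {x x' y : Rd d} {m : ℝ} (h0 : 0 < ‖x' - y‖) (hm : 0 < m)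
    (h : ‖x' - y‖ ≤ m * ‖x - y‖) : invPow x y ≤ ENNReal.ofReal (m ^ d) * invPow x' y := by
  rw [invPow, invPow, ← ENNReal.ofReal_mul (by positivity)]
  apply ENNReal.ofReal_le_ofReal
  have h1 : 0 < ‖x - y‖ := by
    by_contra! hcon
    have : m * ‖x - y‖ ≤ 0 := mul_nonpos_of_nonneg_of_nonpos hm.le hcon
    linarith
  rw [← div_eq_mul_inv, ← one_div, div_le_div_iff₀ (by positivity) (by positivity), one_mul,
    ← mul_pow]
  gcongr

theorem tsum_indicator_annulus_le {d : ℕ} {ε : ℕ → ℝ} (hε : Antitone ε) (x y : Rd d)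
    (c : ℝ≥0∞) : ∑' i, (annulus x (ε (i + 1)) (ε i)).indicator (fun _ => c) y ≤ c := by
  by_cases h : ∃ i, y ∈ annulus x (ε (i + 1)) (ε i)
  · obtain ⟨i, hi⟩ := h
    rw [tsum_eq_single i]
    · exact indicator_le_self _ _ _
    · intro j hj
      refine indicator_of_notMem (fun hjm => ?_) _
      rcases lt_or_gt_of_ne hj with h' | h'
      · have := hε (Nat.succ_le_of_lt h')
        exact (hjm.1.trans_le (hi.2.trans this)).false
      · have := hε (Nat.succ_le_of_lt h')
        exact (hi.1.trans_le (hjm.2.trans this)).false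
  · push Not at h
    rw [ENNReal.tsum_eq_zero.2 fun i => indicator_of_notMem (h i) _]
    exact zero_le

namespace IsRegularKernel

variable {d : ℕ} {K : Rd d → Rd d → ℝ} {C : ℝ} {Ω : ℝ → ℝ}

theorem enorm_le_invPow (hK : IsRegularKernel K C Ω) {x ξ y : Rd d} {m : ℝ} (hm : 0 < m)
    (h0 : 0 < ‖x - y‖) (h : ‖x - y‖ ≤ m * ‖ξ - y‖) :
    ‖K ξ y‖ₑ ≤ ENNReal.ofReal (C * m ^ d) * invPow x y := by
  have hne : ξ ≠ y := by
    rintro rfl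
    simp only [sub_self, norm_zero, mul_zero] at h
    linarith
  refine (hK.enorm_le hne).trans ?_
  rw [ENNReal.ofReal_mul hK.nonneg, mul_assoc]
  gcongr
  exact invPow_le h0 hm h

/-- As `a ≥ 1`, `(1 / a)² ≤ 1 / a ≤ t`, hence `1 / a ≤ √t ≤ Ω t`. Thus a crude size bound at
distance comparable to the side length can be written as a smoothness bound. -/
theorem one_le_modulus (hK : IsRegularKernel K C Ω) {a : ℝ} (ha : 1 ≤ a) {t : ℝ}
    (ht : 1 / a ≤ t) : 1 ≤ ENNReal.ofReal a * ENNReal.ofReal (Ω t) := by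
  rw [← ENNReal.ofReal_mul (by positivity), ← ENNReal.ofReal_one]
  apply ENNReal.ofReal_le_ofReal
  have h1 : 1 / a ≤ √t := by
    refine Real.le_sqrt_of_sq_le (le_trans ?_ ht)
    rw [sq]
    exact mul_le_of_le_one_left (by positivity) ((div_le_one (by positivity)).2 ha)
  calc (1 : ℝ) = a * (1 / a) := by field_simp
    _ ≤ a * Ω t := by
      gcongr
      exact h1.trans (hK.sqrt_le t)

/-- Moving the estimate from `ξ` to the base point `x` multiplies the argument of `Ω` by at most `m
* m`, which doubling turns into the factor `2 ^ n`. -/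
theorem enorm_sub_le (hK : IsRegularKernel K C Ω) {x ξ ξ' y : Rd d} {m l : ℝ} (hm : 1 ≤ m)
    (hl : 0 ≤ l) {n : ℕ} (hn : m * m ≤ 2 ^ n) (h0 : 0 < ‖x - y‖) (h : ‖x - y‖ ≤ m * ‖ξ - y‖)
    (hξ : ‖ξ - ξ'‖ ≤ m * l) (hfar : ‖ξ - ξ'‖ ≤ ‖ξ - y‖ / 2) :
    ‖K ξ y - K ξ' y‖ₑ ≤
      ENNReal.ofReal (C * m ^ d) * ENNReal.ofReal (2 ^ n) * ENNReal.ofReal (Ω (l / ‖x - y‖)) *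
        invPow x y := by
  have hξy : 0 < ‖ξ - y‖ := by
    by_contra! hcon
    have : m * ‖ξ - y‖ ≤ 0 := mul_nonpos_of_nonneg_of_nonpos (by linarith) hcon
    linarith
  have hne : ξ ≠ y := by
    rintro rfl
    simp at hξy
  have h1 := hK.smooth_left ξ ξ' y hne hfar
  have h2 : Ω (‖ξ - ξ'‖ / ‖ξ - y‖) ≤ 2 ^ n * Ω (l / ‖x - y‖) := by
    refine hK.modulus_le (by positivity) ?_
    calc ‖ξ - ξ'‖ / ‖ξ - y‖ ≤ (m * l) / (‖x - y‖ / m) := by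
          gcongr
          rw [div_le_iff₀ (by linarith)]
          linarith
      _ = m * m * (l / ‖x - y‖) := by field_simp
      _ ≤ _ := by gcongr
  calc ‖K ξ y - K ξ' y‖ₑ ≤ ENNReal.ofReal (C * (2 ^ n * Ω (l / ‖x - y‖)) * (‖ξ - y‖ ^ d)⁻¹) := by
        rw [Real.enorm_eq_ofReal_abs]
        apply ENNReal.ofReal_le_ofReal
        refine h1.trans ?_
        have := hK.nonneg
        gcongr
    _ = ENNReal.ofReal C * (ENNReal.ofReal (2 ^ n) * ENNReal.ofReal (Ω (l / ‖x - y‖))) *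
          invPow ξ y := by
        have := hK.modulus_nonneg (l / ‖x - y‖)
        rw [invPow, ← ENNReal.ofReal_mul (by positivity), ← ENNReal.ofReal_mul hK.nonneg,
          ← ENNReal.ofReal_mul (mul_nonneg hK.nonneg (by positivity))]
    _ ≤ ENNReal.ofReal C * (ENNReal.ofReal (2 ^ n) * ENNReal.ofReal (Ω (l / ‖x - y‖))) *
          (ENNReal.ofReal (m ^ d) * invPow x y) := by
        gcongr
        exact invPow_le h0 (by linarith) h
    _ = _ := by
        rw [ENNReal.ofReal_mul hK.nonneg]
        ring

end IsRegularKernel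

/-- The distances of `y` from the two centres differ by at most `δ`, so equal radii can separate
them only within `δ` of a bounding sphere. -/
theorem mem_shell_of_mem_annulus {d : ℕ} {ξ ξ' y : Rd d} {a b δ : ℝ} (hδ : ‖ξ - ξ'‖ ≤ δ)
    (h : (y ∈ annulus ξ a b ∧ y ∉ annulus ξ' a b) ∨ (y ∉ annulus ξ a b ∧ y ∈ annulus ξ' a b)) :
    |‖ξ - y‖ - a| ≤ δ ∨ |‖ξ - y‖ - b| ≤ δ := by
  have h1 : |‖ξ - y‖ - ‖ξ' - y‖| ≤ δ := by
    refine (abs_norm_sub_norm_le _ _).trans ?_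
    simpa using hδ
  rw [abs_le] at h1
  simp only [annulus, mem_ofPred_eq, not_and_or, not_lt, not_le] at h
  simp only [abs_le]
  rcases h with ⟨⟨h2, h3⟩, h4 | h4⟩ | ⟨h4 | h4, h2, h3⟩
  · left; constructor <;> linarith
  · right; constructor <;> linarith
  · left; constructor <;> linarith
  · right; constructor <;> linarith

theorem IsTruncatable.enorm_increment_le {d : ℕ} {K : Rd d → Rd d → ℝ} {f : Rd d → ℝ}
    {G : Set (Rd d)} (hG : MeasurableSet G) (hf : IsTruncatable K f) {ε : ℕ → ℝ}
    (hε : DecreasesToZero ε) (x x' : Rd d) (i : ℕ) :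
    ‖increment K ε (G.indicator f) x i‖ₑ ≤ ‖increment K ε (G.indicator f) x' i‖ₑ +
      ∫⁻ y in G, ‖(annulus x (ε (i + 1)) (ε i)).indicator (K x) y -
        (annulus x' (ε (i + 1)) (ε i)).indicator (K x') y‖ₑ * ‖f y‖ₑ := by
  have hind : ∀ z : Rd d, increment K ε (G.indicator f) z i =
      ∫ y, (annulus z (ε (i + 1)) (ε i)).indicator (fun y => K z y * G.indicator f y) y := fun z =>
    (integral_indicator (measurableSet_annulus z _ _)).symm
  have hint : ∀ z : Rd d, Integrable
      ((annulus z (ε (i + 1)) (ε i)).indicator fun y => K z y * G.indicator f y) := fun z =>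
    (integrable_indicator_iff (measurableSet_annulus z _ _)).2
      ((hf.indicator hG).integrableOn_annulus z (hε.1 _) _)
  have h1 : increment K ε (G.indicator f) x i = increment K ε (G.indicator f) x' i +
      ∫ y, ((annulus x (ε (i + 1)) (ε i)).indicator (fun y => K x y * G.indicator f y) y -
        (annulus x' (ε (i + 1)) (ε i)).indicator (fun y => K x' y * G.indicator f y) y) := by
    rw [integral_sub (hint x) (hint x'), hind x, hind x']
    ring
  rw [h1]
  refine (enorm_add_le _ _).trans (add_le_add le_rfl ?_)
  refine (enorm_integral_le_lintegral_enorm _).trans ?_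
  rw [← lintegral_indicator hG]
  refine lintegral_mono fun y => ?_
  by_cases hy : y ∈ G
  · rw [indicator_of_mem hy, ← enorm_mul]
    refine le_of_eq ?_
    congr 1
    rw [sub_mul]
    congr 1
    · by_cases hA : y ∈ annulus x (ε (i + 1)) (ε i) <;> simp [hA, hy]
    · by_cases hA : y ∈ annulus x' (ε (i + 1)) (ε i) <;> simp [hA, hy]
  · simp [hy, Set.indicator]

/-- The variation of a function that vanishes near a cube oscillates little over the cube. -/
theorem exists_variation_le_of_mem_cube {d : ℕ} (hd : 0 < d) {K : Rd d → Rd d → ℝ} {C : ℝ}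
    {Ω : ℝ → ℝ} (hK : IsRegularKernel K C Ω) {r ρ : ℝ} (hr : 1 < r) (hrρ : r ≤ ρ) :
    ∃ A : ℝ≥0, ∀ (c : Rd d) (l : ℝ), 0 < l → ∀ x ∈ cube c l, ∀ ξ ∈ cube c l, ∀ ξ' ∈ cube c l,
      ∀ f : Rd d → ℝ, IsTruncatable K f → AEStronglyMeasurable f volume →
        variation K ρ ((cube c (3 * l))ᶜ.indicator f) ξ ≤
          variation K ρ ((cube c (3 * l))ᶜ.indicator f) ξ' +
            A * (ballMaximal (fun y => ‖f y‖ₑ) x +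
              ballMaximal (fun y => ‖f y‖ₑ ^ r) x ^ (1 / r)) := by
  obtain ⟨B, hB⟩ := exists_lintegral_shell_le hd
  have hd1 : (1 : ℝ) ≤ d := by exact_mod_cast hd
  -- For `z, w` in the cube and `y` outside its triple, `‖z - y‖ ≤ d * l + ‖w - y‖` and `l ≤ ‖w -
  -- y‖`, so all points of the cube are at comparable distance from `y`, with ratio `d + 1`.
  set m : ℝ := d + 1 with hm
  have hm1 : 1 ≤ m := by linarith
  obtain ⟨n, hn⟩ := pow_unbounded_of_one_lt (m * m) (one_lt_two)
  set c₂ : ℝ≥0∞ := ENNReal.ofReal (C * m ^ d) with hc₂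
  set c₁ : ℝ≥0∞ := c₂ * (2 * ENNReal.ofReal (3 * m) + ENNReal.ofReal (2 ^ n)) with hc₁
  set S₁ : ℝ≥0∞ := ∑' k : ℕ, ENNReal.ofReal (Ω ((1 / 2) ^ k)) with hS₁
  -- The exponent of `l / ‖x - y‖` in `θ ^ (r - 1)`; it is positive because `r > 1`, which makes the
  -- dyadic sum `S₂` finite.
  set s : ℝ := (r - 1) / 2 with hs
  have hs0 : 0 < s := by rw [hs]; linarith
  set S₂ : ℝ≥0∞ := ∑' k : ℕ, ENNReal.ofReal ((max ((1 / 2) ^ k) 0) ^ s) with hS₂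
  set Λ : ℝ≥0∞ := c₂ * ENNReal.ofReal (m ^ d) * ENNReal.ofReal (m * m) ^ (1 / 2 : ℝ) * (2 * B)
    with hΛ
  set A₁ : ℝ≥0∞ := 2 * c₁ * (2 ^ d * S₁) with hA₁
  set A₂ : ℝ≥0∞ := (Λ ^ (r - 1) * (2 * c₂ * (2 ^ d * S₂))) ^ (1 / r) with hA₂
  have hc₂t : c₂ ≠ ∞ := ENNReal.ofReal_ne_top
  have hS₁t : S₁ ≠ ∞ := hK.tsum_ne_top
  have hS₂t : S₂ ≠ ∞ := tsum_max_rpow_ne_top hs0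
  have hpt : ∀ (a : ℝ≥0∞) (t : ℝ), 0 ≤ t → a ≠ ∞ → a ^ t ≠ ∞ := fun a t ht ha =>
    ENNReal.rpow_ne_top_of_nonneg ht ha
  have hΛt : Λ ≠ ∞ := by
    have := hpt (ENNReal.ofReal (m * m)) (1 / 2) (by norm_num) ENNReal.ofReal_ne_top
    finiteness
  have hA₁t : A₁ ≠ ∞ := by finiteness
  have hA₂t : A₂ ≠ ∞ := by
    have := hpt Λ (r - 1) (by linarith) hΛt
    exact hpt _ _ (by positivity) (by finiteness)
  refine ⟨(A₁ + A₂).toNNReal, ?_⟩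
  rw [ENNReal.coe_toNNReal (ENNReal.add_ne_top.2 ⟨hA₁t, hA₂t⟩)]
  intro c l hl x hx ξ hξ ξ' hξ' f hf hfm
  set G : Set (Rd d) := (cube c (3 * l))ᶜ with hG
  have hGm : MeasurableSet G := (measurableSet_cube c (3 * l)).compl
  set u : Rd d → ℝ≥0∞ := fun y => ‖f y‖ₑ with hu
  have hum : AEMeasurable u volume := hfm.enorm
  have hfar : ∀ z ∈ cube c l, ∀ y ∈ G, l ≤ ‖z - y‖ := fun z hz y hy =>
    le_norm_sub_of_notMem_cube hz hy
  have hclose : ∀ z ∈ cube c l, ∀ w ∈ cube c l, ‖z - w‖ ≤ d * l := fun z hz w hw => by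
    have := norm_sub_le_of_mem_cube hz hw
    rwa [add_self_div_two] at this
  have hcomp : ∀ z ∈ cube c l, ∀ w ∈ cube c l, ∀ y ∈ G, ‖z - y‖ ≤ m * ‖w - y‖ := by
    intro z hz w hw y hy
    have h1 := hclose z hz w hw
    have h2 := hfar w hw y hy
    have h3 := norm_sub_le_norm_sub_add_norm_sub z w y
    rw [hm]
    nlinarith
  have hxy : ∀ y ∈ G, 0 < ‖x - y‖ := fun y hy => hl.trans_le (hfar x hx y hy)
  rw [(hf.indicator hGm).variation_eq, (hf.indicator hGm).variation_eq]
  refine iSup₂_le fun ε hε => ?_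
  refine le_trans ?_ (add_le_add_left (le_iSup₂ (f := fun ε (_ : DecreasesToZero ε) =>
    lpSeqNorm ρ fun i => ‖increment K ε (G.indicator f) ξ' i‖ₑ) ε hε) _)
  set An : Rd d → ℕ → Set (Rd d) := fun z i => annulus z (ε (i + 1)) (ε i) with hAn
  have hAnm : ∀ z i, MeasurableSet (An z i) := fun z i => measurableSet_annulus z _ _
  -- The points that only one of the two annuli contains. The threshold is twice the bound `d * l`
  -- for `‖ξ - ξ'‖`, as required both by the smoothness condition and for membership in a shell.
  -- Closer points are charged to `W` instead.
  set Bd : ℕ → Set (Rd d) := fun i => {y | 2 * (d * l) ≤ ‖ξ - y‖} ∩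
    ((An ξ i \ An ξ' i) ∪ (An ξ' i \ An ξ i)) with hBd
  have hBdm : ∀ i, MeasurableSet (Bd i) := fun i =>
    (measurableSet_le (f := fun _ => 2 * (d * l)) (by fun_prop) (by fun_prop)).inter
      (((hAnm _ _).diff (hAnm _ _)).union ((hAnm _ _).diff (hAnm _ _)))
  -- The two summands of `c₁` account for points near the cube, through `one_le_modulus`, and for
  -- the smoothness of the kernel at the others.
  set W : Rd d → ℝ≥0∞ := fun y => c₁ * (ENNReal.ofReal (Ω (l / ‖x - y‖)) * invPow x y) with hW
  have hΩm : Measurable Ω := hK.mono.measurable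
  have hWm : Measurable W := by
    have := measurable_invPow x
    fun_prop
  set α : ℕ → Rd d → ℝ≥0∞ := fun i y =>
    (An ξ i).indicator W y + (An ξ' i).indicator W y with hα
  have hαm : ∀ i, Measurable (α i) := fun i =>
    (hWm.indicator (hAnm _ _)).add (hWm.indicator (hAnm _ _))
  have hαu : ∀ i, AEMeasurable (fun y => α i y * u y) (volume.restrict G) := fun i =>
    ((hαm i).aemeasurable.mul hum).restrict
  set a : ℕ → Rd d → ℝ≥0∞ := fun i => (Bd i).indicator fun y => c₂ * invPow x y with ha
  have ham : ∀ i, Measurable (a i) := fun i =>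
    ((measurable_invPow x).const_mul _).indicator (hBdm i)
  have hK1 : ∀ z ∈ cube c l, ∀ y ∈ G, ‖K z y‖ₑ ≤ c₂ * invPow x y := fun z hz y hy =>
    hK.enorm_le_invPow (by linarith) (hxy y hy) (hcomp x hx z hz y hy)
  have hnear : ∀ y ∈ G, ‖ξ - y‖ < 2 * (d * l) →
      1 ≤ ENNReal.ofReal (3 * m) * ENNReal.ofReal (Ω (l / ‖x - y‖)) := by
    intro y hy h
    refine hK.one_le_modulus (by linarith) ?_
    rw [div_le_div_iff₀ (by positivity) (hxy y hy)]
    have h1 := hclose x hx ξ hξ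
    have h3 := norm_sub_le_norm_sub_add_norm_sub x ξ y
    nlinarith
  have hnearW : ∀ z ∈ cube c l, ∀ y ∈ G, ‖ξ - y‖ < 2 * (d * l) → 2 * ‖K z y‖ₑ ≤ W y := by
    intro z hz y hy h
    calc 2 * ‖K z y‖ₑ ≤ 2 * (c₂ * invPow x y) * 1 := by
          rw [mul_one]; gcongr; exact hK1 z hz y hy
      _ ≤ 2 * (c₂ * invPow x y) * (ENNReal.ofReal (3 * m) * ENNReal.ofReal (Ω (l / ‖x - y‖))) := by
          gcongr; exact hnear y hy h
      _ = c₂ * (2 * ENNReal.ofReal (3 * m)) *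
            (ENNReal.ofReal (Ω (l / ‖x - y‖)) * invPow x y) := by ring
      _ ≤ W y := by
          simp only [hW]
          rw [hc₁]
          gcongr
          exact le_self_add
  have hnearW' : ∀ z ∈ cube c l, ∀ y ∈ G, ‖ξ - y‖ < 2 * (d * l) → ‖K z y‖ₑ ≤ W y := by
    intro z hz y hy h
    refine le_trans ?_ (hnearW z hz y hy h)
    rw [two_mul]
    exact le_self_add
  have hdiff : ∀ y ∈ G, ‖K ξ y - K ξ' y‖ₑ ≤ 2 * W y := by
    intro y hy
    rcases lt_or_ge ‖ξ - y‖ (2 * (d * l)) with h | h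
    · refine (enorm_sub_le (E := ℝ)).trans ?_
      rw [two_mul]
      exact add_le_add (hnearW' ξ hξ y hy h) (hnearW' ξ' hξ' y hy h)
    · have h1 := hclose ξ hξ ξ' hξ'
      refine (hK.enorm_sub_le hm1 hl.le hn.le (hxy y hy) (hcomp x hx ξ hξ y hy)
        (h1.trans (by nlinarith)) (by linarith)).trans ?_
      rw [two_mul]
      refine le_trans ?_ le_self_add
      simp only [hW]
      rw [hc₁]
      rw [← hc₂, mul_assoc (c₂ * _)]
      gcongr
      exact le_add_self
  have hpoint : ∀ i, ∀ y ∈ G, ‖(An ξ i).indicator (K ξ) y - (An ξ' i).indicator (K ξ') y‖ₑ ≤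
      α i y + a i y := by
    intro i y hy
    by_cases h1 : y ∈ An ξ i <;> by_cases h2 : y ∈ An ξ' i
    · simp only [hα, h1, h2, indicator_of_mem]
      refine (hdiff y hy).trans ?_
      rw [two_mul]
      exact le_self_add
    · rcases lt_or_ge ‖ξ - y‖ (2 * (d * l)) with h | h
      · simp only [hα, h1, h2, indicator_of_mem, not_false_eq_true, indicator_of_notMem, sub_zero,
          add_zero]
        exact (hnearW' ξ hξ y hy h).trans le_self_add
      · have hb : y ∈ Bd i := ⟨h, Or.inl ⟨h1, h2⟩⟩
        simp only [ha, hb, h1, h2, indicator_of_mem, not_false_eq_true, indicator_of_notMem,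
          sub_zero]
        exact (hK1 ξ hξ y hy).trans le_add_self
    · rcases lt_or_ge ‖ξ - y‖ (2 * (d * l)) with h | h
      · simp only [hα, h1, h2, indicator_of_mem, not_false_eq_true, indicator_of_notMem, zero_sub,
          zero_add, enorm_neg]
        exact (hnearW' ξ' hξ' y hy h).trans le_self_add
      · have hb : y ∈ Bd i := ⟨h, Or.inr ⟨h2, h1⟩⟩
        simp only [ha, hb, h1, h2, indicator_of_mem, not_false_eq_true, indicator_of_notMem,
          zero_sub, enorm_neg]
        exact (hK1 ξ' hξ' y hy).trans le_add_self
    · simp [h1, h2]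
  have hinc : ∀ i, ‖increment K ε (G.indicator f) ξ i‖ₑ ≤
      ‖increment K ε (G.indicator f) ξ' i‖ₑ +
        ((∫⁻ y in G, α i y * u y) + ∫⁻ y in G, a i y * u y) := by
    intro i
    refine (hf.enorm_increment_le hGm hε ξ ξ' i).trans (add_le_add le_rfl ?_)
    rw [← lintegral_add_left' (hαu i)]
    refine setLIntegral_mono' hGm fun y hy => ?_
    rw [← add_mul]
    gcongr
    exact hpoint i y hy
  have hsub : G ⊆ {y | l ≤ ‖x - y‖} := fun y hy => hfar x hx y hy
  -- Annuli with the same centre are disjoint, so the `α i` add up to at most `2 * W`.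
  have hαsum : ∑' i, ∫⁻ y in G, α i y * u y ≤ A₁ * ballMaximal u x := by
    rw [← lintegral_tsum hαu]
    calc ∫⁻ y in G, ∑' i, α i y * u y
        ≤ ∫⁻ y in G, 2 * c₁ * (ENNReal.ofReal (Ω (l / ‖x - y‖)) * invPow x y * u y) := by
          refine lintegral_mono fun y => ?_
          dsimp only
          rw [ENNReal.tsum_mul_right]
          have : ∑' i, α i y ≤ 2 * W y := by
            simp only [hα]
            rw [ENNReal.tsum_add, two_mul]
            exact add_le_add (tsum_indicator_annulus_le hε.2.1 ξ y (W y))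
              (tsum_indicator_annulus_le hε.2.1 ξ' y (W y))
          refine (mul_le_mul_left this _).trans (le_of_eq ?_)
          rw [hW]
          ring
      _ = 2 * c₁ * ∫⁻ y in G, ENNReal.ofReal (Ω (l / ‖x - y‖)) * invPow x y * u y :=
          lintegral_const_mul' _ _ (by finiteness)
      _ ≤ 2 * c₁ * (2 ^ d * S₁ * ballMaximal u x) := by
          gcongr
          exact (lintegral_mono_set hsub).trans (lintegral_radial_le hK.mono u x hl)
      _ = _ := by rw [hA₁]; ring
  -- The maximum with `l` keeps `θ` positive and finite everywhere, as the weighted Hölder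
  -- inequality demands; on `G` it is just `‖x - y‖`.
  set θ : Rd d → ℝ≥0∞ := fun y => ENNReal.ofReal (l / max ‖x - y‖ l) ^ (1 / 2 : ℝ) with hθ
  have hθpos : ∀ y, 0 < l / max ‖x - y‖ l := fun y => by
    have : 0 < max ‖x - y‖ l := lt_max_of_lt_right hl
    positivity
  have hθ0 : ∀ y, θ y ≠ 0 := fun y => by
    have := hθpos y
    simp [hθ, this]
  have hθt : ∀ y, θ y ≠ ∞ := fun y => hpt _ _ (by norm_num) ENNReal.ofReal_ne_top
  have hθm : Measurable θ := by fun_prop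
  have hθG : ∀ y ∈ G, θ y = ENNReal.ofReal (l / ‖x - y‖) ^ (1 / 2 : ℝ) := fun y hy => by
    simp only [hθ]
    rw [max_eq_left (hfar x hx y hy)]
  -- On `Bd i` the point `y` is within `d * l` of one of the two bounding spheres, so `(θ y)⁻¹` is
  -- dominated by the weight that is singular on that sphere. The two spheres give `2 * B`.
  have hΛle : ∀ i, ∫⁻ y in G, a i y * (θ y)⁻¹ ≤ Λ := by
    intro i
    set c₃ : ℝ≥0∞ := c₂ * ENNReal.ofReal (m ^ d) * ENNReal.ofReal (m * m) ^ (1 / 2 : ℝ) with hc₃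
    have hc₃t : c₃ ≠ ∞ := by
      have := hpt (ENNReal.ofReal (m * m)) (1 / 2) (by norm_num) ENNReal.ofReal_ne_top
      finiteness
    set Sh : ℝ → Rd d → ℝ≥0∞ := fun e =>
      (shell ξ e).indicator fun y => invPow ξ y * shellWeight ξ e y with hSh
    have hShm : ∀ e, Measurable (Sh e) := fun e => by
      refine Measurable.indicator ((measurable_invPow ξ).mul ?_) (measurableSet_shell ξ e)
      unfold shellWeight
      fun_prop
    have key : ∀ y ∈ G, ∀ e : ℝ, 2 * (d * l) ≤ ‖ξ - y‖ → |‖ξ - y‖ - e| ≤ d * l →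
        c₂ * invPow x y * (θ y)⁻¹ ≤ c₃ * Sh e y := by
      intro y hy e h1 h2
      have hsh : y ∈ shell ξ e := by
        change |‖ξ - y‖ - e| ≤ ‖ξ - y‖ / 2
        linarith
      have hx0 := hxy y hy
      have hξ0 : 0 < ‖ξ - y‖ := hl.trans_le (hfar ξ hξ y hy)
      have h3 : (θ y)⁻¹ ≤ ENNReal.ofReal (m * m) ^ (1 / 2 : ℝ) * shellWeight ξ e y := by
        rw [hθG y hy, ← ENNReal.inv_rpow, shellWeight, ← ENNReal.mul_rpow_of_nonneg _ _ (by norm_num)]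
        refine ENNReal.rpow_le_rpow ?_ (by norm_num)
        rw [← ENNReal.ofReal_inv_of_pos (by positivity), inv_div]
        calc ENNReal.ofReal (‖x - y‖ / l)
            ≤ ENNReal.ofReal ((m * m) * ‖ξ - y‖ * (d * l)⁻¹) := by
              apply ENNReal.ofReal_le_ofReal
              rw [← div_eq_mul_inv, div_le_div_iff₀ hl (by positivity)]
              have := hcomp x hx ξ hξ y hy
              have h4 : ‖x - y‖ * d ≤ m * ‖ξ - y‖ * m := by
                gcongr
                linarith
              nlinarith
          _ = ENNReal.ofReal (m * m) * (ENNReal.ofReal ‖ξ - y‖ * (ENNReal.ofReal (d * l))⁻¹) := by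
              rw [ENNReal.ofReal_mul (by positivity), ENNReal.ofReal_mul (by positivity),
                ENNReal.ofReal_inv_of_pos (by positivity), mul_assoc]
          _ ≤ _ := by gcongr
      have h5 : invPow x y ≤ ENNReal.ofReal (m ^ d) * invPow ξ y :=
        invPow_le hξ0 (by linarith) (hcomp ξ hξ x hx y hy)
      calc c₂ * invPow x y * (θ y)⁻¹ ≤ c₂ * (ENNReal.ofReal (m ^ d) * invPow ξ y) *
            (ENNReal.ofReal (m * m) ^ (1 / 2 : ℝ) * shellWeight ξ e y) := by gcongr
        _ = c₃ * Sh e y := by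
            simp only [hSh, indicator_of_mem hsh, hc₃]
            ring
    calc ∫⁻ y in G, a i y * (θ y)⁻¹
        ≤ ∫⁻ y in G, c₃ * (Sh (ε (i + 1)) y + Sh (ε i) y) := by
          refine setLIntegral_mono' hGm fun y hy => ?_
          by_cases hb : y ∈ Bd i
          · simp only [ha, indicator_of_mem hb]
            have hor := mem_shell_of_mem_annulus (y := y) (hclose ξ hξ ξ' hξ')
              (a := ε (i + 1)) (b := ε i) (by
                rcases hb.2 with h | h
                · exact Or.inl h
                · exact Or.inr ⟨h.2, h.1⟩)
            rw [mul_add]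
            rcases hor with h | h
            · exact (key y hy _ hb.1 h).trans le_self_add
            · exact (key y hy _ hb.1 h).trans le_add_self
          · simp [ha, hb]
      _ ≤ c₃ * ∫⁻ y, (Sh (ε (i + 1)) y + Sh (ε i) y) := by
          rw [lintegral_const_mul' _ _ hc₃t]
          gcongr
          exact Measure.restrict_le_self
      _ ≤ c₃ * (B + B) := by
          rw [lintegral_add_left (hShm _), lintegral_indicator (measurableSet_shell _ _),
            lintegral_indicator (measurableSet_shell _ _)]
          gcongr
          · exact hB ξ _ (hε.1 _)
          · exact hB ξ _ (hε.1 _)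
      _ = Λ := by rw [hΛ, ← two_mul]
  have hasum : lpSeqNorm ρ (fun i => ∫⁻ y in G, a i y * u y) ≤
      A₂ * ballMaximal (fun y => u y ^ r) x ^ (1 / r) := by
    refine (lpSeqNorm_anti (by linarith) hrρ _).trans ?_
    rw [hA₂, ← ENNReal.mul_rpow_of_nonneg _ _ (by positivity)]
    refine ENNReal.rpow_le_rpow ?_ (by positivity)
    refine (tsum_lintegral_rpow_le (fun i => (ham i).aemeasurable) hum.restrict
      hθm.aemeasurable hθ0 hθt hr hΛle).trans ?_
    rw [mul_assoc]
    gcongr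
    calc ∫⁻ y in G, (∑' i, a i y) * (θ y ^ (r - 1) * u y ^ r)
        ≤ ∫⁻ y in G, 2 * c₂ * (ENNReal.ofReal ((max (l / ‖x - y‖) 0) ^ s) * invPow x y *
            u y ^ r) := by
          refine setLIntegral_mono' hGm fun y hy => ?_
          have h1 : ∑' i, a i y ≤ 2 * (c₂ * invPow x y) := by
            have : ∀ i, a i y ≤ (An ξ i).indicator (fun _ => c₂ * invPow x y) y +
                (An ξ' i).indicator (fun _ => c₂ * invPow x y) y := by
              intro i
              by_cases hb : y ∈ Bd i
              · simp only [ha, indicator_of_mem hb]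
                rcases hb.2 with h | h
                · rw [indicator_of_mem h.1]; exact le_self_add
                · rw [indicator_of_mem h.1]; exact le_add_self
              · simp [ha, hb]
            refine (ENNReal.tsum_le_tsum this).trans ?_
            rw [ENNReal.tsum_add, two_mul]
            exact add_le_add (tsum_indicator_annulus_le hε.2.1 ξ y _)
              (tsum_indicator_annulus_le hε.2.1 ξ' y _)
          have h2 : θ y ^ (r - 1) = ENNReal.ofReal ((max (l / ‖x - y‖) 0) ^ s) := by
            have := hxy y hy
            rw [hθG y hy, ← ENNReal.rpow_mul, max_eq_left (by positivity),
              ENNReal.ofReal_rpow_of_pos (by positivity), hs]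
            congr 2
            ring
          rw [h2]
          refine (mul_le_mul_left h1 _).trans (le_of_eq ?_)
          ring
      _ = 2 * c₂ * ∫⁻ y in G, ENNReal.ofReal ((max (l / ‖x - y‖) 0) ^ s) * invPow x y * u y ^ r :=
          lintegral_const_mul' _ _ (by finiteness)
      _ ≤ 2 * c₂ * (2 ^ d * S₂ * ballMaximal (fun y => u y ^ r) x) := by
          gcongr
          exact (lintegral_mono_set hsub).trans
            (lintegral_radial_le (monotone_max_rpow hs0.le) _ x hl)
      _ = _ := by ring
  calc lpSeqNorm ρ (fun i => ‖increment K ε (G.indicator f) ξ i‖ₑ)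
      ≤ lpSeqNorm ρ (fun i => ‖increment K ε (G.indicator f) ξ' i‖ₑ +
        ((∫⁻ y in G, α i y * u y) + ∫⁻ y in G, a i y * u y)) :=
        lpSeqNorm_mono (by linarith) hinc
    _ ≤ lpSeqNorm ρ (fun i => ‖increment K ε (G.indicator f) ξ' i‖ₑ) +
        ((∑' i, ∫⁻ y in G, α i y * u y) + lpSeqNorm ρ fun i => ∫⁻ y in G, a i y * u y) := by
        refine (lpSeqNorm_add_le (by linarith) _ _).trans (add_le_add le_rfl ?_)
        exact (lpSeqNorm_add_le (by linarith) _ _).trans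
          (add_le_add (lpSeqNorm_le_tsum (by linarith) _) le_rfl)
    _ ≤ _ := by
        refine add_le_add le_rfl ((add_le_add hαsum hasum).trans ?_)
        rw [add_mul, mul_add, mul_add]
        exact add_le_add le_self_add le_add_self

/-! ### The variation of a sum of atoms -/

/-- `b` is a sum of functions with mean zero and average size at most `t`, supported on the
disjoint sets `P j`, where `P j` lies in the ball of centre `z j` and radius `ℓ j`. -/
structure IsAtomicSum {d : ℕ} {ι : Type*} (P : ι → Set (Rd d)) (z : ι → Rd d) (ℓ : ι → ℝ)
    (b : Rd d → ℝ) (t : ℝ≥0∞) : Prop where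
  measurableSet : ∀ j, MeasurableSet (P j)
  disjoint : Pairwise (Function.onFun Disjoint P)
  pos : ∀ j, 0 < ℓ j
  subset : ∀ j, P j ⊆ closedBall (z j) (ℓ j)
  integrable : Integrable b volume
  integral_eq_zero : ∀ j, ∫ y in P j, b y = 0
  eq_zero : ∀ y, y ∉ ⋃ j, P j → b y = 0
  lintegral_le : ∀ j, ∫⁻ y in P j, ‖b y‖ₑ ≤ t * volume (P j)

/-- The function that controls the variation of a sum of atoms away from their supports. -/
def atomicTail {d : ℕ} {ι : Type*} (Ω : ℝ → ℝ) (P : ι → Set (Rd d)) (z : ι → Rd d) (ℓ : ι → ℝ)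
    (b : Rd d → ℝ) (x : Rd d) : ℝ≥0∞ :=
  ∑' j, ENNReal.ofReal (Ω (ℓ j / ‖x - z j‖)) * invPow x (z j) * ∫⁻ y in P j, ‖b y‖ₑ

/-- The points `x` and `ξ` are at comparable distance from all points of `G`, and `G` is either
the whole space or the complement of a neighbourhood of `x`. -/
structure IsComparable {d : ℕ} (m : ℝ) (x ξ : Rd d) (G : Set (Rd d)) : Prop where
  measurableSet : MeasurableSet G
  left_le : ∀ y ∈ G, ‖x - y‖ ≤ m * ‖ξ - y‖
  right_le : ∀ y ∈ G, ‖ξ - y‖ ≤ m * ‖x - y‖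
  eq_univ_or : G = univ ∨ ∃ l : ℝ, 0 < l ∧ (∀ y ∈ G, l ≤ ‖x - y‖) ∧ ∀ y ∉ G, ‖x - y‖ ≤ 2 * m * l

theorem isComparable_univ {d : ℕ} {m : ℝ} (hm : 1 ≤ m) (x : Rd d) :
    IsComparable m x x univ :=
  ⟨MeasurableSet.univ, fun _ _ => le_mul_of_one_le_left (norm_nonneg _) hm,
    fun _ _ => le_mul_of_one_le_left (norm_nonneg _) hm, Or.inl rfl⟩

theorem isComparable_compl_cube {d : ℕ} {c x ξ : Rd d} {l : ℝ} (hl : 0 < l) (hx : x ∈ cube c l)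
    (hξ : ξ ∈ cube c l) : IsComparable (d + 1) x ξ (cube c (3 * l))ᶜ := by
  have hcomp : ∀ z ∈ cube c l, ∀ w ∈ cube c l, ∀ y ∈ (cube c (3 * l))ᶜ,
      ‖z - y‖ ≤ (d + 1) * ‖w - y‖ := by
    intro z hz w hw y hy
    have h1 := norm_sub_le_of_mem_cube hz hw
    rw [add_self_div_two] at h1
    have h2 := le_norm_sub_of_notMem_cube hw hy
    have h3 := norm_sub_le_norm_sub_add_norm_sub z w y
    have : (d : ℝ) * l ≤ d * ‖w - y‖ := by gcongr
    linarith
  refine ⟨(measurableSet_cube _ _).compl, hcomp x hx ξ hξ, hcomp ξ hξ x hx,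
    Or.inr ⟨l, hl, fun y hy => le_norm_sub_of_notMem_cube hx hy, fun y hy => ?_⟩⟩
  have h1 := norm_sub_le_of_mem_cube hx (not_not.1 hy)
  linarith

theorem invPow_le_of_le {d : ℕ} {ξ y : Rd d} {m D : ℝ} (hD : 0 < D) (hm : 0 < m)
    (h : D ≤ m * ‖ξ - y‖) :
    invPow ξ y ≤ ENNReal.ofReal (m ^ d) * ENNReal.ofReal (D ^ d)⁻¹ := by
  rw [invPow, ← ENNReal.ofReal_mul (by positivity)]
  apply ENNReal.ofReal_le_ofReal
  have h1 : 0 < ‖ξ - y‖ := by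
    by_contra! hcon
    have : m * ‖ξ - y‖ ≤ 0 := mul_nonpos_of_nonneg_of_nonpos hm.le hcon
    linarith
  rw [← div_eq_mul_inv, ← one_div, div_le_div_iff₀ (by positivity) (by positivity), one_mul,
    ← mul_pow]
  gcongr

theorem pairwise_disjoint_annulus {d : ℕ} {ε : ℕ → ℝ} (hε : Antitone ε) (x : Rd d) :
    Pairwise (Function.onFun Disjoint fun i => annulus x (ε (i + 1)) (ε i)) := by
  have h : ∀ i j, i < j → Disjoint (annulus x (ε (i + 1)) (ε i)) (annulus x (ε (j + 1)) (ε j)) := by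
    intro i j hij
    refine Set.disjoint_left.2 fun y hi hj => ?_
    exact (hi.1.trans_le (hj.2.trans (hε (Nat.succ_le_of_lt hij)))).false
  intro i j hij
  rcases lt_or_gt_of_ne hij with h' | h'
  · exact h i j h'
  · exact (h j i h').symm

/-- A weighted Cauchy–Schwarz inequality: `tsum_lintegral_rpow_le` for `r = 2`, `g = 1` and the
counting measure on the atoms. -/
theorem tsum_tsum_sq_le {ι : Type*} {a : ℕ → ι → ℝ≥0∞} {θ : ι → ℝ≥0∞} (hθ0 : ∀ j, θ j ≠ 0)
    (hθt : ∀ j, θ j ≠ ∞) {Λ : ℝ≥0∞} (hΛ : ∀ i, ∑' j, a i j * (θ j)⁻¹ ≤ Λ) :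
    ∑' i, (∑' j, a i j) ^ (2 : ℝ) ≤ Λ * ∑' j, (∑' i, a i j) * θ j := by
  let _ : MeasurableSpace ι := ⊤
  have := tsum_lintegral_rpow_le (μ := Measure.count) (a := a) (g := fun _ => 1) (θ := θ)
    (fun i => measurable_from_top.aemeasurable) measurable_from_top.aemeasurable
    measurable_from_top.aemeasurable hθ0 hθt (r := 2) (by norm_num) (Λ := Λ)
    (fun i => by rw [lintegral_count]; exact hΛ i)
  simp only [lintegral_count, mul_one, ENNReal.one_rpow] at this
  norm_num at this
  exact_mod_cast this

namespace IsAtomicSum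

variable {d : ℕ} {ι : Type*} {P : ι → Set (Rd d)} {z : ι → Rd d} {ℓ : ι → ℝ} {b : Rd d → ℝ}
  {t : ℝ≥0∞}

/-- The increments of the truncated integrals decompose over the atoms. -/
theorem enorm_increment_le [Countable ι] (hb : IsAtomicSum P z ℓ b t) {K : Rd d → Rd d → ℝ}
    (hbK : IsTruncatable K b) {G : Set (Rd d)} (hG : MeasurableSet G) {ε : ℕ → ℝ}
    (hε : DecreasesToZero ε) (ξ : Rd d) (i : ℕ) :
    ‖increment K ε (G.indicator b) ξ i‖ₑ ≤
      ∑' j, ‖∫ y in P j, (annulus ξ (ε (i + 1)) (ε i)).indicator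
        (fun y => K ξ y * G.indicator b y) y‖ₑ := by
  have hint : Integrable ((annulus ξ (ε (i + 1)) (ε i)).indicator
      fun y => K ξ y * G.indicator b y) volume :=
    (integrable_indicator_iff (measurableSet_annulus ξ _ _)).2
      ((hbK.indicator hG).integrableOn_annulus ξ (hε.1 _) _)
  rw [increment, ← integral_indicator (measurableSet_annulus ξ _ _),
    ← setIntegral_eq_integral_of_forall_compl_eq_zero (s := ⋃ j, P j),
    integral_iUnion hb.measurableSet hb.disjoint hint.integrableOn]
  · exact enorm_tsum_le_tsum_enorm
  · intro y hy
    have h0 := hb.eq_zero y hy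
    have : G.indicator b y = 0 := by
      by_cases hyG : y ∈ G <;> simp [hyG, h0]
    by_cases hyA : y ∈ annulus ξ (ε (i + 1)) (ε i) <;> simp [hyA, this]

theorem tsum_lintegral_inter_annulus_le (hb : IsAtomicSum P z ℓ b t) {ε : ℕ → ℝ}
    (hε : Antitone ε) (ξ : Rd d) (j : ι) :
    ∑' i, ∫⁻ y in P j ∩ annulus ξ (ε (i + 1)) (ε i), ‖b y‖ₑ ≤ ∫⁻ y in P j, ‖b y‖ₑ := by
  rw [← lintegral_iUnion (fun i => (hb.measurableSet j).inter (measurableSet_annulus ξ _ _))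
    ((pairwise_disjoint_annulus hε ξ).mono fun _ _ h =>
      h.mono inter_subset_right inter_subset_right)]
  exact lintegral_mono_set (iUnion_subset fun i => inter_subset_left)

/-- The contribution of one atom to one increment, for a general position of the atom. -/
theorem enorm_setIntegral_le (hb : IsAtomicSum P z ℓ b t) {K : Rd d → Rd d → ℝ} {G : Set (Rd d)}
    {ξ : Rd d} {α β : ℝ} {j : ι} {c : ℝ≥0∞} (hc : ∀ y ∈ P j, ‖K ξ y‖ₑ ≤ c) :
    ‖∫ y in P j, (annulus ξ α β).indicator (fun y => K ξ y * G.indicator b y) y‖ₑ ≤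
      c * ∫⁻ y in P j ∩ annulus ξ α β, ‖b y‖ₑ := by
  refine (enorm_integral_le_lintegral_enorm _).trans ?_
  calc ∫⁻ y in P j, ‖(annulus ξ α β).indicator (fun y => K ξ y * G.indicator b y) y‖ₑ
      ≤ ∫⁻ y in P j, (annulus ξ α β).indicator (fun y => c * ‖b y‖ₑ) y := by
        refine setLIntegral_mono' (hb.measurableSet j) fun y hy => ?_
        by_cases hA : y ∈ annulus ξ α β
        · rw [indicator_of_mem hA, indicator_of_mem hA, enorm_mul]
          gcongr
          · exact hc y hy
          · by_cases hyG : y ∈ G <;> simp [hyG]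
        · simp [hA]
    _ = ∫⁻ y in P j ∩ annulus ξ α β, c * ‖b y‖ₑ := by
        rw [setLIntegral_indicator (measurableSet_annulus ξ α β), inter_comm]
    _ = _ := by
        rw [lintegral_const_mul'' _ hb.integrable.1.enorm.restrict]

/-- The contribution of one atom to one increment, if the annulus contains the atom. -/
theorem enorm_setIntegral_le_of_subset (hb : IsAtomicSum P z ℓ b t) {K : Rd d → Rd d → ℝ}
    (hbK : IsTruncatable K b) {G : Set (Rd d)} {ξ : Rd d} {α β : ℝ} (hα : 0 < α) {j : ι}
    {c : ℝ≥0∞} (hc : ∀ y ∈ P j, ‖K ξ y - K ξ (z j)‖ₑ ≤ c) (hG : P j ⊆ G)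
    (hA : P j ⊆ annulus ξ α β) :
    ‖∫ y in P j, (annulus ξ α β).indicator (fun y => K ξ y * G.indicator b y) y‖ₑ ≤
      c * ∫⁻ y in P j ∩ annulus ξ α β, ‖b y‖ₑ := by
  -- As the atom lies in both `G` and the annulus, neither cut-off acts on it, and its mean zero
  -- allows `K ξ (z j)` to be subtracted.
  have h1 : ∫ y in P j, (annulus ξ α β).indicator (fun y => K ξ y * G.indicator b y) y =
      ∫ y in P j, (K ξ y - K ξ (z j)) * b y := by
    have e : ∫ y in P j, (annulus ξ α β).indicator (fun y => K ξ y * G.indicator b y) y =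
        ∫ y in P j, K ξ y * b y := by
      refine setIntegral_congr_fun (hb.measurableSet j) fun y hy => ?_
      simp only [indicator_of_mem (hA hy), indicator_of_mem (hG hy)]
    have hi : IntegrableOn (fun y => K ξ y * b y) (P j) :=
      (hbK.integrableOn_annulus ξ hα β).mono_set hA
    have hi' : IntegrableOn (fun y => K ξ (z j) * b y) (P j) :=
      (hb.integrable.const_mul _).integrableOn
    simp_rw [e, sub_mul]
    rw [integral_sub hi hi', integral_const_mul, hb.integral_eq_zero, mul_zero, sub_zero]
  rw [h1, inter_eq_left.2 hA]
  refine (enorm_integral_le_lintegral_enorm _).trans ?_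
  rw [← lintegral_const_mul'' _ hb.integrable.1.enorm.restrict]
  refine setLIntegral_mono' (hb.measurableSet j) fun y hy => ?_
  rw [enorm_mul]
  gcongr
  exact hc y hy

end IsAtomicSum

/-- The distances between the points involved, for an atom that meets `G` and is far from `x`
relative to its size. -/
theorem IsComparable.norm_sub_bounds {d : ℕ} {m : ℝ} {x ξ z : Rd d} {G : Set (Rd d)} {ℓ : ℝ}
    (hm : 1 ≤ m) (h : IsComparable m x ξ G) (hx : 8 * m * ℓ ≤ ‖x - z‖) (hℓ : 0 < ℓ)
    {y₀ : Rd d} (hy₀ : y₀ ∈ closedBall z ℓ) (hyG : y₀ ∈ G) {y : Rd d} (hy : y ∈ closedBall z ℓ) :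
    ‖x - z‖ ≤ 2 * m * ‖ξ - y‖ ∧ ‖ξ - y‖ ≤ 2 * m * ‖x - z‖ ∧ 4 * ℓ ≤ ‖ξ - y‖ ∧
      ‖x - y₀‖ ≤ 2 * ‖x - z‖ := by
  have h1 := h.left_le y₀ hyG
  have h2 := h.right_le y₀ hyG
  rw [mem_closedBall, dist_eq_norm] at hy₀ hy
  have e1 : ‖x - z‖ ≤ ‖x - y₀‖ + ℓ := by
    have := norm_sub_le_norm_sub_add_norm_sub x y₀ z
    linarith
  have e2 : ‖x - y₀‖ ≤ ‖x - z‖ + ℓ := by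
    have := norm_sub_le_norm_sub_add_norm_sub x z y₀
    rw [norm_sub_rev z y₀] at this
    linarith
  have e3 : ‖y - y₀‖ ≤ 2 * ℓ := by
    have := norm_sub_le_norm_sub_add_norm_sub y z y₀
    rw [norm_sub_rev z y₀] at this
    linarith
  have e4 : ‖ξ - y₀‖ ≤ ‖ξ - y‖ + 2 * ℓ := by
    have := norm_sub_le_norm_sub_add_norm_sub ξ y y₀
    linarith
  have e5 : ‖ξ - y‖ ≤ ‖ξ - y₀‖ + 2 * ℓ := by
    have := norm_sub_le_norm_sub_add_norm_sub ξ y₀ y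
    rw [norm_sub_rev y₀ y] at this
    linarith
  have e6 : m * ‖ξ - y₀‖ ≤ m * (‖ξ - y‖ + 2 * ℓ) := by gcongr
  have e7 : m * ‖x - y₀‖ ≤ m * (‖x - z‖ + ℓ) := by gcongr
  have e8 : ℓ ≤ m * ℓ := le_mul_of_one_le_left hℓ.le hm
  have e9 : ‖x - z‖ ≤ m * ‖x - z‖ := le_mul_of_one_le_left (norm_nonneg _) hm
  -- The detours through the atom cost at most `3 * m * ℓ`, that is, at most three eighths of `‖x -
  -- z‖`, which the left side absorbs.
  have k1 : ‖x - z‖ ≤ 2 * m * ‖ξ - y‖ := by nlinarith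
  refine ⟨k1, by nlinarith, ?_, by nlinarith⟩
  have : m * (4 * ℓ) ≤ m * ‖ξ - y‖ := by nlinarith
  exact le_of_mul_le_mul_left this (by linarith)

/-- The atoms that straddle the boundary of `G` contribute at most the height of the atoms. -/
theorem IsAtomicSum.tsum_straddling_le {d : ℕ} {ι : Type*} [Countable ι] {P : ι → Set (Rd d)}
    {z : ι → Rd d} {ℓ : ι → ℝ} {b : Rd d → ℝ} {t : ℝ≥0∞} (hb : IsAtomicSum P z ℓ b t) {m : ℝ}
    (hm : 1 ≤ m) {x ξ : Rd d} {G : Set (Rd d)} (h : IsComparable m x ξ G)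
    (hx : ∀ j, 8 * m * ℓ j ≤ ‖x - z j‖) {J : Set ι}
    (hJ : ∀ j ∈ J, (P j ∩ G).Nonempty ∧ ¬ P j ⊆ G) :
    ∑' j, J.indicator (fun j => invPow x (z j) * ∫⁻ y in P j, ‖b y‖ₑ) j ≤
      ENNReal.ofReal (2 ^ d) * ENNReal.ofReal ((5 * m) ^ d) * unitBallVolume d * t := by
  rcases h.eq_univ_or with hG | ⟨l, hl, hl1, hl2⟩
  · have : J = ∅ := by
      refine eq_empty_of_forall_notMem fun j hj => (hJ j hj).2 ?_
      rw [hG]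
      exact subset_univ _
    simp [this]
  -- A point of the atom in `G` forces `‖x - z j‖ ≥ l / 2`; a point outside `G` forces `‖x - z j‖ ≤
  -- 4 * m * l`. So the atoms in question lie in a ball of radius `5 * m * l`, where the kernel is
  -- at most a multiple of `l^{-d}`.
  have key : ∀ j ∈ J, invPow x (z j) ≤ ENNReal.ofReal (2 ^ d) * ENNReal.ofReal (l ^ d)⁻¹ ∧
      P j ⊆ closedBall x (5 * m * l) := by
    intro j hj
    obtain ⟨⟨y₀, hy₀, hy₀G⟩, hsub⟩ := hJ j hj
    obtain ⟨y₁, hy₁, hy₁G⟩ := not_subset.1 hsub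
    have h0 := (h.norm_sub_bounds hm (hx j) (hb.pos j) (hb.subset j hy₀) hy₀G
      (hb.subset j hy₀)).2.2.2
    have h1 := hl1 y₀ hy₀G
    have h2 := hl2 y₁ hy₁G
    have h3 := mem_closedBall.1 (hb.subset j hy₁)
    rw [dist_eq_norm] at h3
    have h4 := norm_sub_le_norm_sub_add_norm_sub x y₁ (z j)
    have h5 : ℓ j ≤ m * ℓ j := le_mul_of_one_le_left (hb.pos j).le hm
    have h6 := hx j
    have h7 : ‖x - z j‖ ≤ 4 * m * l := by nlinarith
    refine ⟨invPow_le_of_le hl two_pos (by linarith), fun y hy => ?_⟩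
    have h8 := mem_closedBall.1 (hb.subset j hy)
    rw [mem_closedBall']
    rw [dist_comm, dist_eq_norm] at h8
    rw [dist_eq_norm]
    have h9 := norm_sub_le_norm_sub_add_norm_sub x (z j) y
    nlinarith
  set c : ℝ≥0∞ := ENNReal.ofReal (2 ^ d) * ENNReal.ofReal (l ^ d)⁻¹ with hc
  calc ∑' j, J.indicator (fun j => invPow x (z j) * ∫⁻ y in P j, ‖b y‖ₑ) j
      ≤ ∑' j, c * t * volume (P j ∩ closedBall x (5 * m * l)) := by
        refine ENNReal.tsum_le_tsum fun j => ?_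
        by_cases hj : j ∈ J
        · rw [indicator_of_mem hj, inter_eq_left.2 (key j hj).2, mul_assoc]
          exact mul_le_mul' (key j hj).1 (hb.lintegral_le j)
        · rw [indicator_of_notMem hj]
          exact zero_le
    _ = c * t * volume (⋃ j, P j ∩ closedBall x (5 * m * l)) := by
        rw [ENNReal.tsum_mul_left, measure_iUnion
          (fun i j hij => (hb.disjoint hij).mono inter_subset_left inter_subset_left)
          fun j => (hb.measurableSet j).inter measurableSet_closedBall]
    _ ≤ c * t * volume (closedBall x (5 * m * l)) := by
        gcongr
        exact iUnion_subset fun j => inter_subset_right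
    _ = _ := by
        rw [volume_closedBall_eq _ (by positivity), mul_pow (5 * m),
          ENNReal.ofReal_mul (by positivity)]
        have : ENNReal.ofReal (l ^ d)⁻¹ * ENNReal.ofReal (l ^ d) = 1 := by
          rw [← ENNReal.ofReal_mul (by positivity), inv_mul_cancel₀ (by positivity),
            ENNReal.ofReal_one]
        calc _ = ENNReal.ofReal (2 ^ d) * (ENNReal.ofReal (l ^ d)⁻¹ * ENNReal.ofReal (l ^ d)) * t *
              ENNReal.ofReal ((5 * m) ^ d) * unitBallVolume d := by rw [hc]; ring
          _ = _ := by rw [this]; ring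

/-- The atoms that straddle the boundary of an annulus, with weights. -/
theorem IsAtomicSum.tsum_boundary_le {d : ℕ} {ι : Type*} [Countable ι] {P : ι → Set (Rd d)}
    {z : ι → Rd d} {ℓ : ι → ℝ} {b : Rd d → ℝ} {t : ℝ≥0∞} (hb : IsAtomicSum P z ℓ b t) {m : ℝ}
    (hm : 1 ≤ m) {x ξ : Rd d} {G : Set (Rd d)} (h : IsComparable m x ξ G)
    (hx : ∀ j, 8 * m * ℓ j ≤ ‖x - z j‖) {α β : ℝ} (hα : 0 < α) (hβ : 0 < β) {B : ℝ≥0∞}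
    (hB : ∀ e : ℝ, 0 < e →
      ∫⁻ y in shell ξ e, ENNReal.ofReal (‖ξ - y‖ ^ d)⁻¹ * shellWeight ξ e y ≤ B) {J : Set ι}
    (hJ : ∀ j ∈ J, (P j ∩ G).Nonempty ∧ (P j ∩ annulus ξ α β).Nonempty ∧
      ¬ P j ⊆ annulus ξ α β) :
    ∑' j, J.indicator (fun j => invPow x (z j) * (∫⁻ y in P j, ‖b y‖ₑ) *
      (ENNReal.ofReal (ℓ j / ‖x - z j‖) ^ (1 / 2 : ℝ))⁻¹) j ≤
      ENNReal.ofReal ((2 * m) ^ d) * ENNReal.ofReal (4 * m) ^ (1 / 2 : ℝ) * (2 * B) * t := by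
  set c : ℝ≥0∞ := ENNReal.ofReal ((2 * m) ^ d) * ENNReal.ofReal (4 * m) ^ (1 / 2 : ℝ) with hc
  have hct : c ≠ ∞ := by
    have : ENNReal.ofReal (4 * m) ^ (1 / 2 : ℝ) ≠ ∞ :=
      ENNReal.rpow_ne_top_of_nonneg (by norm_num) ENNReal.ofReal_ne_top
    finiteness
  set Sh : ℝ → Rd d → ℝ≥0∞ := fun e =>
    (shell ξ e).indicator fun y => ENNReal.ofReal (‖ξ - y‖ ^ d)⁻¹ * shellWeight ξ e y with hSh
  have hShm : ∀ e, Measurable (Sh e) := fun e => by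
    refine Measurable.indicator (Measurable.mul (by fun_prop) ?_) (measurableSet_shell ξ e)
    unfold shellWeight
    fun_prop
  have hShB : ∀ e, 0 < e → ∫⁻ y, Sh e y ≤ B := fun e he => by
    rw [lintegral_indicator (measurableSet_shell _ _)]
    exact hB e he
  -- An atom that meets the annulus without being contained in it lies within its diameter `2 * ℓ j`
  -- of a bounding sphere, so the inverse root of `ℓ j / ‖x - z j‖` is controlled by a shell weight
  -- at each of its points.
  have key : ∀ j ∈ J, ∀ y ∈ P j, invPow x (z j) * (ENNReal.ofReal (ℓ j / ‖x - z j‖) ^ (1 / 2 : ℝ))⁻¹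
      ≤ c * (Sh α y + Sh β y) := by
    intro j hj y hy
    obtain ⟨⟨y₀, hy₀, hy₀G⟩, ⟨y₁, hy₁, hy₁A⟩, hsub⟩ := hJ j hj
    obtain ⟨y₂, hy₂, hy₂A⟩ := not_subset.1 hsub
    have hℓ := hb.pos j
    have hbd : ∀ w ∈ P j, _ := fun w hw => h.norm_sub_bounds hm (hx j) hℓ (hb.subset j hy₀) hy₀G
      (hb.subset j hw)
    have hD : 0 < ‖x - z j‖ := lt_of_lt_of_le (by positivity) (hx j)
    have hdist : ∀ w ∈ P j, |‖ξ - y‖ - ‖ξ - w‖| ≤ 2 * ℓ j := fun w hw => by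
      refine (abs_norm_sub_norm_le _ _).trans ?_
      have h1 := mem_closedBall.1 (hb.subset j hy)
      have h2 := mem_closedBall.1 (hb.subset j hw)
      rw [sub_sub_sub_cancel_left, norm_sub_rev, ← dist_eq_norm]
      linarith [dist_triangle_right y w (z j)]
    have hor : |‖ξ - y‖ - α| ≤ 2 * ℓ j ∨ |‖ξ - y‖ - β| ≤ 2 * ℓ j := by
      have d1 := hdist y₁ hy₁
      have d2 := hdist y₂ hy₂
      simp only [annulus, mem_ofPred_eq, not_and_or, not_lt, not_le] at hy₁A hy₂A
      rw [abs_le] at d1 d2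
      simp only [abs_le]
      rcases hy₂A with h3 | h3
      · left; constructor <;> linarith [hy₁A.1]
      · right; constructor <;> linarith [hy₁A.2]
    have hmain : ∀ e, |‖ξ - y‖ - e| ≤ 2 * ℓ j →
        invPow x (z j) * (ENNReal.ofReal (ℓ j / ‖x - z j‖) ^ (1 / 2 : ℝ))⁻¹ ≤ c * Sh e y := by
      intro e he
      obtain ⟨k1, k2, k3, -⟩ := hbd y hy
      have hξ0 : 0 < ‖ξ - y‖ := lt_of_lt_of_le (by positivity) k3
      have hsh : y ∈ shell ξ e := by
        change |‖ξ - y‖ - e| ≤ ‖ξ - y‖ / 2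
        linarith
      simp only [hSh, indicator_of_mem hsh]
      rw [hc, mul_mul_mul_comm]
      refine mul_le_mul' (invPow_le_of_le hξ0 (by positivity) k2) ?_
      rw [← ENNReal.inv_rpow, shellWeight, ← ENNReal.mul_rpow_of_nonneg _ _ (by norm_num)]
      refine ENNReal.rpow_le_rpow ?_ (by norm_num)
      rw [← ENNReal.ofReal_inv_of_pos (by positivity), inv_div]
      calc ENNReal.ofReal (‖x - z j‖ / ℓ j)
          ≤ ENNReal.ofReal ((4 * m) * (‖ξ - y‖ * (2 * ℓ j)⁻¹)) := by
            apply ENNReal.ofReal_le_ofReal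
            rw [div_le_iff₀ hℓ]
            have : 4 * m * (‖ξ - y‖ * (2 * ℓ j)⁻¹) * ℓ j = 2 * m * ‖ξ - y‖ := by
              field_simp
              ring
            rw [this]
            exact k1
        _ = ENNReal.ofReal (4 * m) * (ENNReal.ofReal ‖ξ - y‖ * (ENNReal.ofReal (2 * ℓ j))⁻¹) := by
            rw [ENNReal.ofReal_mul (p := 4 * m) (by positivity),
              ENNReal.ofReal_mul (p := ‖ξ - y‖) (by positivity),
              ENNReal.ofReal_inv_of_pos (by positivity)]
        _ ≤ _ := by gcongr
    rw [mul_add]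
    rcases hor with h3 | h3
    · exact (hmain _ h3).trans le_self_add
    · exact (hmain _ h3).trans le_add_self
  -- The mass of the atom is traded for `t * volume (P j)`, and the constant weight for the integral
  -- of the shell weight over `P j`; disjointness of the `P j` then sums the integrals.
  calc _ ≤ ∑' j, t * ∫⁻ y in P j, c * (Sh α y + Sh β y) := by
        refine ENNReal.tsum_le_tsum fun j => ?_
        by_cases hj : j ∈ J
        · rw [indicator_of_mem hj]
          calc _ = (∫⁻ y in P j, ‖b y‖ₑ) * (invPow x (z j) *
                (ENNReal.ofReal (ℓ j / ‖x - z j‖) ^ (1 / 2 : ℝ))⁻¹) := by ring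
            _ ≤ t * volume (P j) * (invPow x (z j) *
                (ENNReal.ofReal (ℓ j / ‖x - z j‖) ^ (1 / 2 : ℝ))⁻¹) := by
                gcongr
                exact hb.lintegral_le j
            _ = t * ∫⁻ _ in P j, (invPow x (z j) *
                (ENNReal.ofReal (ℓ j / ‖x - z j‖) ^ (1 / 2 : ℝ))⁻¹) := by
                rw [setLIntegral_const]; ring
            _ ≤ _ := by
                gcongr t * ?_
                exact setLIntegral_mono' (hb.measurableSet j) (key j hj)
        · rw [indicator_of_notMem hj]
          exact zero_le
    _ = t * ∫⁻ y in ⋃ j, P j, c * (Sh α y + Sh β y) := by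
        rw [ENNReal.tsum_mul_left, lintegral_iUnion hb.measurableSet hb.disjoint]
    _ ≤ t * ∫⁻ y, c * (Sh α y + Sh β y) := by
        gcongr
        exact Measure.restrict_le_self
    _ ≤ t * (c * (B + B)) := by
        rw [lintegral_const_mul' _ _ hct, lintegral_add_left (hShm _)]
        gcongr
        · exact hShB α hα
        · exact hShB β hβ
    _ = _ := by ring

/-- Away from the supports of the atoms, the variation of a sum of atoms is controlled by the
height of the atoms and by their tails. -/
theorem exists_variation_atomicSum_le {d : ℕ} (hd : 0 < d) {K : Rd d → Rd d → ℝ} {C : ℝ}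
    {Ω : ℝ → ℝ} (hK : IsRegularKernel K C Ω) {ρ : ℝ} (hρ : 2 ≤ ρ) {m : ℝ} (hm : 1 ≤ m) :
    ∃ A : ℝ≥0, ∀ (ι : Type) [Countable ι] (P : ι → Set (Rd d)) (z : ι → Rd d) (ℓ : ι → ℝ)
      (b : Rd d → ℝ) (t : ℝ≥0∞), IsAtomicSum P z ℓ b t → IsTruncatable K b →
      ∀ (x ξ : Rd d) (G : Set (Rd d)), IsComparable m x ξ G →
      (∀ j, 8 * m * ℓ j ≤ ‖x - z j‖) →
      variation K ρ (G.indicator b) ξ ≤ A * (t + atomicTail Ω P z ℓ b x) := by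
  obtain ⟨B, hB⟩ := exists_lintegral_shell_le hd
  obtain ⟨n, hn⟩ := pow_unbounded_of_one_lt (2 * m) (one_lt_two)
  set c₂ : ℝ≥0∞ := ENNReal.ofReal C * ENNReal.ofReal ((2 * m) ^ d) with hc₂
  set c₃ : ℝ≥0∞ := c₂ * ENNReal.ofReal (2 ^ n) with hc₃
  set c₄ : ℝ≥0∞ := c₂ *
    (ENNReal.ofReal (2 ^ d) * ENNReal.ofReal ((5 * m) ^ d) * unitBallVolume d) with hc₄
  set c₅ : ℝ≥0∞ := c₂ *
    (ENNReal.ofReal ((2 * m) ^ d) * ENNReal.ofReal (4 * m) ^ (1 / 2 : ℝ) * (2 * B)) with hc₅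
  set A : ℝ≥0∞ := c₃ + c₄ + (c₅ * c₂) ^ (1 / 2 : ℝ) with hA
  have hc₂t : c₂ ≠ ∞ := by finiteness
  have hpt : ∀ a : ℝ≥0∞, a ≠ ∞ → a ^ (1 / 2 : ℝ) ≠ ∞ := fun a ha =>
    ENNReal.rpow_ne_top_of_nonneg (by norm_num) ha
  have hAt : A ≠ ∞ := by
    have h1 := hpt (ENNReal.ofReal (4 * m)) ENNReal.ofReal_ne_top
    have h2 := unitBallVolume_ne_top d
    have h3 := hpt (c₅ * c₂) (by finiteness)
    finiteness
  refine ⟨A.toNNReal, ?_⟩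
  rw [ENNReal.coe_toNNReal hAt]
  intro ι _ P z ℓ b t hb hbK x ξ G h hx
  set H := atomicTail Ω P z ℓ b x with hH
  rw [(hbK.indicator h.measurableSet).variation_eq]
  refine iSup₂_le fun ε hε => ?_
  have hℓ := hb.pos
  have hD : ∀ j, 0 < ‖x - z j‖ := fun j => by
    have := hℓ j
    exact lt_of_lt_of_le (by positivity) (hx j)
  set An : ℕ → Set (Rd d) := fun i => annulus ξ (ε (i + 1)) (ε i) with hAn
  set w : ι → ℝ≥0∞ := fun j => invPow x (z j) with hw
  set Φ : ι → ℝ≥0∞ := fun j => ENNReal.ofReal (Ω (ℓ j / ‖x - z j‖)) with hΦ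
  set β : ι → ℝ≥0∞ := fun j => ∫⁻ y in P j, ‖b y‖ₑ with hβ
  set β' : ℕ → ι → ℝ≥0∞ := fun i j => ∫⁻ y in P j ∩ An i, ‖b y‖ₑ with hβ'
  have hβsum : ∀ j, ∑' i, β' i j ≤ β j := fun j =>
    hb.tsum_lintegral_inter_annulus_le hε.2.1 ξ j
  have hβle : ∀ i j, β' i j ≤ β j := fun i j => lintegral_mono_set inter_subset_left
  have hkin : ∀ j, (P j ∩ G).Nonempty → ∀ y ∈ closedBall (z j) (ℓ j), ‖K ξ y‖ₑ ≤ c₂ * w j := by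
    rintro j ⟨y₀, hy₀, hy₀G⟩ y hy
    obtain ⟨k1, -, k3, -⟩ := h.norm_sub_bounds hm (hx j) (hℓ j) (hb.subset j hy₀) hy₀G hy
    have hne : ξ ≠ y := by
      rintro rfl
      have := hℓ j
      rw [sub_self, norm_zero] at k3
      linarith
    refine (hK.enorm_le hne).trans ?_
    rw [hc₂, mul_assoc]
    gcongr
    exact invPow_le_of_le (hD j) (by positivity) k1
  have hkdiff : ∀ j, (P j ∩ G).Nonempty → ∀ y ∈ closedBall (z j) (ℓ j),
      ‖K ξ y - K ξ (z j)‖ₑ ≤ c₃ * Φ j * w j := by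
    rintro j ⟨y₀, hy₀, hy₀G⟩ y hy
    obtain ⟨k1, -, k3, -⟩ := h.norm_sub_bounds hm (hx j) (hℓ j) (hb.subset j hy₀) hy₀G
      (mem_closedBall_self (hℓ j).le)
    have hℓj := hℓ j
    have hDj := hD j
    have hξ0 : 0 < ‖ξ - z j‖ := by linarith
    have hne : z j ≠ ξ := by
      intro hcon
      rw [hcon, sub_self, norm_zero] at hξ0
      exact hξ0.false
    have hy' : ‖z j - y‖ ≤ ℓ j := by
      rw [← dist_eq_norm]
      exact mem_closedBall'.1 hy
    have h1 := hK.smooth_right (z j) y ξ hne (by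
      rw [norm_sub_rev (z j) ξ]
      linarith)
    rw [norm_sub_rev (z j) ξ] at h1
    have h2 : Ω (‖z j - y‖ / ‖ξ - z j‖) ≤ 2 ^ n * Ω (ℓ j / ‖x - z j‖) := by
      refine hK.modulus_le (by positivity) ?_
      calc ‖z j - y‖ / ‖ξ - z j‖ ≤ ℓ j / (‖x - z j‖ / (2 * m)) := by
            gcongr
            rw [div_le_iff₀ (by positivity)]
            linarith
        _ = 2 * m * (ℓ j / ‖x - z j‖) := by field_simp
        _ ≤ _ := by gcongr
    have hΩ0 := hK.modulus_nonneg (ℓ j / ‖x - z j‖)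
    calc ‖K ξ y - K ξ (z j)‖ₑ
        ≤ ENNReal.ofReal (C * (2 ^ n * Ω (ℓ j / ‖x - z j‖)) * (‖ξ - z j‖ ^ d)⁻¹) := by
          rw [Real.enorm_eq_ofReal_abs, abs_sub_comm]
          apply ENNReal.ofReal_le_ofReal
          refine h1.trans ?_
          have := hK.nonneg
          gcongr
      _ = ENNReal.ofReal C * (ENNReal.ofReal (2 ^ n) * Φ j) * invPow ξ (z j) := by
          rw [invPow, hΦ, ← ENNReal.ofReal_mul (by positivity), ← ENNReal.ofReal_mul hK.nonneg,
            ← ENNReal.ofReal_mul (mul_nonneg hK.nonneg (by positivity))]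
      _ ≤ ENNReal.ofReal C * (ENNReal.ofReal (2 ^ n) * Φ j) *
            (ENNReal.ofReal ((2 * m) ^ d) * w j) := by
          gcongr
          exact invPow_le_of_le (hD j) (by positivity) k1
      _ = _ := by rw [hc₃, hc₂]; ring
  -- The contribution of atom `j` to increment `i` is bounded by one of three terms: `p` uses
  -- cancellation if the atom lies in `G` and in the annulus, `q` covers atoms that cross the
  -- boundary of `G`, and `s` those that cross the boundary of the annulus.
  set Jb : Set ι := {j | (P j ∩ G).Nonempty ∧ ¬ P j ⊆ G} with hJb
  set Jc : ℕ → Set ι := fun i => {j | (P j ∩ G).Nonempty ∧ (P j ∩ An i).Nonempty ∧ ¬ P j ⊆ An i}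
    with hJc
  set p : ℕ → ι → ℝ≥0∞ := fun i j => c₃ * Φ j * w j * β' i j with hp
  set q : ℕ → ι → ℝ≥0∞ := fun i j => Jb.indicator (fun j => c₂ * w j * β' i j) j with hq
  set s : ℕ → ι → ℝ≥0∞ := fun i => (Jc i).indicator fun j => c₂ * w j * β' i j with hs
  have hterm : ∀ i j, ‖∫ y in P j, (An i).indicator (fun y => K ξ y * G.indicator b y) y‖ₑ ≤
      p i j + q i j + s i j := by
    intro i j
    by_cases hne : (P j ∩ G).Nonempty
    · have hgen := hb.enorm_setIntegral_le (G := G) (α := ε (i + 1)) (β := ε i) (j := j)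
        fun y hy => hkin j hne y (hb.subset j hy)
      by_cases hsub : P j ⊆ G
      · by_cases hsubA : P j ⊆ An i
        · refine le_trans ?_ (le_add_right le_self_add)
          exact hb.enorm_setIntegral_le_of_subset hbK (hε.1 _)
            (fun y hy => hkdiff j hne y (hb.subset j hy)) hsub hsubA
        · by_cases hneA : (P j ∩ An i).Nonempty
          · have hj : j ∈ Jc i := ⟨hne, hneA, hsubA⟩
            refine le_trans ?_ le_add_self
            simp only [hs, indicator_of_mem hj]
            exact hgen
          · refine hgen.trans ?_
            have : P j ∩ annulus ξ (ε (i + 1)) (ε i) = ∅ := not_nonempty_iff_eq_empty.1 hneA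
            rw [this]
            simp
      · have hj : j ∈ Jb := ⟨hne, hsub⟩
        refine le_trans ?_ (le_add_right le_add_self)
        simp only [hq, indicator_of_mem hj]
        exact hgen
    · have : ∫ y in P j, (An i).indicator (fun y => K ξ y * G.indicator b y) y = 0 := by
        refine setIntegral_eq_zero_of_forall_eq_zero fun y hy => ?_
        have hyG : y ∉ G := fun hyG => hne ⟨y, hy, hyG⟩
        by_cases hA : y ∈ An i <;> simp [hA, hyG]
      rw [this, enorm_zero]
      exact zero_le
  have hinc : ∀ i, ‖increment K ε (G.indicator b) ξ i‖ₑ ≤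
      (∑' j, p i j) + ((∑' j, q i j) + ∑' j, s i j) := by
    intro i
    refine (hb.enorm_increment_le hbK h.measurableSet hε ξ i).trans ?_
    refine (ENNReal.tsum_le_tsum (hterm i)).trans (le_of_eq ?_)
    rw [ENNReal.tsum_add, ENNReal.tsum_add, add_assoc]
  have hpsum : ∑' i, ∑' j, p i j ≤ c₃ * H := by
    rw [ENNReal.tsum_comm, hH, atomicTail, ← ENNReal.tsum_mul_left]
    refine ENNReal.tsum_le_tsum fun j => ?_
    simp only [hp]
    rw [ENNReal.tsum_mul_left, mul_assoc c₃, mul_assoc c₃]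
    gcongr
    exact hβsum j
  have hqsum : ∑' i, ∑' j, q i j ≤ c₄ * t := by
    calc ∑' i, ∑' j, q i j ≤ ∑' j, c₂ * Jb.indicator (fun j => w j * β j) j := by
          rw [ENNReal.tsum_comm]
          refine ENNReal.tsum_le_tsum fun j => ?_
          by_cases hj : j ∈ Jb
          · simp only [hq, indicator_of_mem hj]
            rw [ENNReal.tsum_mul_left, mul_assoc]
            gcongr
            exact hβsum j
          · simp [hq, hj]
      _ ≤ _ := by
          rw [ENNReal.tsum_mul_left, hc₄, mul_assoc c₂]
          gcongr
          exact hb.tsum_straddling_le hm h hx fun j hj => hj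
  set θ : ι → ℝ≥0∞ := fun j => ENNReal.ofReal (ℓ j / ‖x - z j‖) ^ (1 / 2 : ℝ) with hθ
  have hθ0 : ∀ j, θ j ≠ 0 := fun j => by
    have : 0 < ℓ j / ‖x - z j‖ := div_pos (hℓ j) (hD j)
    simp [hθ, this]
  have hθt : ∀ j, θ j ≠ ∞ := fun j => hpt _ ENNReal.ofReal_ne_top
  -- Because `√t ≤ Ω t`, the weight of the Cauchy–Schwarz inequality is dominated by the modulus, so
  -- the weighted sum is again a part of the tail `H`.
  have hθΦ : ∀ j, θ j ≤ Φ j := fun j => by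
    have : 0 < ℓ j / ‖x - z j‖ := div_pos (hℓ j) (hD j)
    simp only [hθ, hΦ]
    rw [ENNReal.ofReal_rpow_of_pos this, ← Real.sqrt_eq_rpow]
    exact ENNReal.ofReal_le_ofReal (hK.sqrt_le _)
  have hsΛ : ∀ i, ∑' j, s i j * (θ j)⁻¹ ≤ c₅ * t := by
    intro i
    calc ∑' j, s i j * (θ j)⁻¹
        ≤ ∑' j, c₂ * (Jc i).indicator (fun j => w j * β j * (θ j)⁻¹) j := by
          refine ENNReal.tsum_le_tsum fun j => ?_
          by_cases hj : j ∈ Jc i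
          · simp only [hs, indicator_of_mem hj]
            rw [mul_assoc c₂, mul_assoc c₂]
            gcongr
            exact hβle i j
          · simp [hs, hj]
      _ ≤ _ := by
          rw [ENNReal.tsum_mul_left, hc₅, mul_assoc c₂]
          gcongr
          exact hb.tsum_boundary_le hm h hx (hε.1 _) (hε.1 _) (fun e he => hB ξ e he)
            fun j hj => hj
  -- The squared `ℓ²` norm is at most a multiple of `t * H`, hence of `(t + H)²`.
  have hssum : lpSeqNorm ρ (fun i => ∑' j, s i j) ≤ (c₅ * c₂) ^ (1 / 2 : ℝ) * (t + H) := by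
    refine (lpSeqNorm_anti two_pos hρ _).trans ?_
    have h1 : ∑' i, (∑' j, s i j) ^ (2 : ℝ) ≤ c₅ * c₂ * (t + H) ^ (2 : ℝ) := by
      refine (tsum_tsum_sq_le hθ0 hθt hsΛ).trans ?_
      have h2 : ∑' j, (∑' i, s i j) * θ j ≤ c₂ * H := by
        rw [hH, atomicTail, ← ENNReal.tsum_mul_left]
        refine ENNReal.tsum_le_tsum fun j => ?_
        have h3 : ∑' i, s i j ≤ c₂ * w j * β j := by
          calc ∑' i, s i j ≤ ∑' i, c₂ * w j * β' i j :=
                ENNReal.tsum_le_tsum fun i => indicator_le_self _ _ _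
            _ ≤ _ := by
                rw [ENNReal.tsum_mul_left]
                gcongr
                exact hβsum j
        calc (∑' i, s i j) * θ j ≤ (c₂ * w j * β j) * Φ j := mul_le_mul' h3 (hθΦ j)
          _ = _ := by ring
      calc c₅ * t * ∑' j, (∑' i, s i j) * θ j ≤ c₅ * t * (c₂ * H) := by gcongr
        _ = c₅ * c₂ * (t * H) := by ring
        _ ≤ c₅ * c₂ * ((t + H) * (t + H)) := by
            gcongr
            · exact le_self_add
            · exact le_add_self
        _ = _ := by
            rw [← sq]
            norm_cast
    calc lpSeqNorm 2 (fun i => ∑' j, s i j) ≤ (c₅ * c₂ * (t + H) ^ (2 : ℝ)) ^ (1 / 2 : ℝ) :=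
          ENNReal.rpow_le_rpow h1 (by norm_num)
      _ = _ := by
          rw [ENNReal.mul_rpow_of_nonneg _ _ (by norm_num), ← ENNReal.rpow_mul]
          norm_num
  have hρ1 : 1 ≤ ρ := by linarith
  calc lpSeqNorm ρ (fun i => ‖increment K ε (G.indicator b) ξ i‖ₑ)
      ≤ lpSeqNorm ρ (fun i => (∑' j, p i j) + ((∑' j, q i j) + ∑' j, s i j)) :=
        lpSeqNorm_mono (by linarith) hinc
    _ ≤ (∑' i, ∑' j, p i j) + ((∑' i, ∑' j, q i j) + lpSeqNorm ρ fun i => ∑' j, s i j) := by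
        refine (lpSeqNorm_add_le hρ1 _ _).trans (add_le_add (lpSeqNorm_le_tsum hρ1 _) ?_)
        exact (lpSeqNorm_add_le hρ1 _ _).trans (add_le_add (lpSeqNorm_le_tsum hρ1 _) le_rfl)
    _ ≤ c₃ * (t + H) + (c₄ * (t + H) + (c₅ * c₂) ^ (1 / 2 : ℝ) * (t + H)) := by
        gcongr
        · exact hpsum.trans (by gcongr; exact le_add_self)
        · exact hqsum.trans (by gcongr; exact le_self_add)
    _ = _ := by rw [hA]; ring

/-! ### The Calderón–Zygmund decomposition -/

theorem lintegral_enorm_rpow_le_of_ae_le {α : Type*} [MeasurableSpace α] {μ : Measure α}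
    {g : α → ℝ} {p q : ℝ} (hp : 0 ≤ p) (hpq : p ≤ q) {h : ℝ≥0∞} (hh : h ≠ ∞)
    (hg : ∀ᵐ y ∂μ, ‖g y‖ₑ ≤ h) :
    ∫⁻ y, ‖g y‖ₑ ^ q ∂μ ≤ h ^ (q - p) * ∫⁻ y, ‖g y‖ₑ ^ p ∂μ := by
  rw [← lintegral_const_mul' _ _ (ENNReal.rpow_ne_top_of_nonneg (by linarith) hh)]
  refine lintegral_mono_ae ?_
  filter_upwards [hg] with y hy
  have : ‖g y‖ₑ ^ q = ‖g y‖ₑ ^ (q - p) * ‖g y‖ₑ ^ p := by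
    rw [← ENNReal.rpow_add_of_nonneg _ _ (by linarith) hp, sub_add_cancel]
  rw [this]
  gcongr

theorem memLp_ofReal_iff {α : Type*} [MeasurableSpace α] {μ : Measure α} {g : α → ℝ} {p : ℝ}
    (hp : 0 < p) : MemLp g (ENNReal.ofReal p) μ ↔
      AEStronglyMeasurable g μ ∧ ∫⁻ y, ‖g y‖ₑ ^ p ∂μ < ∞ := by
  have := eLpNorm_lt_top_iff_lintegral_rpow_enorm_lt_top (f := g) (μ := μ)
    (ENNReal.ofReal_pos.2 hp).ne' ENNReal.ofReal_ne_top
  rw [ENNReal.toReal_ofReal hp.le] at this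
  rw [MemLp, this]

theorem _root_.MeasureTheory.MemLp.of_ae_le {α : Type*} [MeasurableSpace α] {μ : Measure α}
    {g : α → ℝ} {p q : ℝ} (hg : MemLp g (ENNReal.ofReal p) μ) (hp : 0 < p) (hpq : p ≤ q)
    {h : ℝ≥0∞} (hh : h ≠ ∞) (hgh : ∀ᵐ y ∂μ, ‖g y‖ₑ ≤ h) : MemLp g (ENNReal.ofReal q) μ := by
  rw [memLp_ofReal_iff hp] at hg
  rw [memLp_ofReal_iff (hp.trans_le hpq)]
  exact ⟨hg.1, (lintegral_enorm_rpow_le_of_ae_le hp.le hpq hh hgh).trans_lt (ENNReal.mul_lt_top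
    (ENNReal.rpow_ne_top_of_nonneg (by linarith) hh).lt_top hg.2)⟩

/-- Lebesgue differentiation along centred balls; the factor accounts for the normalisation by `R ^
d` instead of the volume. -/
theorem ae_le_ballMaximal {d : ℕ} {u : Rd d → ℝ≥0∞} (hu : AEMeasurable u volume)
    (hfin : ∫⁻ y, u y ≠ ∞) : ∀ᵐ x, u x ≤ (unitBallVolume d)⁻¹ * ballMaximal u x := by
  filter_upwards [(Besicovitch.vitaliFamily (volume : Measure (Rd d))).ae_tendsto_lintegral_div
    hu hfin] with x hx
  have h1 := hx.comp (Besicovitch.tendsto_filterAt (volume : Measure (Rd d)) x)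
  refine le_of_tendsto h1 ?_
  filter_upwards [self_mem_nhdsWithin] with R hR
  have hR0 : 0 < R := hR
  have h2 := lintegral_closedBall_le_ballMaximal u x hR0
  have h3 : volume (closedBall x R) ≠ 0 := (measure_closedBall_pos _ _ hR0).ne'
  have hp : ENNReal.ofReal (R ^ d) ≠ 0 := by simpa using pow_pos hR0 d
  simp only [Function.comp_apply]
  rw [ENNReal.div_le_iff h3 measure_closedBall_lt_top.ne, volume_closedBall_eq x hR0.le]
  refine h2.trans (le_of_eq ?_)
  calc ENNReal.ofReal (R ^ d) * ballMaximal u x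
      = ((unitBallVolume d)⁻¹ * unitBallVolume d) * (ENNReal.ofReal (R ^ d) * ballMaximal u x) := by
        rw [ENNReal.inv_mul_cancel (unitBallVolume_ne_zero d) (unitBallVolume_ne_top d), one_mul]
    _ = _ := by ring

/-- Disjoint measurable sets `P j` between the balls `B j` and their fivefold dilates `D j`,
with the same union as the dilates. -/
theorem exists_disjoint_between {α ι : Type*} [MeasurableSpace α] [Countable ι] {B D : ι → Set α}
    (hB : ∀ j, MeasurableSet (B j)) (hD : ∀ j, MeasurableSet (D j)) (hBD : ∀ j, B j ⊆ D j)
    (hdisj : Pairwise (Function.onFun Disjoint B)) :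
    ∃ P : ι → Set α, (∀ j, MeasurableSet (P j)) ∧ Pairwise (Function.onFun Disjoint P) ∧
      (∀ j, B j ⊆ P j) ∧ (∀ j, P j ⊆ D j) ∧ ⋃ j, D j ⊆ ⋃ j, P j := by
  obtain ⟨e, he⟩ := exists_injective_nat ι
  -- Each `D j` keeps only those points that are in no `B i` and in no `D i` of smaller index, so
  -- every core `B j` stays whole and the sets become disjoint.
  set P : ι → Set α := fun j => B j ∪ (D j \ ((⋃ i, B i) ∪ ⋃ (i) (_ : e i < e j), D i)) with hP
  refine ⟨P, fun j => ?_, ?_, fun j => subset_union_left, fun j => ?_, ?_⟩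
  · exact (hB j).union ((hD j).diff ((MeasurableSet.iUnion hB).union
      (MeasurableSet.iUnion fun i => MeasurableSet.iUnion fun _ => hD i)))
  · have key : ∀ i j, e i < e j → Disjoint (P i) (P j) := by
      intro i j hij
      refine Set.disjoint_left.2 fun y hi hj => ?_
      rcases hi with hi | hi <;> rcases hj with hj | hj
      · exact Set.disjoint_left.1 (hdisj (fun h => hij.ne (by rw [h]))) hi hj
      · exact hj.2 (Or.inl (mem_iUnion.2 ⟨i, hi⟩))
      · exact hi.2 (Or.inl (mem_iUnion.2 ⟨j, hj⟩))
      · exact hj.2 (Or.inr (mem_iUnion₂.2 ⟨i, hij, hi.1⟩))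
    intro i j hij
    rcases lt_or_gt_of_ne (he.ne hij) with h | h
    · exact key i j h
    · exact (key j i h).symm
  · exact union_subset (hBD j) sdiff_subset
  · intro y hy
    by_cases hyB : y ∈ ⋃ i, B i
    · obtain ⟨i, hi⟩ := mem_iUnion.1 hyB
      exact mem_iUnion.2 ⟨i, Or.inl hi⟩
    · classical
      have hex : ∃ n, ∃ j, e j = n ∧ y ∈ D j := by
        obtain ⟨j, hj⟩ := mem_iUnion.1 hy
        exact ⟨e j, j, rfl, hj⟩
      obtain ⟨j, hj1, hj2⟩ := Nat.find_spec hex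
      refine mem_iUnion.2 ⟨j, Or.inr ⟨hj2, ?_⟩⟩
      rintro (h | h)
      · exact hyB h
      · obtain ⟨i, hi, hiD⟩ := mem_iUnion₂.1 h
        exact Nat.find_min hex (hi.trans_eq hj1) ⟨i, rfl, hiD⟩

/-- A measurable function that is constant on the members of a countable disjoint family. -/
theorem exists_measurable_eq_on {α ι : Type*} [MeasurableSpace α] [Countable ι] {P : ι → Set α}
    (hP : ∀ j, MeasurableSet (P j)) (hdisj : Pairwise (Function.onFun Disjoint P)) (a : ι → ℝ) :
    ∃ e : α → ℝ, Measurable e ∧ (∀ j, ∀ y ∈ P j, e y = a j) ∧ ∀ y, y ∉ ⋃ j, P j → e y = 0 := by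
  set s : (ι → ℝ) → α → ℝ≥0∞ := fun a y =>
    ∑' j, (P j).indicator (fun _ => ENNReal.ofReal (a j)) y with hs
  have hsm : ∀ a, Measurable (s a) := fun a =>
    Measurable.tsum fun j => measurable_const.indicator (hP j)
  have hsP : ∀ a j, ∀ y ∈ P j, s a y = ENNReal.ofReal (a j) := by
    intro a j y hy
    simp only [hs]
    rw [tsum_eq_single j, indicator_of_mem hy]
    intro i hi
    exact indicator_of_notMem (fun h => Set.disjoint_left.1 (hdisj hi) h hy) _
  have hs0 : ∀ a, ∀ y, y ∉ ⋃ j, P j → s a y = 0 := by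
    intro a y hy
    simp only [mem_iUnion, not_exists] at hy
    exact ENNReal.tsum_eq_zero.2 fun j => indicator_of_notMem (hy j) _
  refine ⟨fun y => (s a y).toReal - (s (-a) y).toReal,
    (hsm a).ennreal_toReal.sub (hsm (-a)).ennreal_toReal, fun j y hy => ?_, fun y hy => ?_⟩
  · simp only [hsP _ j y hy, ENNReal.toReal_ofReal', Pi.neg_apply]
    exact max_zero_sub_max_neg_zero_eq_self _
  · simp only [hs0 _ y hy, sub_self]

/-- Stopping-scale balls take the place of dyadic cubes: their disjoint cores have large averages,
while the fivefold dilates have small ones and cover the superlevel set. The atoms live on disjoint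
sets between cores and dilates, `b` is `f` minus its mean on each, and outside them Lebesgue
differentiation bounds `f`. -/
theorem exists_calderonZygmund {d : ℕ} (hd : 0 < d) :
    ∃ C : ℝ≥0, ∀ (f : Rd d → ℝ), Integrable f volume → ∀ h : ℝ≥0∞, h ≠ 0 → h ≠ ∞ →
      ∃ (ι : Type) (_ : Countable ι) (P : ι → Set (Rd d)) (z : ι → Rd d) (ℓ : ι → ℝ)
        (g b : Rd d → ℝ), f = g + b ∧ IsAtomicSum P z ℓ b h ∧ Integrable g volume ∧
        (∀ᵐ y, ‖g y‖ₑ ≤ h) ∧ ∫⁻ y, ‖g y‖ₑ ≤ ∫⁻ y, ‖f y‖ₑ ∧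
        ∑' j, ∫⁻ y in P j, ‖b y‖ₑ ≤ 2 * ∫⁻ y, ‖f y‖ₑ ∧
        h * ∑' j, ENNReal.ofReal (ℓ j ^ d) ≤ C * ∫⁻ y, ‖f y‖ₑ := by
  set v := unitBallVolume d with hv
  have hv0 : v ≠ 0 := unitBallVolume_ne_zero d
  have hvt : v ≠ ∞ := unitBallVolume_ne_top d
  -- The ratio of `h` to the level `τ`: `5 ^ d` is the price of the dilate, `v⁻¹` converts `R ^ d`
  -- to volume through the core, and `2` allows for subtracting the mean.
  set k : ℝ≥0∞ := 2 * 5 ^ d * v⁻¹ with hk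
  have hkt : k ≠ ∞ := by
    have := ENNReal.inv_ne_top.2 hv0
    finiteness
  have hk0 : k ≠ 0 := by
    have := ENNReal.inv_ne_zero.2 hvt
    simp [hk, this]
  refine ⟨(k * 5 ^ d).toNNReal, fun f hf h h0 ht => ?_⟩
  rw [ENNReal.coe_toNNReal (by finiteness)]
  set u : Rd d → ℝ≥0∞ := fun y => ‖f y‖ₑ with hu
  have hum : AEMeasurable u volume := hf.1.enorm
  have hufin : ∫⁻ y, u y ≠ ∞ := hf.2.ne
  set τ : ℝ≥0∞ := h / k with hτ
  have hkτ : k * τ = h := ENNReal.mul_div_cancel hk0 hkt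
  have hτ0 : τ ≠ 0 := (ENNReal.div_pos h0 hkt).ne'
  have hτt : τ ≠ ∞ := ENNReal.div_ne_top ht hk0
  obtain ⟨J, hJ, hpos, hdisj, hlow, hup, hcov⟩ := exists_ball_covering hd hufin hτ0 hτt
  have hJc : Countable J := hJ.to_subtype
  obtain ⟨P, hPm, hPd, hBP, hPD, hPU⟩ := exists_disjoint_between
    (B := fun j : J => closedBall j.1.1 j.1.2) (D := fun j : J => closedBall j.1.1 (5 * j.1.2))
    (fun j => measurableSet_closedBall) (fun j => measurableSet_closedBall)
    (fun j => closedBall_subset_closedBall (by linarith [hpos j.1 j.2]))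
    (fun i j hij => hdisj i.2 j.2 (fun h => hij (Subtype.ext h)))
  have hvolP : ∀ j, ENNReal.ofReal (j.1.2 ^ d) ≤ v⁻¹ * volume (P j) := fun j => by
    calc ENNReal.ofReal (j.1.2 ^ d) = v⁻¹ * v * ENNReal.ofReal (j.1.2 ^ d) := by
          rw [ENNReal.inv_mul_cancel hv0 hvt, one_mul]
      _ = v⁻¹ * volume (closedBall j.1.1 j.1.2) := by
          rw [volume_closedBall_eq _ (hpos j.1 j.2).le]; ring
      _ ≤ _ := by
          gcongr
          exact hBP j
  have hPfin : ∀ j, volume (P j) ≠ ∞ := fun j =>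
    ne_top_of_le_ne_top measure_closedBall_lt_top.ne (measure_mono (hPD j))
  have hPpos : ∀ j, volume (P j) ≠ 0 := fun j => by
    have := measure_closedBall_pos volume j.1.1 (hpos j.1 j.2)
    exact (this.trans_le (measure_mono (hBP j))).ne'
  have hPu : ∀ j, 2 * ∫⁻ y in P j, u y ≤ h * volume (P j) := fun j => by
    calc 2 * ∫⁻ y in P j, u y ≤ 2 * (τ * ENNReal.ofReal ((5 * j.1.2) ^ d)) := by
          gcongr
          exact (lintegral_mono_set (hPD j)).trans (hup j.1 j.2)
      _ = 2 * (τ * (5 ^ d * ENNReal.ofReal (j.1.2 ^ d))) := by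
          rw [mul_pow, ENNReal.ofReal_mul (by positivity), ENNReal.ofReal_pow (by norm_num)]
          norm_num
      _ ≤ 2 * (τ * (5 ^ d * (v⁻¹ * volume (P j)))) := by
          gcongr
          exact hvolP j
      _ = k * τ * volume (P j) := by rw [hk]; ring
      _ = _ := by rw [hkτ]
  set a : J → ℝ := fun j => (volume.real (P j))⁻¹ * ∫ y in P j, f y with ha
  obtain ⟨e, hem, heP, he0⟩ := exists_measurable_eq_on hPm hPd a
  have hreal : ∀ j, volume.real (P j) ≠ 0 := fun j => by
    rw [Measure.real, Ne, ENNReal.toReal_eq_zero_iff]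
    simp [hPpos j, hPfin j]
  have havg : ∀ j, ∫ y in P j, e y = ∫ y in P j, f y := fun j => by
    rw [setIntegral_congr_fun (hPm j) (heP j), setIntegral_const, smul_eq_mul, ha,
      mul_inv_cancel_left₀ (hreal j)]
  have hea : ∀ j, ‖a j‖ₑ * volume (P j) ≤ ∫⁻ y in P j, u y := fun j => by
    have h1 : ‖a j‖ₑ * volume (P j) = ‖∫ y in P j, f y‖ₑ := by
      have h2 : volume (P j) = ‖volume.real (P j)‖ₑ := by
        rw [Real.enorm_of_nonneg measureReal_nonneg, ofReal_measureReal (hPfin j)]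
      rw [h2, ← enorm_mul, ha]
      congr 1
      field_simp [hreal j]
    rw [h1]
    exact enorm_integral_le_lintegral_enorm _
  have heint : ∀ j, ∫⁻ y in P j, ‖e y‖ₑ ≤ ∫⁻ y in P j, u y := fun j => by
    calc ∫⁻ y in P j, ‖e y‖ₑ = ∫⁻ _ in P j, ‖a j‖ₑ :=
          setLIntegral_congr_fun (hPm j) fun y hy => by simp only [heP j y hy]
      _ = ‖a j‖ₑ * volume (P j) := by rw [setLIntegral_const]
      _ ≤ _ := hea j
  set U : Set (Rd d) := ⋃ j, P j with hU
  have hUm : MeasurableSet U := MeasurableSet.iUnion hPm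
  have heU : ∫⁻ y, ‖e y‖ₑ ≤ ∫⁻ y in U, u y := by
    calc ∫⁻ y, ‖e y‖ₑ = ∫⁻ y in U, ‖e y‖ₑ := by
          rw [← lintegral_indicator hUm]
          refine lintegral_congr fun y => ?_
          by_cases hy : y ∈ U
          · rw [indicator_of_mem hy]
          · rw [indicator_of_notMem hy, he0 y hy, enorm_zero]
      _ = ∑' j, ∫⁻ y in P j, ‖e y‖ₑ := lintegral_iUnion hPm hPd _
      _ ≤ ∑' j, ∫⁻ y in P j, u y := ENNReal.tsum_le_tsum heint
      _ = _ := (lintegral_iUnion hPm hPd _).symm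
  have heI : Integrable e volume :=
    ⟨hem.aestronglyMeasurable, (heU.trans (setLIntegral_le_lintegral _ _)).trans_lt hf.2⟩
  have hbP : ∀ j, ∀ y ∈ P j, (U.indicator f - e) y = f y - a j := fun j y hy => by
    rw [Pi.sub_apply, indicator_of_mem (mem_iUnion.2 ⟨j, hy⟩), heP j y hy]
  have hbnorm : ∀ j, ∫⁻ y in P j, ‖(U.indicator f - e) y‖ₑ ≤ 2 * ∫⁻ y in P j, u y := fun j => by
    calc ∫⁻ y in P j, ‖(U.indicator f - e) y‖ₑ ≤ ∫⁻ y in P j, (u y + ‖e y‖ₑ) := by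
          refine setLIntegral_mono' (hPm j) fun y hy => ?_
          rw [hbP j y hy, ← heP j y hy]
          exact enorm_sub_le
      _ = (∫⁻ y in P j, u y) + ∫⁻ y in P j, ‖e y‖ₑ := lintegral_add_left' hum.restrict _
      _ ≤ _ := by
          rw [two_mul]
          exact add_le_add le_rfl (heint j)
  refine ⟨J, hJc, P, fun j => j.1.1, fun j => 5 * j.1.2, Uᶜ.indicator f + e, U.indicator f - e,
    ?_, ⟨hPm, hPd, fun j => ?_, hPD, ?_, fun j => ?_, fun y hy => ?_, fun j => ?_⟩, ?_, ?_, ?_, ?_,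
    ?_⟩
  · ext y
    by_cases hy : y ∈ U <;> simp [hy]
  · have := hpos j.1 j.2
    positivity
  · exact (hf.indicator hUm).sub heI
  · have e1 : ∫ y in P j, (U.indicator f - e) y = ∫ y in P j, (f y - e y) :=
      setIntegral_congr_fun (hPm j) fun y hy => by simp only [hbP j y hy, heP j y hy]
    rw [e1, integral_sub hf.integrableOn heI.integrableOn, havg j, sub_self]
  · rw [Pi.sub_apply, indicator_of_notMem hy, he0 y hy, sub_self]
  · exact (hbnorm j).trans (hPu j)
  · exact (hf.indicator hUm.compl).add heI
  · filter_upwards [ae_le_ballMaximal hum hufin] with y hy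
    by_cases hyU : y ∈ U
    · obtain ⟨j, hj⟩ := mem_iUnion.1 hyU
      rw [Pi.add_apply, indicator_of_notMem (not_not.2 hyU), zero_add, heP j y hj]
      have h1 : ‖a j‖ₑ * volume (P j) ≤ h * volume (P j) :=
        (hea j).trans (le_trans (by rw [two_mul]; exact le_self_add) (hPu j))
      exact (ENNReal.mul_le_mul_iff_left (hPpos j) (hPfin j)).1 h1
    · rw [Pi.add_apply, indicator_of_mem (show y ∈ Uᶜ from hyU), he0 y hyU, add_zero]
      have h1 : ballMaximal u y ≤ τ := by
        by_contra! hcon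
        have := hcov hcon
        refine hyU (hPU ?_)
        simp only [mem_iUnion] at this ⊢
        obtain ⟨i, hi, hyi⟩ := this
        exact ⟨⟨i, hi⟩, hyi⟩
      calc ‖f y‖ₑ ≤ v⁻¹ * τ := hy.trans (by gcongr)
        _ ≤ k * τ := by
            gcongr
            rw [hk]
            refine le_mul_of_one_le_left (zero_le) ?_
            calc (1 : ℝ≥0∞) = 1 * 1 := (one_mul 1).symm
              _ ≤ 2 * 5 ^ d := mul_le_mul' one_le_two (one_le_pow₀ (by norm_num))
        _ = h := hkτ
  · calc ∫⁻ y, ‖(Uᶜ.indicator f + e) y‖ₑ ≤ ∫⁻ y, (Uᶜ.indicator u y + ‖e y‖ₑ) := by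
          refine lintegral_mono fun y => ?_
          refine (enorm_add_le _ _).trans (le_of_eq ?_)
          congr 1
          by_cases hy : y ∈ U <;> simp [hy, hu]
      _ = (∫⁻ y in Uᶜ, u y) + ∫⁻ y, ‖e y‖ₑ := by
          rw [lintegral_add_left' (hum.indicator hUm.compl), lintegral_indicator hUm.compl]
      _ ≤ (∫⁻ y in Uᶜ, u y) + ∫⁻ y in U, u y := by gcongr
      _ = _ := by rw [add_comm, lintegral_add_compl _ hUm]
  · calc ∑' j, ∫⁻ y in P j, ‖(U.indicator f - e) y‖ₑ ≤ ∑' j, 2 * ∫⁻ y in P j, u y :=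
          ENNReal.tsum_le_tsum hbnorm
      _ = 2 * ∫⁻ y in U, u y := by rw [ENNReal.tsum_mul_left, lintegral_iUnion hPm hPd]
      _ ≤ _ := by
          gcongr
          exact Measure.restrict_le_self
  · calc h * ∑' j : J, ENNReal.ofReal ((5 * j.1.2) ^ d)
        = ∑' j : J, k * 5 ^ d * (τ * ENNReal.ofReal (j.1.2 ^ d)) := by
          rw [← ENNReal.tsum_mul_left]
          congr 1
          ext j
          rw [mul_pow, ENNReal.ofReal_mul (by positivity), ENNReal.ofReal_pow (by norm_num), ← hkτ]
          norm_num
          ring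
      _ ≤ ∑' j : J, k * 5 ^ d * ∫⁻ y in closedBall j.1.1 j.1.2, u y := by
          refine ENNReal.tsum_le_tsum fun j => ?_
          gcongr
          exact hlow j.1 j.2
      _ = k * 5 ^ d * ∫⁻ y in ⋃ j : J, closedBall j.1.1 j.1.2, u y := by
          rw [ENNReal.tsum_mul_left,
            lintegral_iUnion (s := fun j : J => closedBall j.1.1 j.1.2)
              (fun j => measurableSet_closedBall)
              (fun i j hij => hdisj i.2 j.2 (fun h => hij (Subtype.ext h)))]
      _ ≤ _ := by
          gcongr
          exact Measure.restrict_le_self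

/-! ### Weak type (1,1) through the Calderón–Zygmund decomposition -/

/-- The integral of the tail of a sum of atoms away from the atoms. -/
theorem lintegral_atomicTail_le {d : ℕ} {K : Rd d → Rd d → ℝ} {C : ℝ} {Ω : ℝ → ℝ}
    (hK : IsRegularKernel K C Ω) {ι : Type*} [Countable ι] {P : ι → Set (Rd d)} {z : ι → Rd d}
    {ℓ : ι → ℝ} {b : Rd d → ℝ} {t : ℝ≥0∞} (hb : IsAtomicSum P z ℓ b t) {E : Set (Rd d)}
    (hE : ∀ x ∈ E, ∀ j, ℓ j ≤ ‖x - z j‖) :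
    ∫⁻ x in E, atomicTail Ω P z ℓ b x ≤
      2 ^ d * (∑' k : ℕ, ENNReal.ofReal (Ω ((1 / 2) ^ k))) * unitBallVolume d *
        ∑' j, ∫⁻ y in P j, ‖b y‖ₑ := by
  have hΩ : Measurable Ω := hK.mono.measurable
  have hm : ∀ j, Measurable fun x =>
      ENNReal.ofReal (Ω (ℓ j / ‖x - z j‖)) * invPow x (z j) := fun j => by
    have := measurable_invPow_left (z j)
    fun_prop
  simp only [atomicTail]
  rw [lintegral_tsum fun j => ((hm j).mul_const _).aemeasurable, ← ENNReal.tsum_mul_left]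
  refine ENNReal.tsum_le_tsum fun j => ?_
  rw [lintegral_mul_const _ (hm j)]
  gcongr
  calc _ ≤ ∫⁻ x in {x | ℓ j ≤ ‖z j - x‖}, ENNReal.ofReal (Ω (ℓ j / ‖z j - x‖)) *
        ENNReal.ofReal (‖z j - x‖ ^ d)⁻¹ * 1 := by
        simp_rw [mul_one, norm_sub_rev (z j), invPow]
        exact lintegral_mono_set fun x hx => hE x hx j
    _ ≤ _ := lintegral_radial_le hK.mono (fun _ => 1) (z j) (hb.pos j)
    _ ≤ _ := by
        gcongr
        simpa using ballMaximal_le_of_le (fun _ : Rd d => le_refl (1 : ℝ≥0∞)) (z j)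

/-- Weak type `(1,1)` of a subadditive operator that is of weak type `(q,q)` and is controlled
on sums of atoms away from their supports. -/
theorem exists_weak_type_one {d : ℕ} (hd : 0 < d) {K : Rd d → Rd d → ℝ} {C : ℝ} {Ω : ℝ → ℝ}
    (hK : IsRegularKernel K C Ω) {S : (Rd d → ℝ) → Rd d → ℝ≥0∞} {q : ℝ} (hq : 1 < q)
    {C₀ : ℝ≥0} (hS : ∀ g : Rd d → ℝ, MemLp g (ENNReal.ofReal q) volume → ∀ s : ℝ≥0∞,
      s ^ q * volume {x | s < S g x} ≤ C₀ * ∫⁻ y, ‖g y‖ₑ ^ q)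
    (hadd : ∀ g b : Rd d → ℝ, MemLp g 1 volume → MemLp b 1 volume → ∀ x,
      S (g + b) x ≤ S g x + S b x)
    {m : ℝ} (hm : 1 ≤ m) {A : ℝ≥0}
    (hA : ∀ (ι : Type) [Countable ι] (P : ι → Set (Rd d)) (z : ι → Rd d) (ℓ : ι → ℝ)
      (b : Rd d → ℝ) (t : ℝ≥0∞), IsAtomicSum P z ℓ b t → ∀ x, (∀ j, 8 * m * ℓ j ≤ ‖x - z j‖) →
      S b x ≤ A * (t + atomicTail Ω P z ℓ b x)) :
    ∃ C : ℝ≥0, ∀ f : Rd d → ℝ, Integrable f volume → ∀ s : ℝ≥0∞,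
      s * volume {x | s < S f x} ≤ C * ∫⁻ y, ‖f y‖ₑ := by
  obtain ⟨C₁, hCZ⟩ := exists_calderonZygmund hd
  -- With `h = s / a` one has `h + A * (h + h) ≤ s`, so `S f x > s` requires `S g x > h`, or `x ∈
  -- E`, or a tail of at least `h`.
  set a : ℝ≥0∞ := 4 * (A + 1) with ha
  have ha0 : a ≠ 0 := by simp [ha]
  have hat : a ≠ ∞ := by finiteness
  set v := unitBallVolume d with hv
  have hvt : v ≠ ∞ := unitBallVolume_ne_top d
  set S₁ : ℝ≥0∞ := ∑' k : ℕ, ENNReal.ofReal (Ω ((1 / 2) ^ k)) with hS₁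
  have hS₁t : S₁ ≠ ∞ := hK.tsum_ne_top
  set c₁ : ℝ≥0∞ := ENNReal.ofReal ((8 * m) ^ d) * v * C₁ with hc₁
  set c₂ : ℝ≥0∞ := 2 ^ d * S₁ * v * 2 with hc₂
  refine ⟨(a * (C₀ + c₁ + c₂)).toNNReal, fun f hf s => ?_⟩
  rw [ENNReal.coe_toNNReal (by finiteness)]
  rcases eq_or_ne s 0 with rfl | hs0
  · simp
  rcases eq_or_ne s ∞ with rfl | hst
  · simp
  set h : ℝ≥0∞ := s / a with hh
  have hah : a * h = s := ENNReal.mul_div_cancel ha0 hat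
  have hh0 : h ≠ 0 := (ENNReal.div_pos hs0 hat).ne'
  have hht : h ≠ ∞ := ENNReal.div_ne_top hst ha0
  obtain ⟨ι, _, P, z, ℓ, g, b, hfgb, hb, hg, hgle, hgf, hbf, hℓ⟩ := hCZ f hf h hh0 hht
  set F : ℝ≥0∞ := ∫⁻ y, ‖f y‖ₑ with hF
  set E : Set (Rd d) := ⋃ j, closedBall (z j) (8 * m * ℓ j) with hE
  set H := atomicTail Ω P z ℓ b with hH
  have hfar : ∀ x ∉ E, ∀ j, 8 * m * ℓ j ≤ ‖x - z j‖ := by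
    intro x hx j
    rw [← dist_eq_norm]
    by_contra! hcon
    exact hx (mem_iUnion.2 ⟨j, mem_closedBall.2 hcon.le⟩)
  have hEm : MeasurableSet E := MeasurableSet.iUnion fun j => measurableSet_closedBall
  have hsub : {x | s < S f x} ⊆ {x | h < S g x} ∪ (E ∪ (Eᶜ ∩ {x | h ≤ H x})) := by
    intro x hx
    by_contra! hcon
    simp only [mem_union, mem_inter_iff, mem_ofPred_eq, not_or, not_and, not_lt, not_le,
      mem_compl_iff] at hcon hx
    obtain ⟨h1, h2, h3⟩ := hcon
    have h3 := h3 h2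
    refine hx.not_ge ?_
    calc S f x ≤ S g x + S b x := by
          rw [hfgb]
          exact hadd g b (memLp_one_iff_integrable.2 hg) (memLp_one_iff_integrable.2 hb.integrable) x
      _ ≤ h + A * (h + H x) := add_le_add h1 (hA ι P z ℓ b h hb x (hfar x h2))
      _ ≤ h + A * (h + h) := by gcongr
      _ ≤ 4 * (A + 1) * h := by
          have e : (4 : ℝ≥0∞) * (A + 1) * h = (h + A * (h + h)) + (3 * h + 2 * A * h) := by ring
          rw [e]
          exact le_self_add
      _ = s := hah
  have hgq : MemLp g (ENNReal.ofReal q) volume := by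
    have h1 := memLp_one_iff_integrable.2 hg
    rw [← ENNReal.ofReal_one] at h1
    exact h1.of_ae_le one_pos hq.le hht hgle
  -- Since `|g| ≤ h`, the integral of `|g| ^ q` is at most `h ^ (q - 1)` times the mass of `f`,
  -- which cancels all but one power of `h`.
  have hgood : h * volume {x | h < S g x} ≤ C₀ * F := by
    have h1 : ∫⁻ y, ‖g y‖ₑ ^ q ≤ h ^ (q - 1) * F := by
      refine (lintegral_enorm_rpow_le_of_ae_le zero_le_one hq.le hht hgle).trans ?_
      simp only [ENNReal.rpow_one]
      gcongr
    have h2 := (hS g hgq h).trans (mul_le_mul_right h1 _)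
    have h3 : h ^ q = h ^ (q - 1) * h := by
      nth_rewrite 3 [← ENNReal.rpow_one h]
      rw [← ENNReal.rpow_add_of_nonneg _ _ (by linarith) zero_le_one, sub_add_cancel]
    rw [h3, mul_assoc, mul_left_comm (C₀ : ℝ≥0∞)] at h2
    exact (ENNReal.mul_le_mul_iff_right (by simp [hh0, hht])
      (ENNReal.rpow_ne_top_of_nonneg (by linarith) hht)).1 h2
  have hEvol : h * volume E ≤ c₁ * F := by
    calc h * volume E ≤ h * ∑' j, volume (closedBall (z j) (8 * m * ℓ j)) := by
          gcongr
          exact measure_iUnion_le _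
      _ = ENNReal.ofReal ((8 * m) ^ d) * v * (h * ∑' j, ENNReal.ofReal (ℓ j ^ d)) := by
          have : ∀ j, volume (closedBall (z j) (8 * m * ℓ j)) =
              ENNReal.ofReal ((8 * m) ^ d) * v * ENNReal.ofReal (ℓ j ^ d) := fun j => by
            have := hb.pos j
            rw [volume_closedBall_eq _ (by positivity), mul_pow (8 * m),
              ENNReal.ofReal_mul (by positivity)]
            ring
          simp_rw [this]
          rw [ENNReal.tsum_mul_left]
          ring
      _ ≤ ENNReal.ofReal ((8 * m) ^ d) * v * (C₁ * F) := by gcongr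
      _ = _ := by rw [hc₁]; ring
  have hHvol : h * volume (Eᶜ ∩ {x | h ≤ H x}) ≤ c₂ * F := by
    have hHm : Measurable H := by
      refine Measurable.tsum fun j => ?_
      have h1 : Measurable Ω := hK.mono.measurable
      have h2 := measurable_invPow_left (z j)
      fun_prop
    calc h * volume (Eᶜ ∩ {x | h ≤ H x}) = h * volume.restrict Eᶜ {x | h ≤ H x} := by
          rw [Measure.restrict_apply (measurableSet_le measurable_const hHm), inter_comm]
      _ ≤ ∫⁻ x in Eᶜ, H x := mul_meas_ge_le_lintegral hHm h
      _ ≤ 2 ^ d * S₁ * v * ∑' j, ∫⁻ y in P j, ‖b y‖ₑ := by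
          refine lintegral_atomicTail_le hK hb fun x hx j => ?_
          have := hb.pos j
          refine le_trans ?_ (hfar x hx j)
          nlinarith
      _ ≤ 2 ^ d * S₁ * v * (2 * F) := by gcongr
      _ = _ := by rw [hc₂]; ring
  calc s * volume {x | s < S f x}
      ≤ a * h * (volume {x | h < S g x} + (volume E + volume (Eᶜ ∩ {x | h ≤ H x}))) := by
        rw [hah]
        gcongr
        exact (measure_mono hsub).trans ((measure_union_le _ _).trans
          (add_le_add le_rfl (measure_union_le _ _)))
    _ = a * (h * volume {x | h < S g x} + (h * volume E + h * volume (Eᶜ ∩ {x | h ≤ H x}))) := by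
        ring
    _ ≤ a * (C₀ * F + (c₁ * F + c₂ * F)) := by gcongr
    _ = _ := by ring

/-! ### From weak to strong bounds -/

theorem boundedOnLpWith_iff {d : ℕ} {S : (Rd d → ℝ) → Rd d → ℝ≥0∞} {p : ℝ} (hp : 0 < p)
    {C : ℝ≥0} : BoundedOnLpWith S p C ↔ ∀ f : Rd d → ℝ, MemLp f (ENNReal.ofReal p) volume →
      AEMeasurable (S f) volume ∧ ∫⁻ x, S f x ^ p ≤ (C : ℝ≥0∞) ^ p * ∫⁻ y, ‖f y‖ₑ ^ p := by
  refine forall_congr' fun f => imp_congr_right fun _ => and_congr_right fun _ => ?_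
  have h0 : ENNReal.ofReal p ≠ 0 := (ENNReal.ofReal_pos.2 hp).ne'
  have hp' : 0 < 1 / p := by positivity
  rw [eLpNorm_eq_lintegral_rpow_enorm_toReal h0 ENNReal.ofReal_ne_top,
    eLpNorm_eq_lintegral_rpow_enorm_toReal h0 ENNReal.ofReal_ne_top, ENNReal.toReal_ofReal hp.le]
  simp only [enorm_eq_self]
  have h1 : (C : ℝ≥0∞) * (∫⁻ y, ‖f y‖ₑ ^ p) ^ (1 / p) =
      ((C : ℝ≥0∞) ^ p * ∫⁻ y, ‖f y‖ₑ ^ p) ^ (1 / p) := by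
    rw [ENNReal.mul_rpow_of_nonneg _ _ hp'.le, ← ENNReal.rpow_mul, mul_one_div_cancel hp.ne',
      ENNReal.rpow_one]
  rw [h1, ENNReal.rpow_le_rpow_iff hp']

theorem exists_boundedOnLpWith {d : ℕ} {S : (Rd d → ℝ) → Rd d → ℝ≥0∞} {p : ℝ} (hp : 0 < p)
    (hS : ∀ f, AEMeasurable (S f) volume) (h : ∃ C : ℝ≥0, ∀ f : Rd d → ℝ,
      MemLp f (ENNReal.ofReal p) volume → ∫⁻ x, S f x ^ p ≤ C * ∫⁻ y, ‖f y‖ₑ ^ p) :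
    ∃ C : ℝ≥0, BoundedOnLpWith S p C := by
  obtain ⟨C, hC⟩ := h
  refine ⟨C ^ (1 / p), (boundedOnLpWith_iff hp).2 fun f hf => ⟨hS f, ?_⟩⟩
  rw [← ENNReal.coe_rpow_of_nonneg _ hp.le, ← NNReal.rpow_mul, one_div_mul_cancel hp.ne',
    NNReal.rpow_one]
  exact hC f hf

theorem rpow_mul_volume_lt_le {d : ℕ} {F : Rd d → ℝ≥0∞} (hF : AEMeasurable F volume) {q : ℝ}
    (hq : 0 < q) (s : ℝ≥0∞) : s ^ q * volume {x | s < F x} ≤ ∫⁻ x, F x ^ q := by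
  refine le_trans ?_ (mul_meas_ge_le_lintegral₀ (hF.pow_const q) (s ^ q))
  refine mul_le_mul_right (measure_mono fun x hx => ?_) _
  exact ENNReal.rpow_le_rpow (le_of_lt hx) hq.le

/-- The Marcinkiewicz interpolation theorem for a subadditive operator. -/
theorem exists_lintegral_rpow_le_of_weak {d : ℕ} {S : (Rd d → ℝ) → Rd d → ℝ≥0∞} {p q : ℝ}
    (hp : 1 < p) (hpq : p < q) (hmeas : ∀ f, AEMeasurable (S f) volume)
    (hadd : ∀ g b : Rd d → ℝ, MemLp g (ENNReal.ofReal q) volume → MemLp b 1 volume → ∀ x,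
      S (g + b) x ≤ S g x + S b x) {C₁ C₂ : ℝ≥0}
    (h₁ : ∀ f : Rd d → ℝ, Integrable f volume → ∀ s : ℝ≥0∞,
      s * volume {x | s < S f x} ≤ C₁ * ∫⁻ y, ‖f y‖ₑ)
    (h₂ : ∀ f : Rd d → ℝ, MemLp f (ENNReal.ofReal q) volume → ∀ s : ℝ≥0∞,
      s ^ q * volume {x | s < S f x} ≤ C₂ * ∫⁻ y, ‖f y‖ₑ ^ q) :
    ∃ C : ℝ≥0, ∀ f : Rd d → ℝ, MemLp f (ENNReal.ofReal p) volume →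
      ∫⁻ x, S f x ^ p ≤ C * ∫⁻ y, ‖f y‖ₑ ^ p := by
  have hp0 : 0 < p := by linarith
  have hq0 : 0 < q := by linarith
  set D : ℝ≥0∞ := 2 ^ p * (ENNReal.ofReal p *
    (C₁ * ENNReal.ofReal (1 / (p - 1)) + C₂ * ENNReal.ofReal (1 / (q - p)))) with hD
  have h2t : (2 : ℝ≥0∞) ^ p ≠ ∞ := by finiteness
  have hDt : D ≠ ∞ := by finiteness
  refine ⟨D.toNNReal, fun f hf => ?_⟩
  rw [ENNReal.coe_toNNReal hDt]
  -- The function is cut at height `τ` along level sets of a measurable representative, so that both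
  -- pieces are measurable.
  set f' := hf.1.mk f with hf'
  have hff' : f =ᵐ[volume] f' := hf.1.ae_eq_mk
  have hf'm : Measurable fun y => ‖f' y‖ₑ := hf.1.stronglyMeasurable_mk.enorm
  have hkey := lintegral_rpow_le_of_distribution (μ := (volume : Measure (Rd d)))
    (F := fun x => 2⁻¹ * S f x) (u := fun y => ‖f' y‖ₑ) ((hmeas f).const_mul _) hf'm.aemeasurable
    hp hpq (A := C₁) (B := C₂) ?_
  · have e1 : ∫⁻ x, S f x ^ p = 2 ^ p * ∫⁻ x, (2⁻¹ * S f x) ^ p := by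
      rw [← lintegral_const_mul' _ _ h2t]
      refine lintegral_congr fun x => ?_
      rw [← ENNReal.mul_rpow_of_nonneg _ _ hp0.le, ← mul_assoc,
        ENNReal.mul_inv_cancel (by norm_num) (by norm_num), one_mul]
    have e2 : ∫⁻ y, ‖f y‖ₑ ^ p = ∫⁻ y, ‖f' y‖ₑ ^ p :=
      lintegral_congr_ae (hff'.mono fun y hy => by simp only [hy])
    rw [e1, e2, hD, mul_assoc]
    gcongr
  · intro t ht
    set τ : ℝ≥0∞ := ENNReal.ofReal t with hτ
    have hτ0 : τ ≠ 0 := (ENNReal.ofReal_pos.2 ht).ne'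
    have hτt : τ ≠ ∞ := ENNReal.ofReal_ne_top
    set s : Set (Rd d) := {y | ‖f' y‖ₑ ≤ τ} with hs
    have hsm : MeasurableSet s := measurableSet_le hf'm measurable_const
    have hsc : {y | τ < ‖f' y‖ₑ} = sᶜ := by
      ext y
      simp [hs]
    have i1 : ∫⁻ y, ‖sᶜ.indicator f y‖ₑ = ∫⁻ y in sᶜ, ‖f' y‖ₑ := by
      simp only [enorm_indicator_eq_indicator_enorm]
      rw [lintegral_indicator hsm.compl]
      exact lintegral_congr_ae (ae_restrict_of_ae (hff'.mono fun y hy => by simp only [hy]))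
    have i2 : ∫⁻ y, ‖s.indicator f y‖ₑ ^ q = ∫⁻ y in s, ‖f' y‖ₑ ^ q := by
      rw [← lintegral_indicator hsm]
      refine lintegral_congr_ae (hff'.mono fun y hy => ?_)
      by_cases hys : y ∈ s
      · simp only [indicator_of_mem hys, hy]
      · simp only [indicator_of_notMem hys, enorm_zero, ENNReal.zero_rpow_of_pos hq0]
    have hg : MemLp (s.indicator f) (ENNReal.ofReal q) volume := by
      refine (hf.indicator hsm).of_ae_le hp0 hpq.le hτt (hff'.mono fun y hy => ?_)
      by_cases hys : y ∈ s
      · rw [indicator_of_mem hys, hy]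
        exact hys
      · simp [indicator_of_notMem hys]
    have hb : Integrable (sᶜ.indicator f) volume := by
      refine ⟨hf.1.indicator hsm.compl, ?_⟩
      rw [HasFiniteIntegral, i1]
      have hfin : ∫⁻ y, ‖f' y‖ₑ ^ p < ∞ := by
        exact ((memLp_ofReal_iff hp0).1 (hf.ae_eq hff')).2
      have hle : τ ^ (p - 1) * ∫⁻ y in sᶜ, ‖f' y‖ₑ ≤ ∫⁻ y, ‖f' y‖ₑ ^ p := by
        rw [← lintegral_const_mul _ hf'm]
        refine le_trans (setLIntegral_mono' hsm.compl fun y hy => ?_)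
          (setLIntegral_le_lintegral sᶜ _)
        have hy' : τ ≤ ‖f' y‖ₑ := (not_le.1 (show ¬ ‖f' y‖ₑ ≤ τ from hy)).le
        calc τ ^ (p - 1) * ‖f' y‖ₑ ≤ ‖f' y‖ₑ ^ (p - 1) * ‖f' y‖ₑ ^ (1 : ℝ) := by
              rw [ENNReal.rpow_one]
              gcongr
          _ = _ := by
              rw [← ENNReal.rpow_add_of_nonneg _ _ (by linarith) zero_le_one, sub_add_cancel]
      refine lt_top_iff_ne_top.2 fun htop => (hle.trans_lt hfin).ne ?_
      rw [htop, ENNReal.mul_top]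
      simp [hτ0, hτt]
    have hsub : {x | τ < 2⁻¹ * S f x} ⊆
        {x | τ < S (sᶜ.indicator f) x} ∪ {x | τ < S (s.indicator f) x} := by
      intro x hx
      by_contra! hcon
      simp only [mem_union, mem_ofPred_eq, not_or, not_lt] at hcon hx
      refine hx.not_ge ?_
      calc 2⁻¹ * S f x ≤ 2⁻¹ * (τ + τ) := by
            gcongr
            conv_lhs => rw [← indicator_self_add_compl s f]
            exact (hadd _ _ hg (memLp_one_iff_integrable.2 hb) x).trans
              (add_le_add hcon.2 hcon.1)
        _ = τ := by
            rw [← two_mul, ← mul_assoc, ENNReal.inv_mul_cancel (by norm_num) (by norm_num), one_mul]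
    have j1 : volume {x | τ < S (sᶜ.indicator f) x} ≤
        C₁ * ENNReal.ofReal (t ^ (-1 : ℝ)) * ∫⁻ y in sᶜ, ‖f' y‖ₑ := by
      have := h₁ _ hb τ
      rw [i1, mul_comm τ] at this
      rw [← ENNReal.ofReal_rpow_of_pos ht, ENNReal.rpow_neg_one, mul_right_comm]
      exact (ENNReal.le_div_iff_mul_le (Or.inl hτ0) (Or.inl hτt)).2 this
    have j2 : volume {x | τ < S (s.indicator f) x} ≤
        C₂ * ENNReal.ofReal (t ^ (-q)) * ∫⁻ y in s, ‖f' y‖ₑ ^ q := by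
      have := h₂ _ hg τ
      rw [i2, mul_comm (τ ^ q)] at this
      rw [← ENNReal.ofReal_rpow_of_pos ht, ENNReal.rpow_neg, mul_right_comm]
      exact (ENNReal.le_div_iff_mul_le (Or.inl (by simp [hτ0, hτt]))
        (Or.inl (ENNReal.rpow_ne_top_of_nonneg hq0.le hτt))).2 this
    rw [hsc]
    exact (measure_mono hsub).trans ((measure_union_le _ _).trans (add_le_add j1 j2))

/-! ### The grand maximal operator -/

/-- The variation is subadditive and even, and `sᶜ.indicator f` is `f` minus `s.indicator f`. -/
theorem IsTruncatable.variation_compl_indicator_le {d : ℕ} {K : Rd d → Rd d → ℝ} {f : Rd d → ℝ}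
    (hf : IsTruncatable K f) {s : Set (Rd d)} (hs : MeasurableSet s) {ρ : ℝ} (hρ : 1 ≤ ρ)
    (x : Rd d) :
    variation K ρ (sᶜ.indicator f) x ≤ variation K ρ f x + variation K ρ (s.indicator f) x := by
  have hneg : IsTruncatable K (-s.indicator f) := fun y ε hε => by
    simpa only [Pi.neg_apply, mul_neg] using! (hf.indicator hs y ε hε).neg
  have e1 : sᶜ.indicator f = f + -s.indicator f := by
    rw [eq_add_neg_iff_add_eq, indicator_compl_add_self]
  have e2 : variation K ρ (-s.indicator f) x = variation K ρ (s.indicator f) x := by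
    have : ∀ ε, truncation K ε (-s.indicator f) x = -truncation K ε (s.indicator f) x := fun ε => by
      simp only [truncation, Pi.neg_apply, mul_neg, integral_neg]
    simp only [variation, this, neg_sub_neg]
    simp only [enorm_sub_rev]
  rw [e1, ← e2]
  exact hf.variation_add_le hneg hρ x

/-- By the oscillation estimate it suffices to find one `ξ'` in the cube where the variation of `f
χ_{(3Q)ᶜ}` is small, hence one where those of `f` and of `f χ_{3Q}` are. Chebyshev's inequality for
the first and weak type `(1,1)` for the second provide it. -/
theorem exists_grandMaximal_le {d : ℕ} (hd : 0 < d) {K : Rd d → Rd d → ℝ} {C : ℝ} {Ω : ℝ → ℝ}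
    (hK : IsRegularKernel K C Ω) {r ρ : ℝ} (hr : 1 < r) (hrρ : r ≤ ρ) {C₁ : ℝ≥0}
    (h₁ : ∀ f : Rd d → ℝ, Integrable f volume → ∀ s : ℝ≥0∞,
      s * volume {x | s < variation K ρ f x} ≤ C₁ * ∫⁻ y, ‖f y‖ₑ) :
    ∃ A : ℝ≥0, ∀ f : Rd d → ℝ, IsTruncatable K f → LocallyIntegrable f volume →
      AEMeasurable (variation K ρ f) volume → ∀ x, grandMaximal K ρ f x ≤
        A * (ballMaximal (fun y => ‖f y‖ₑ) x + ballMaximal (fun y => ‖f y‖ₑ ^ r) x ^ (1 / r) +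
          ballMaximal (variation K ρ f) x) := by
  obtain ⟨A, hA⟩ := exists_variation_le_of_mem_cube hd hK hr hrρ
  have hd1 : (1 : ℝ) ≤ d := by exact_mod_cast hd
  set v := unitBallVolume d with hv
  have hv0 : v ≠ 0 := unitBallVolume_ne_zero d
  have hvt : v ≠ ∞ := unitBallVolume_ne_top d
  have hvi : v⁻¹ ≠ ∞ := ENNReal.inv_ne_top.2 hv0
  -- The ratio of `(2dl)^d`, for the ball about `x` that contains `3Q`, to the volume of the ball of
  -- radius `l / 2` inside `Q`.
  set k : ℝ≥0∞ := v⁻¹ * ENNReal.ofReal ((4 * d) ^ d) with hk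
  have hkt : k ≠ ∞ := by finiteness
  set B : ℝ≥0∞ := 2 * k * (1 + C₁) + A with hB
  refine ⟨B.toNNReal, fun f hft hfl hfV x => ?_⟩
  rw [ENNReal.coe_toNNReal (by finiteness)]
  set a := ballMaximal (fun y => ‖f y‖ₑ) x
  set b := ballMaximal (fun y => ‖f y‖ₑ ^ r) x ^ (1 / r)
  set e := ballMaximal (variation K ρ f) x
  refine iSup₂_le fun c l => iSup₂_le fun hl hx => ?_
  have hQ : MeasurableSet (cube c l) := measurableSet_cube c l
  refine essSup_le_of_ae_le _ ?_
  filter_upwards [ae_restrict_mem hQ] with ξ hξ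
  set g := (cube c (3 * l)).indicator f with hg
  have h3Q : cube c (3 * l) ⊆ closedBall x (2 * d * l) := fun y hy => by
    rw [mem_closedBall, dist_eq_norm]
    have := norm_sub_le_of_mem_cube hy hx
    linarith
  have hQx : cube c l ⊆ closedBall x (2 * d * l) := fun y hy => by
    rw [mem_closedBall, dist_eq_norm]
    have := norm_sub_le_of_mem_cube hy hx
    nlinarith
  have hgi : Integrable g volume :=
    ((hfl.integrableOn_isCompact (isCompact_closedBall x (2 * d * l))).mono_set
      h3Q).integrable_indicator (measurableSet_cube _ _)
  set τ₀ : ℝ≥0∞ := k * (e + C₁ * a) with hτ₀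
  -- Above `τ₀` the two exceptional sets together have too little measure to cover the cube.
  have hex : ∀ τ, τ₀ < τ → ∃ ξ' ∈ cube c l, variation K ρ f ξ' ≤ τ ∧ variation K ρ g ξ' ≤ τ := by
    intro τ hτ
    by_contra! hcon
    have hsub : cube c l ⊆ (cube c l ∩ {y | τ < variation K ρ f y}) ∪
        {y | τ < variation K ρ g y} := by
      intro y hy
      by_cases h : variation K ρ f y ≤ τ
      · exact Or.inr (hcon y hy h)
      · exact Or.inl ⟨hy, not_le.1 h⟩
    have m1 : τ * volume (cube c l ∩ {y | τ < variation K ρ f y}) ≤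
        ENNReal.ofReal ((2 * d * l) ^ d) * e := by
      calc τ * volume (cube c l ∩ {y | τ < variation K ρ f y})
          ≤ τ * (volume.restrict (cube c l)) {y | τ ≤ variation K ρ f y} := by
            rw [inter_comm]
            refine mul_le_mul_right (le_trans (measure_mono ?_) (Measure.le_restrict_apply _ _)) _
            exact inter_subset_inter_left _ fun y (hy : τ < _) => hy.le
        _ ≤ ∫⁻ y in cube c l, variation K ρ f y := mul_meas_ge_le_lintegral₀ hfV.restrict τ
        _ ≤ _ := lintegral_subset_le_ballMaximal _ (by positivity) hQx
    have m2 : τ * volume {y | τ < variation K ρ g y} ≤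
        C₁ * (ENNReal.ofReal ((2 * d * l) ^ d) * a) := by
      refine (h₁ g hgi τ).trans ?_
      gcongr
      simp only [hg, enorm_indicator_eq_indicator_enorm]
      rw [lintegral_indicator (measurableSet_cube _ _)]
      exact lintegral_subset_le_ballMaximal _ (by positivity) h3Q
    have m3 : v * ENNReal.ofReal ((l / 2) ^ d) ≤ volume (cube c l) := by
      refine le_trans (le_of_eq ?_) (measure_mono (closedBall_subset_cube c l))
      rw [volume_closedBall_eq _ (by positivity), mul_comm]
    have m4 : ENNReal.ofReal ((2 * d * l) ^ d) =
        ENNReal.ofReal ((4 * d) ^ d) * ENNReal.ofReal ((l / 2) ^ d) := by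
      rw [← ENNReal.ofReal_mul (by positivity), ← mul_pow]
      ring_nf
    have m5 : ENNReal.ofReal ((l / 2) ^ d) * (v * τ) ≤
        ENNReal.ofReal ((l / 2) ^ d) * (ENNReal.ofReal ((4 * d) ^ d) * (e + C₁ * a)) := by
      calc ENNReal.ofReal ((l / 2) ^ d) * (v * τ) = τ * (v * ENNReal.ofReal ((l / 2) ^ d)) := by
            ring
        _ ≤ τ * (volume (cube c l ∩ {y | τ < variation K ρ f y}) +
            volume {y | τ < variation K ρ g y}) := by
            gcongr
            exact m3.trans ((measure_mono hsub).trans (measure_union_le _ _))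
        _ ≤ ENNReal.ofReal ((2 * d * l) ^ d) * e +
            C₁ * (ENNReal.ofReal ((2 * d * l) ^ d) * a) := by
            rw [mul_add]
            exact add_le_add m1 m2
        _ = _ := by rw [m4]; ring
    rw [ENNReal.mul_le_mul_iff_right (by simpa using pow_pos (half_pos hl) d)
      ENNReal.ofReal_ne_top] at m5
    refine hτ.not_ge ?_
    calc τ = v⁻¹ * (v * τ) := by rw [← mul_assoc, ENNReal.inv_mul_cancel hv0 hvt, one_mul]
      _ ≤ v⁻¹ * (ENNReal.ofReal ((4 * d) ^ d) * (e + C₁ * a)) := by gcongr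
      _ = τ₀ := by rw [hτ₀, hk]; ring
  have hbound : ∀ τ, τ₀ < τ →
      variation K ρ ((cube c (3 * l))ᶜ.indicator f) ξ ≤ τ + τ + A * (a + b) := by
    intro τ hτ
    obtain ⟨ξ', hξ', hf1, hf2⟩ := hex τ hτ
    refine (hA c l hl x hx ξ hξ ξ' hξ' f hft hfl.aestronglyMeasurable).trans ?_
    gcongr
    exact (hft.variation_compl_indicator_le (measurableSet_cube _ _) (hr.le.trans hrρ) ξ').trans
      (add_le_add hf1 hf2)
  have hfinal : τ₀ + τ₀ + A * (a + b) ≤ B * (a + b + e) := by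
    calc τ₀ + τ₀ + A * (a + b) ≤ 2 * k * ((1 + C₁) * (a + b + e)) + A * (a + b + e) := by
          have h1 : e + C₁ * a ≤ (1 + C₁) * (a + b + e) := by
            rw [add_mul, one_mul]
            gcongr
            · exact le_add_self
            · rw [add_assoc]
              exact le_self_add
          rw [← two_mul, hτ₀, ← mul_assoc]
          exact add_le_add (mul_le_mul_right h1 _) (mul_le_mul_right le_self_add _)
      _ = _ := by rw [hB]; ring
  refine le_trans ?_ hfinal
  refine ENNReal.le_of_forall_pos_le_add fun ε hε hfin => ?_
  have hτ₀t : τ₀ ≠ ∞ := by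
    rintro h
    simp [h] at hfin
  have hε2 : (ε / 2 : ℝ≥0∞) ≠ 0 := by simp [hε.ne']
  refine (hbound (τ₀ + ε / 2) (ENNReal.lt_add_right hτ₀t hε2)).trans (le_of_eq ?_)
  nth_rewrite 3 [← ENNReal.add_halves (ε : ℝ≥0∞)]
  ring

/-- The three terms of the pointwise bound are treated by the maximal theorem on `L^q`, on `L^{q/r}`
for `|f|^r`, and on `L^q` after the assumed bound for the variation. -/
theorem exists_lintegral_grandMaximal_rpow_le {d : ℕ} (hd : 0 < d) {K : Rd d → Rd d → ℝ} {C : ℝ}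
    {Ω : ℝ → ℝ} (hK : IsRegularKernel K C Ω) {ρ : ℝ} (hρ : 2 ≤ ρ) {q : ℝ} (hq : 1 < q)
    {C₁ C₂ : ℝ≥0} (h₁ : ∀ f : Rd d → ℝ, Integrable f volume → ∀ s : ℝ≥0∞,
      s * volume {x | s < variation K ρ f x} ≤ C₁ * ∫⁻ y, ‖f y‖ₑ)
    (h₂ : ∀ f : Rd d → ℝ, MemLp f (ENNReal.ofReal q) volume →
      AEMeasurable (variation K ρ f) volume ∧
        ∫⁻ x, variation K ρ f x ^ q ≤ C₂ * ∫⁻ y, ‖f y‖ₑ ^ q) :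
    ∃ D : ℝ≥0, ∀ f : Rd d → ℝ, MemLp f (ENNReal.ofReal q) volume →
      ∫⁻ x, grandMaximal K ρ f x ^ q ≤ D * ∫⁻ y, ‖f y‖ₑ ^ q := by
  have hq0 : 0 < q := by linarith
  -- Strictly between `1` and both `q` and `2`: `r > 1` for the shells, `r < q` for the maximal
  -- theorem on `L^{q/r}`, and `r ≤ 2 ≤ ρ`.
  set r : ℝ := (1 + min q 2) / 2 with hr
  have hm1 : 1 < min q 2 := lt_min hq one_lt_two
  have hr1 : 1 < r := by linarith
  have hrq : r < q := by linarith [min_le_left q 2]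
  have hrρ : r ≤ ρ := by linarith [min_le_right q 2]
  obtain ⟨A, hA⟩ := exists_grandMaximal_le hd hK hr1 hrρ h₁
  obtain ⟨M₁, hM₁⟩ := exists_lintegral_ballMaximal_rpow_le hd hq
  obtain ⟨M₂, hM₂⟩ := exists_lintegral_ballMaximal_rpow_le hd
    ((one_lt_div (by linarith)).2 hrq : 1 < q / r)
  set k : ℝ≥0∞ := 2 ^ (q - 1) with hk
  have hkt : k ≠ ∞ := ENNReal.rpow_ne_top_of_nonneg (by linarith) (by norm_num)
  have hAt : (A : ℝ≥0∞) ^ q ≠ ∞ := ENNReal.rpow_ne_top_of_nonneg hq0.le (by norm_num)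
  set D : ℝ≥0∞ := (A : ℝ≥0∞) ^ q * (k * (k * (M₁ + M₂) + M₁ * C₂)) with hD
  refine ⟨D.toNNReal, fun f hf => ?_⟩
  rw [ENNReal.coe_toNNReal (by finiteness)]
  obtain ⟨hVm, hVq⟩ := h₂ f hf
  have hfm : AEMeasurable (fun y => ‖f y‖ₑ) volume := hf.1.enorm
  have hpt := hA f (hK.isTruncatable hd hq.le hf)
    (hf.locallyIntegrable (by rw [← ENNReal.ofReal_one]; exact ENNReal.ofReal_le_ofReal hq.le)) hVm
  set a := ballMaximal fun y => ‖f y‖ₑ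
  set b := ballMaximal fun y => ‖f y‖ₑ ^ r with hb
  set e := ballMaximal (variation K ρ f)
  have ham : Measurable a := measurable_ballMaximal _
  have hbm : Measurable b := measurable_ballMaximal _
  have hbq : ∫⁻ x, (b x ^ (1 / r)) ^ q ≤ M₂ * ∫⁻ y, ‖f y‖ₑ ^ q := by
    have := hM₂ (fun y => ‖f y‖ₑ ^ r) (hfm.pow_const r)
    simp only [← ENNReal.rpow_mul] at this ⊢
    rwa [mul_div_cancel₀ q (by linarith : r ≠ 0), ← one_div_mul_eq_div] at this
  calc ∫⁻ x, grandMaximal K ρ f x ^ q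
      ≤ ∫⁻ x, (A : ℝ≥0∞) ^ q * (k * (k * (a x ^ q + (b x ^ (1 / r)) ^ q) + e x ^ q)) := by
        refine lintegral_mono fun x => ?_
        refine (ENNReal.rpow_le_rpow (hpt x) hq0.le).trans ?_
        rw [ENNReal.mul_rpow_of_nonneg _ _ hq0.le]
        gcongr
        refine (ENNReal.rpow_add_le_mul_rpow_add_rpow _ _ hq.le).trans ?_
        gcongr
        exact ENNReal.rpow_add_le_mul_rpow_add_rpow _ _ hq.le
    _ = (A : ℝ≥0∞) ^ q * (k * (k * ((∫⁻ x, a x ^ q) + ∫⁻ x, (b x ^ (1 / r)) ^ q) +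
          ∫⁻ x, e x ^ q)) := by
        rw [lintegral_const_mul' _ _ hAt, lintegral_const_mul' _ _ hkt,
          lintegral_add_left (by fun_prop), lintegral_const_mul' _ _ hkt,
          lintegral_add_left (by fun_prop)]
    _ ≤ (A : ℝ≥0∞) ^ q * (k * (k * (M₁ * (∫⁻ y, ‖f y‖ₑ ^ q) + M₂ * ∫⁻ y, ‖f y‖ₑ ^ q) +
          M₁ * (C₂ * ∫⁻ y, ‖f y‖ₑ ^ q))) := by
        gcongr
        · exact hM₁ _ hfm
        · exact (hM₁ _ hVm).trans (by gcongr)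
    _ = _ := by ring

theorem BoundedOnLpWith.of_le_indicator {d : ℕ} {S S' : (Rd d → ℝ) → Rd d → ℝ≥0∞} {p : ℝ}
    {C : ℝ≥0} (hS : BoundedOnLpWith S p C) {s : Set (Rd d)} (hs : MeasurableSet s)
    (hm : ∀ f, AEMeasurable (S' f) volume) (hle : ∀ f x, S' f x ≤ S (s.indicator f) x) :
    BoundedOnLpWith S' p C := fun f hf => by
  refine ⟨hm f, le_trans (eLpNorm_mono_enorm fun x => ?_)
    (((hS _ (hf.indicator hs)).2).trans (mul_le_mul_right (eLpNorm_indicator_le f) _))⟩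
  simpa only [enorm_eq_self] using hle f x

theorem WeakTypeOneOneWith.of_le_indicator {d : ℕ} {S S' : (Rd d → ℝ) → Rd d → ℝ≥0∞}
    {C : ℝ≥0} (hS : WeakTypeOneOneWith S C) {s : Set (Rd d)} (hs : MeasurableSet s)
    (hm : ∀ f, AEMeasurable (S' f) volume) (hle : ∀ f x, S' f x ≤ S (s.indicator f) x) :
    WeakTypeOneOneWith S' C := fun f hf => by
  refine ⟨hm f, fun t => le_trans (mul_le_mul_right (measure_mono fun x hx => ?_) _)
    (((hS _ (hf.indicator hs)).2 t).trans (mul_le_mul_right (eLpNorm_indicator_le f) _))⟩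
  exact lt_of_lt_of_le hx (hle f x)

/-- The bounds for the global grand maximal operator. -/
theorem grandMaximal_bounds {d : ℕ} (hd : 0 < d) {K : Rd d → Rd d → ℝ} {C : ℝ} {Ω : ℝ → ℝ}
    (hK : IsRegularKernel K C Ω) {ρ : ℝ} (hρ : 2 ≤ ρ) {q : ℝ} (hq : 1 < q)
    (hV : ∃ C : ℝ≥0, BoundedOnLpWith (variation K ρ) q C) :
    (∀ p : ℝ, 1 < p → p ≤ q → ∃ C : ℝ≥0, BoundedOnLpWith (grandMaximal K ρ) p C) ∧
      ∃ C : ℝ≥0, WeakTypeOneOneWith (grandMaximal K ρ) C := by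
  have hq0 : 0 < q := by linarith
  have hρ1 : 1 ≤ ρ := by linarith
  have hd1 : (1 : ℝ) ≤ d + 1 := by linarith [Nat.cast_nonneg (α := ℝ) d]
  have htr : ∀ f : Rd d → ℝ, MemLp f 1 volume → IsTruncatable K f := fun f hf =>
    hK.isTruncatable hd le_rfl (by rwa [ENNReal.ofReal_one])
  obtain ⟨CV, hCV⟩ := hV
  rw [boundedOnLpWith_iff hq0] at hCV
  have hCVt : (CV : ℝ≥0∞) ^ q = (CV ^ q : ℝ≥0) := (ENNReal.coe_rpow_of_nonneg _ hq0.le).symm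
  rw [hCVt] at hCV
  -- One atomic estimate serves twice: with `ξ = x` and `G = univ` for the variation, and with `ξ`
  -- in a cube containing `x` and `G` the complement of its triple for the grand maximal operator.
  obtain ⟨A, hA⟩ := exists_variation_atomicSum_le hd hK hρ hd1
  obtain ⟨C₁, hC₁⟩ := exists_weak_type_one hd hK hq (S := variation K ρ)
    (fun g hg s => (rpow_mul_volume_lt_le (hCV g hg).1 hq0 s).trans (hCV g hg).2)
    (fun g b hg hb x => (htr g hg).variation_add_le (htr b hb) hρ1 x) hd1 (A := A)
    (fun ι _ P z ℓ b t hb x hx => by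
      have := hA ι P z ℓ b t hb (htr b (memLp_one_iff_integrable.2 hb.integrable)) x x univ
        (isComparable_univ hd1 x) hx
      rwa [indicator_univ] at this)
  obtain ⟨D, hD⟩ := exists_lintegral_grandMaximal_rpow_le hd hK hρ hq hC₁ hCV
  have hm := aemeasurable_grandMaximal K ρ
  have hweak : ∀ g : Rd d → ℝ, MemLp g (ENNReal.ofReal q) volume → ∀ s : ℝ≥0∞,
      s ^ q * volume {x | s < grandMaximal K ρ g x} ≤ D * ∫⁻ y, ‖g y‖ₑ ^ q :=
    fun g hg s => (rpow_mul_volume_lt_le (hm g) hq0 s).trans (hD g hg)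
  obtain ⟨C₂, hC₂⟩ := exists_weak_type_one hd hK hq (S := grandMaximal K ρ) hweak
    (fun g b hg hb x => (htr g hg).grandMaximal_add_le (htr b hb) hρ1 x) hd1 (A := A)
    (fun ι _ P z ℓ b t hb x hx => by
      refine iSup₂_le fun c l => iSup₂_le fun hl hxc => essSup_le_of_ae_le _ ?_
      filter_upwards [ae_restrict_mem (measurableSet_cube c l)] with ξ hξ
      exact hA ι P z ℓ b t hb (htr b (memLp_one_iff_integrable.2 hb.integrable)) x ξ _
        (isComparable_compl_cube hl hxc hξ) hx)
  refine ⟨fun p hp hpq => exists_boundedOnLpWith (by linarith) hm ?_, C₂, fun f hf => ⟨hm f,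
    fun t => ?_⟩⟩
  -- The endpoint `p = q` is the strong bound itself; interpolation needs `p < q`.
  · rcases hpq.eq_or_lt with rfl | hlt
    · exact ⟨D, hD⟩
    · exact exists_lintegral_rpow_le_of_weak hp hlt hm
        (fun g b hg hb x => (hK.isTruncatable hd hq.le hg).grandMaximal_add_le (htr b hb) hρ1 x)
        hC₂ hweak
  · rw [eLpNorm_one_eq_lintegral_enorm]
    exact hC₂ f (memLp_one_iff_integrable.1 hf) t

end CZVariation

end

/-! ### The local and the global bounds -/

theorem proposition2p3 (d : ℕ) (hd : 0 < d)
    (T : Lp ℝ 2 (volume : Measure (Rd d)) →L[ℝ] Lp ℝ 2 (volume : Measure (Rd d)))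
    (K : Rd d → Rd d → ℝ) (hT : IsCZOperator T K)
    (ρ : ℝ) (hρ : 2 < ρ) (q : ℝ) (hq : 1 < q)
    (hV : ∃ C : ℝ≥0, BoundedOnLpWith (variation K ρ) q C) :
    ((∀ p : ℝ, 1 < p → p ≤ q → ∃ C : ℝ≥0, ∀ (c₀ : Rd d) (l₀ : ℝ), 0 < l₀ →
        BoundedOnLpWith (localGrandMaximal K ρ c₀ l₀) p C) ∧
      (∃ C : ℝ≥0, ∀ (c₀ : Rd d) (l₀ : ℝ), 0 < l₀ →
        WeakTypeOneOneWith (localGrandMaximal K ρ c₀ l₀) C)) ∧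
    ((∀ p : ℝ, 1 < p → p ≤ q → ∃ C : ℝ≥0, BoundedOnLpWith (grandMaximal K ρ) p C) ∧
      (∃ C : ℝ≥0, WeakTypeOneOneWith (grandMaximal K ρ) C)) := by
  obtain ⟨C, ω, hω, hCZ⟩ := hT.kernel
  obtain ⟨Ω, hK⟩ := hCZ.exists_isRegularKernel hd hω
  obtain ⟨hstrong, C₁, hweak⟩ := grandMaximal_bounds hd hK hρ.le hq hV
  refine ⟨⟨fun p hp hpq => ?_, C₁, fun c₀ l₀ _ => ?_⟩, hstrong, C₁, hweak⟩
  -- The constant of the global operator is fixed before the cube; restricting `f` to `3Q₀` does not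
  -- increase its norm.
  · obtain ⟨D, hD⟩ := hstrong p hp hpq
    exact ⟨D, fun c₀ l₀ _ => hD.of_le_indicator (measurableSet_cube c₀ (3 * l₀))
      (aemeasurable_localGrandMaximal K ρ c₀ l₀) (localGrandMaximal_le K ρ c₀ l₀)⟩
  · exact hweak.of_le_indicator (measurableSet_cube c₀ (3 * l₀))
      (aemeasurable_localGrandMaximal K ρ c₀ l₀) (localGrandMaximal_le K ρ c₀ l₀)
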